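/- \textbf{Setting.} Let $M=(\mathcal S,s_0,g,\mathcal A,P)$ be a known MDP with finite state space $\mathcal S\ni s_0$, goal state $g\notin\mathcal S$, finite action sets $\mathcal A_s$, set of state-action pairs $\Gamma=\{(s,a):s\in\mathcal S,a\in\mathcal A_s\}$ with $|\Gamma|=SA$ ($S$ the number of states, $A$ the average number of actions), and transition probabilities $P(\cdot\mid s,a)$ on $\mathcal S\cup\{g\}$. A deterministic stationary policy is proper if from every state it reaches $g$ with probability one in finitely many steps; assume that the set $\Pi_{\rm proper}$ of these policies is non-empty. Let $T^\pi(s)$ be the expected number of steps that $\pi$ takes from $s$ to $g$, let $D=\max_{s}\min_{\pi\in\Pi_{\rm proper}}T^\pi(s)$, and let $\pi^f\in\Pi_{\rm proper}$ minimize $T^\pi(s)$ for all $s$ simultaneously. There are $K$ episodes. Before episode $k$ an adaptive environment chooses a cost function $c_k:\Gamma\to[0,1]$ depending on the past (not on the randomness of episode $k$); the learner walks from $s_0$ until it reaches $g$, visiting $(s_k^i,a_k^i)$, $i=1,\dots,I_k$, and then $c_k$ is revealed. With $J_k^\pi(s)$ the expected total cost of $\pi$ from $s$ under $c_k$ and $\pi^\star\in\arg\min_{\pi\in\Pi_{\rm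 proper}}\sum_kJ_k^\pi(s_0)$, the regret is $R_K=\sum_{k=1}^K\sum_{i=1}^{I_k}c_k(s_k^i,a_k^i)-\sum_{k=1}^KJ_k^{\pi^\star}(s_0)$. Put $T_\star=T^{\pi^\star}(s_0)$ and $T_{\max}=\max_sT^{\pi^\star}(s)$ (random if the costs are). \textbf{Algorithm.} Inputs: $T\in\mathbb R$, $H_1\in\mathbb N$, $\delta\in(0,1)$. Put $H_2=\lceil4D\ln\frac{4K}{\delta}\rceil$, $H=H_1+H_2$, $\eta=\min\{\frac12,\sqrt{T\ln(SAHT)/(DK)}\}$, $\lambda=\min\{\frac1H,\sqrt{\ln(1/\delta)/(DTK)}\}$. The loop-free instance $\widetilde M$ has states $(s,h)$ with $s\in\mathcal S\cup\{s_f\}$, $h\in\{1,\dots,H\}$, initial state $(s_0,1)$, goal $g$, the actions $\mathcal A_s$ at $(s,h)$ and a single action $a_f$ at $(s_f,h)$. From $(s,h)$ with $s\in\mathcal S$, $h<H_1$, action $a$ leads to $(s',h+1)$ with probability $P(s'\mid s,a)$ and to $g$ with probability $P(g\mid s,a)$; for $H_1\le h<H$ every action at $(s,h)$ leads to $(s_f,h+1)$;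 $(s_f,h)$ leads to $(s_f,h+1)$ for $h<H$; layer $H$ leads to $g$. Costs are $c_k(s,a,h)=c_k(s,a)$ and $c_k(s_f,a_f,h)=1$. Let $\widetilde\Delta(T)$ be the set of $q(s,a,h)\ge0$ with total mass at most $T$ that satisfy the flow equations of $\widetilde M$ (outflow minus inflow at each state is $1$ at $(s_0,1)$ and $0$ elsewhere), let $\Omega=\{q+\lambda\,h\,q:q\in\widetilde\Delta(T)\}$, where $(h\,q)(s,a,h)=h\cdot q(s,a,h)$, and $\psi(\phi)=\frac1\eta\sum\phi\ln\phi$ with Bregman divergence $D_\psi$. The algorithm takes $\phi_1=q_1+\lambda hq_1\in\arg\min_\Omega\psi$ and $\phi_{k+1}=q_{k+1}+\lambda hq_{k+1}\in\arg\min_{\phi\in\Omega}\{\langle\phi,c_k\rangle+D_\psi(\phi,\phi_k)\}$; in episode $k$ it draws its $h$-th action at state $s$ with probabilities proportional to $q_k(s,\cdot,h)$ for $h\le H_1$ (arbitrarily if $q_k(s,\cdot,h)=0$) and follows $\pi^f$ after $H_1$ steps. \textbf{Theorem.} For every $\delta_0\in(0,1)$ there are constants $C>0$ and $p\in\mathbb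 N$ depending only on $\delta_0$ such that the following holds for every instance, every environment, all $T,H_1$, all $0<\delta\le\delta_0$, and all $K$ with $K^2\ge2H_2$. With probability at least $1-\delta$: whenever $\pi^\star$ is an optimal policy in hindsight with $T\ge T_\star+1$ and $H_1\ge8T_{\max}\ln K$, \[R_K\le C\ln^p(SAHTK)\Big(\sqrt{DTK\ln(1/\delta)}+H\ln(1/\delta)\Big).\] If moreover $K$ is so large that $H^2\ln(1/\delta)\le DTK$, then \[R_K\le C\ln^p(SAHTK)\sqrt{DTK\ln(1/\delta)}=\tilde O\big(\sqrt{DTK\ln(1/\delta)}\big),\] and if in addition $T\le2T_\star$ (for instance $T=T_\star+1$), then \[R_K\le C\ln^p(SAHTK)\sqrt{DT_\star K\ln(1/\delta)}=\tilde O\big(\sqrt{DT_\star K\ln(1/\delta)}\big).\] -/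

import Mathlib

open MeasureTheory Filter Topology
open scoped ENNReal BigOperators

/-- The MDP of a stochastic shortest path instance. `S` is the finite set of non-goal states and
`Γ` the finite set of valid state-action pairs; `src (s, a) = s`, so that the set of actions
available at `s` is the fibre of `src` over `s`. A next state lives in `Option S`, where `none` is
the goal state `g ∉ S`. -/
structure SSP (S Γ : Type*) [Fintype S] where
  s₀ : S
  src : Γ → S
  P : Γ → Option S → ℝ
  P_nonneg : ∀ z y, 0 ≤ P z y
  P_sum : ∀ z, ∑ y, P z y = 1

namespace SSP

section Basic

variable {S Γ : Type*} [Fintype S] [DecidableEq S] [Fintype Γ] [DecidableEq Γ] (M : SSP S Γ)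

/-- `r` is a randomized decision rule: `r (s, a)` is the probability of choosing `a` at `s`. -/
def IsRule (r : Γ → ℝ) : Prop :=
  (∀ z, 0 ≤ r z) ∧ ∀ s, (∑ z, if M.src z = s then r z else 0) = 1

/-! A trajectory is a sequence in `Option Γ`: its `i`-th term (`i = 0, 1, …`) is the state-action
pair of step `i + 1`, or `none` if the goal was reached before that step. -/

/-- Law of the first term of a trajectory started at `s` with decision rule `r`. -/
def startProb (r : Γ → ℝ) (s : S) : Option Γ → ℝ
  | some z => if M.src z = s then r z else 0
  | none => 0

/-- One-step transition law of a trajectory, where `r` is the rule used at the new state. -/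
def stepProb (r : Γ → ℝ) : Option Γ → Option Γ → ℝ
  | some z, some z' => M.P z (some (M.src z')) * r z'
  | some z, none => M.P z none
  | none, some _ => 0
  | none, none => 1

/-- Probability that the trajectory from `s₀` under the non-stationary policy `ρ` (rule `ρ i` at
step `i + 1`) starts with `x 0, …, x n`. -/
def pathProb (ρ : ℕ → Γ → ℝ) (n : ℕ) (x : ℕ → Option Γ) : ℝ :=
  M.startProb (ρ 0) M.s₀ (x 0) *
    ∏ i ∈ Finset.range n, M.stepProb (ρ (i + 1)) (x i) (x (i + 1))

/-- Law of the `i`-th term of the trajectory from `s` under the stationary policy `r`. -/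
def visitProb (r : Γ → ℝ) (s : S) : ℕ → Option Γ → ℝ
  | 0 => M.startProb r s
  | i + 1 => fun y => ∑ x, visitProb r s i x * M.stepProb r x y

/-- The cost-to-go `J^r(s)`: expected total cost until the goal is reached, from `s` under `r`. -/
noncomputable def costToGo (c : Γ → ℝ) (r : Γ → ℝ) (s : S) : ℝ≥0∞ :=
  ∑' i, ∑ z, ENNReal.ofReal (M.visitProb r s i (some z) * c z)

/-- The expected hitting time `T^r(s)` of the goal: expected number of steps until it is reached. -/
noncomputable def hittingTime (r : Γ → ℝ) (s : S) : ℝ≥0∞ :=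
  M.costToGo (fun _ => 1) r s

/-- The randomized rule of a deterministic policy. -/
def det (π : S → Γ) : Γ → ℝ := fun z => if π (M.src z) = z then 1 else 0

/-- The deterministic policies for which, from every state, the goal is reached in finitely many
steps with probability one. -/
def proper : Set (S → Γ) :=
  {π | (∀ s, M.src (π s) = s) ∧
    ∀ s, Tendsto (fun i => M.visitProb (M.det π) s i none) atTop (𝓝 1)}

/-- The diameter `D = max_s min_{π proper} T^π(s)`. -/
noncomputable def diameter : ℝ :=
  (⨆ s, ⨅ π ∈ M.proper, M.hittingTime (M.det π) s).toReal

/-- `π` minimizes the expected hitting time from every state simultaneously. -/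
def IsFast (π : S → Γ) : Prop :=
  π ∈ M.proper ∧ ∀ π' ∈ M.proper, ∀ s, M.hittingTime (M.det π) s ≤ M.hittingTime (M.det π') s

/-- Total expected cost of `π` from `s₀` over `K` episodes with costs `c 0, …, c (K - 1)`. -/
noncomputable def totalCostToGo (K : ℕ) (c : ℕ → Γ → ℝ) (π : S → Γ) : ℝ≥0∞ :=
  ∑ k ∈ Finset.range K, M.costToGo (c k) (M.det π) M.s₀

/-- `π` is a best deterministic proper policy in hindsight. -/
def IsBest (K : ℕ) (c : ℕ → Γ → ℝ) (π : S → Γ) : Prop :=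
  π ∈ M.proper ∧ ∀ π' ∈ M.proper, M.totalCostToGo K c π ≤ M.totalCostToGo K c π'

/-- `T_⋆ = T^π(s₀)` (for `π = π⋆`). -/
noncomputable def tStar (π : S → Γ) : ℝ := (M.hittingTime (M.det π) M.s₀).toReal

/-- `T_max = max_s T^π(s)` (for `π = π⋆`). -/
noncomputable def tMax (π : S → Γ) : ℝ := (⨆ s, M.hittingTime (M.det π) s).toReal

/-- Cost of one term of a trajectory; at the goal nothing is paid. -/
def stepCost (c : Γ → ℝ) : Option Γ → ℝ
  | some z => c z
  | none => 0

/-- The regret `R_K` against `π`, for realized costs `c` and trajectories `x 0, …, x (K - 1)`;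
it is `⊤` if the learner's cost is infinite. -/
noncomputable def regret (K : ℕ) (c : ℕ → Γ → ℝ) (x : ℕ → ℕ → Option Γ) (π : S → Γ) : EReal :=
  ((∑ k ∈ Finset.range K, ∑' i, ENNReal.ofReal (stepCost (c k) (x k i)) : ℝ≥0∞) : EReal)
    - (M.totalCostToGo K c π : EReal)

/-- The set `Δ(T)` of occupancy measures of total mass at most `T`. -/
def occ (T : ℝ) : Set (Γ → ℝ) :=
  {q | (∀ z, 0 ≤ q z) ∧ ∑ z, q z ≤ T ∧
    ∀ s, (∑ z, if M.src z = s then q z else 0) - ∑ z, M.P z (some s) * q z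
      = if s = M.s₀ then 1 else 0}

/-- The interaction of a learner with an adaptive environment over `K` episodes. Episodes are
numbered `0, …, K - 1`, and `𝓕 k` is the information available before episode `k`. The cost `c k`
and the non-stationary policy `ρ k` that the learner executes are determined by `𝓕 k`;
given `𝓕 k`, the trajectory `X k` has the law of the trajectory from `s₀` under `ρ k`. -/
structure IsInteraction {Ω : Type*} {m : MeasurableSpace Ω} (μ : Measure Ω) (𝓕 : Filtration ℕ m)
    (K : ℕ) (c : ℕ → Ω → Γ → ℝ) (ρ : ℕ → Ω → ℕ → Γ → ℝ) (X : ℕ → Ω → ℕ → Option Γ) : Prop where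
  cost_mem : ∀ k < K, ∀ ω z, c k ω z ∈ Set.Icc (0 : ℝ) 1
  cost_meas : ∀ k < K, ∀ z, Measurable[𝓕 k] fun ω => c k ω z
  rule : ∀ k < K, ∀ ω i, M.IsRule (ρ k ω i)
  rule_meas : ∀ k < K, ∀ i z, Measurable[𝓕 k] fun ω => ρ k ω i z
  traj_meas : ∀ k < K, ∀ i y, MeasurableSet[𝓕 (k + 1)] {ω | X k ω i = y}
  traj_law : ∀ k < K, ∀ B, MeasurableSet[𝓕 k] B → ∀ (n : ℕ) (x : ℕ → Option Γ),
    μ (B ∩ {ω | ∀ i ≤ n, X k ω i = x i})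
      = ∫⁻ ω in B, ENNReal.ofReal (M.pathProb (ρ k ω) n x) ∂μ

end Basic

section LoopFree

variable {S Γ : Type*} [Fintype S] (M : SSP S Γ)

/-- Transition function of the loop-free instance. Its states are `(s, j)` with `s : Option S`,
where `none` is the additional fast state `s_f`, and `j : Fin H` stands for the layer `h = j + 1`;
its state-action pairs are `(z, j)` with `z : Option Γ`, where `none` is `(s_f, a_f)`. Below layer
`H₁` the original transitions are followed; from layer `H₁` on one moves to the fast state of the
next layer; the last layer `H` leads to the goal. -/
def loopFreeP (H₁ H : ℕ) (w : Option Γ × Fin H) (y : Option (Option S × Fin H)) : ℝ :=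
  if hj : (w.2 : ℕ) + 1 < H then
    match w.1, y with
    | some z, some (some s, j) =>
        if (w.2 : ℕ) + 1 < H₁ ∧ j = ⟨w.2 + 1, hj⟩ then M.P z (some s) else 0
    | some _, some (none, j) =>
        if H₁ ≤ (w.2 : ℕ) + 1 ∧ j = ⟨w.2 + 1, hj⟩ then 1 else 0
    | some z, none => if (w.2 : ℕ) + 1 < H₁ then M.P z none else 0
    | none, some (none, j) => if j = ⟨w.2 + 1, hj⟩ then 1 else 0
    | none, some (some _, _) => 0
    | none, none => 0
  else if y = none then 1 else 0

lemma loopFreeP_nonneg (H₁ H : ℕ) (w : Option Γ × Fin H) (y : Option (Option S × Fin H)) :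
    0 ≤ M.loopFreeP H₁ H w y := by
  obtain ⟨z, i⟩ := w
  have h1 := M.P_nonneg
  unfold loopFreeP
  by_cases hj : (i : ℕ) + 1 < H
  · simp only [hj, dite_true]
    rcases z with _ | z <;> rcases y with _ | ⟨_ | s, j⟩ <;> simp only <;> try split_ifs
    all_goals first | exact h1 _ _ | norm_num
  · simp only [hj, dite_false]
    split_ifs <;> norm_num

lemma loopFreeP_sum (H₁ H : ℕ) (w : Option Γ × Fin H) :
    ∑ y, M.loopFreeP H₁ H w y = 1 := by
  obtain ⟨z, j⟩ := w
  unfold loopFreeP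
  by_cases hj : (j : ℕ) + 1 < H
  · simp only [hj, dite_true]
    cases z with
    | none => simp [Fintype.sum_option, Fintype.sum_prod_type]
    | some z =>
      have h := M.P_sum z
      rw [Fintype.sum_option] at h
      by_cases h1 : (j : ℕ) + 1 < H₁
      · simp [Fintype.sum_option, Fintype.sum_prod_type, h1, not_le.mpr h1, h]
      · simp [Fintype.sum_option, Fintype.sum_prod_type, h1, not_lt.mp h1]
  · simp only [hj, dite_false]
    rw [Fintype.sum_option]
    simp

/-- The loop-free instance `M̃` with initial state `(s₀, 1)`. -/
def loopFree (H₁ H : ℕ) [NeZero H] : SSP (Option S × Fin H) (Option Γ × Fin H) where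
  s₀ := (some M.s₀, 0)
  src := fun w => (w.1.map M.src, w.2)
  P := M.loopFreeP H₁ H
  P_nonneg := M.loopFreeP_nonneg H₁ H
  P_sum := M.loopFreeP_sum H₁ H

/-- Cost function of the loop-free instance: `c (s, a)` in every layer, and `1` for the fast
action. -/
def loopFreeCost (H : ℕ) (c : Γ → ℝ) (w : Option Γ × Fin H) : ℝ :=
  match w.1 with
  | some z => c z
  | none => 1

/-- The skewed occupancy measure `q + λ · h · q`. -/
def skew {H : ℕ} (lam : ℝ) (q : Option Γ × Fin H → ℝ) : Option Γ × Fin H → ℝ :=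
  fun w => q w + lam * (((w.2 : ℕ) + 1 : ℝ) * q w)

end LoopFree

section OMD

variable {ι : Type*} [Fintype ι]

/-- The regularizer `ψ(φ) = (1/η) ∑ φ ln φ`. -/
noncomputable def entropy (η : ℝ) (φ : ι → ℝ) : ℝ :=
  1 / η * ∑ w, φ w * Real.log (φ w)

/-- The Bregman divergence `D_ψ(u, v) = ψ(u) - ψ(v) - ⟨∇ψ(v), u - v⟩` of the regularizer; the
partial derivatives of `ψ` are `(1/η) (ln v + 1)`. Coordinates at which `u` and `v` both vanish
contribute `0`. -/
noncomputable def bregman (η : ℝ) (u v : ι → ℝ) : ℝ :=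
  entropy η u - entropy η v - ∑ w, 1 / η * (Real.log (v w) + 1) * (u w - v w)

end OMD

section Algorithm

variable {S Γ : Type*} [Fintype S] [DecidableEq S] [Fintype Γ] [DecidableEq Γ] (M : SSP S Γ)

/-- The decision set `Ω = {q + λ · h · q : q ∈ Δ̃(T)}`. -/
def decisionSet (H₁ H : ℕ) [NeZero H] (T lam : ℝ) : Set (Option Γ × Fin H → ℝ) :=
  skew lam '' (M.loopFree H₁ H).occ T

/-- A run of the algorithm over `K` episodes with revealed costs `c 0, …, c (K - 1)`: entropic
online mirror descent over the decision set produces `q 0, …, q (K - 1)`, and in episode `k` the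
executed policy `ρ k` follows `π̃_k(a | (s, h)) ∝ q k (s, a, h)` during the first `H₁` steps
(an arbitrary rule is allowed at states of zero mass) and the fast policy `πf` afterwards. -/
structure IsRun (πf : S → Γ) (H₁ H : ℕ) [NeZero H] (T η lam : ℝ) (K : ℕ) (c : ℕ → Γ → ℝ)
    (q : ℕ → Option Γ × Fin H → ℝ) (ρ : ℕ → ℕ → Γ → ℝ) : Prop where
  mem : ∀ k < K, q k ∈ (M.loopFree H₁ H).occ T
  init : IsMinOn (entropy η) (M.decisionSet H₁ H T lam) (skew lam (q 0))
  update : ∀ k, k + 1 < K →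
    IsMinOn (fun φ => ∑ w, φ w * loopFreeCost H (c k) w + bregman η φ (skew lam (q k)))
      (M.decisionSet H₁ H T lam) (skew lam (q (k + 1)))
  follow : ∀ k < K, ∀ j : Fin H, (j : ℕ) < H₁ → ∀ z,
    ρ k j z * (∑ z', if M.src z' = M.src z then q k (some z', j) else 0) = q k (some z, j)
  fast : ∀ k < K, ∀ i, H₁ ≤ i → ρ k i = M.det πf

/-- `H₂ = ⌈4 D ln (4 K / δ)⌉`. -/
noncomputable def fastHorizon (K : ℕ) (δ : ℝ) : ℕ :=
  ⌈4 * M.diameter * Real.log (4 * K / δ)⌉₊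

/-- `η = min {1/2, √(T ln (S A H T) / (D K))}`; here `S A = |Γ|`. -/
noncomputable def learningRate (T : ℝ) (H K : ℕ) : ℝ :=
  min (1 / 2) (Real.sqrt
    (T * Real.log (Fintype.card Γ * H * T) / (M.diameter * K)))

/-- `λ = min {1/H, √(ln (1/δ) / (D T K))}`. -/
noncomputable def skewness (T : ℝ) (H K : ℕ) (δ : ℝ) : ℝ :=
  min (1 / H) (Real.sqrt (Real.log (1 / δ) / (M.diameter * T * K)))

end Algorithm

end SSP

/-! Mirror descent controls the expected cost of the learner, and a martingale inequality passes
from expected to realized cost. The second step is the delicate one, since a crude variance bound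
for the cost of an episode would bring in the worst-case horizon. Costs lie in `[0, 1]`, so the
squared cost of an episode is at most twice its layer-weighted cost `∑ h · (cost of layer h)`
(`sq_sum_le_weighted`). An exponential supermartingale with parameter `θ = λ / 2`
(`IsInteraction.lintegral_exp_deviation_le`) then gives, up to probability `δ / 2`: realized cost ≤
expected cost + `λ` · (expected weighted cost) + `2 ln (2 / δ) / λ`.

The skewed decision set `q + λ h q` makes mirror descent bound precisely the sum of the first two
terms for the learner by the corresponding quantity for the comparator (`IsRun.occupancy_regret`).
Thus the variance of the learner is exchanged for the weighted cost of `π⋆`. Since `c² ≤ c`, the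
stability term of mirror descent is `η` times the learner's own cost, which can be absorbed; what
remains is of order `η D K` and not `η T K`.

The weighted cost of `π⋆` is the sum over steps of its expected remaining cost (`weighted_cost_le`).
Being optimal from `s₀` only, `π⋆` may have a large remaining cost at some states. However, the gap
between its remaining cost and the optimal one is a supermartingale along its trajectory and starts
near zero. Hence on average the remaining cost at a step is at most that of the fast policy, `D K`,
times the probability of being alive, and the sum over steps is about `D T⋆ K`. Because costs may
vanish, optimal values are taken for costs shifted by a small `ε`.

Truncation is paid for by exponential tails of hitting times (`surv_le_exp`): `π⋆` outlives `H₁`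
layers with probability `O(1 / K²)`, and the fast policy needs more than `H₂` further steps with
probability at most `δ / (2K)`. On the remaining event `tuned_bound` balances `η B`, `λ Bh`, the
entropy range divided by `η` and `ln (1 / δ) / λ`. -/

set_option linter.unusedSectionVars false

namespace SSP

/-! ### Entropic mirror descent with local norms. -/

section MirrorDescent

variable {ι : Type*} [Fintype ι]

/-- Convexity of `x ln x`: the graph lies above its tangent at `y`. The point `x = 0` is covered
because `0 * Real.log 0 = 0`. -/
lemma mul_log_tangent {x y : ℝ} (hx : 0 ≤ x) (hy : 0 < y) :
    y * Real.log y + (Real.log y + 1) * (x - y) ≤ x * Real.log x := by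
  rcases hx.eq_or_lt with rfl | hx
  · simp; nlinarith
  · have h := Real.log_le_sub_one_of_pos (div_pos hy hx)
    rw [Real.log_div hy.ne' hx.ne'] at h
    have h2 : x * (Real.log y - Real.log x) ≤ x * (y / x - 1) :=
      mul_le_mul_of_nonneg_left h hx.le
    have h3 : x * (y / x - 1) = y - x := by field_simp
    nlinarith

/-- The first-order optimality condition for the minimizer of a linear function plus the entropy
along a segment, before passing to the limit. -/
lemma entropy_segment_nonneg {η : ℝ} (hη : 0 < η) {W : Set (ι → ℝ)} (hW : Convex ℝ W)
    (hnn : ∀ φ ∈ W, ∀ w, 0 ≤ φ w) {a u v : ι → ℝ} (hu : u ∈ W) (hv : v ∈ W)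
    (hmin : IsMinOn (fun φ => ∑ w, φ w * a w + entropy η φ) W u) {t : ℝ} (ht : 0 < t)
    (ht1 : t < 1) :
    0 ≤ ∑ w, (a w + 1 / η * (Real.log (u w + t * (v w - u w)) + 1)) * (v w - u w) := by
  set y : ι → ℝ := fun w => u w + t * (v w - u w) with hy
  have hyW : y ∈ W := by
    have := hW hu hv (sub_nonneg.2 ht1.le) ht.le (by ring)
    convert this using 1
    ext w; simp [hy]; ring
  have h1 : ∑ w, u w * a w + entropy η u ≤ ∑ w, y w * a w + entropy η y := hmin hyW
  -- The tangent is taken at the moved point `y`, because at a vanishing coordinate of `u` the slope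
  -- is `-∞`. Since `t < 1`, a vanishing coordinate of `y` also vanishes in `u`.
  have h2 : ∀ w, y w * Real.log (y w) + (Real.log (y w) + 1) * (u w - y w)
      ≤ u w * Real.log (u w) := by
    intro w
    rcases (hnn y hyW w).eq_or_lt with h0 | h0
    · have hu0 := hnn u hu w
      have hv0 := hnn v hv w
      have hu' : u w = 0 := by
        by_contra hcon
        have h3 : 0 < (1 - t) * u w :=
          mul_pos (sub_pos.2 ht1) (lt_of_le_of_ne hu0 (Ne.symm hcon))
        have h4 : y w = (1 - t) * u w + t * v w := by simp [hy]; ring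
        have h5 : 0 ≤ t * v w := by positivity
        linarith
      rw [← h0, hu']
      simp
    · exact mul_log_tangent (hnn u hu w) h0
  have h3 : entropy η y + ∑ w, 1 / η * (Real.log (y w) + 1) * (u w - y w) ≤ entropy η u := by
    unfold entropy
    rw [Finset.mul_sum, Finset.mul_sum, ← Finset.sum_add_distrib]
    refine Finset.sum_le_sum fun w _ => ?_
    have := mul_le_mul_of_nonneg_left (h2 w) (by positivity : 0 ≤ 1 / η)
    linarith
  have h4 : 0 ≤ t * ∑ w, (a w + 1 / η * (Real.log (y w) + 1)) * (v w - u w) := by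
    have e1 : t * ∑ w, (a w + 1 / η * (Real.log (y w) + 1)) * (v w - u w)
        = (∑ w, y w * a w - ∑ w, u w * a w)
          - ∑ w, 1 / η * (Real.log (y w) + 1) * (u w - y w) := by
      rw [Finset.mul_sum, ← Finset.sum_sub_distrib, ← Finset.sum_sub_distrib]
      refine Finset.sum_congr rfl fun w _ => ?_
      have : y w - u w = t * (v w - u w) := by simp [hy]
      linear_combination (-(a w) - 1 / η * (Real.log (y w) + 1)) * this
    rw [e1]; linarith
  exact nonneg_of_mul_nonneg_right h4 ht

/-- The slope of `x ln x` at `0` is `-∞`, so moving from a minimizer towards a point with a larger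
support would lower the objective. This is what makes the formal Bregman divergence, with `Real.log
0 = 0`, legitimate on the whole decision set. -/
lemma eq_zero_of_isMinOn_entropy {η : ℝ} (hη : 0 < η) {W : Set (ι → ℝ)} (hW : Convex ℝ W)
    (hnn : ∀ φ ∈ W, ∀ w, 0 ≤ φ w) {a u v : ι → ℝ} (hu : u ∈ W) (hv : v ∈ W)
    (hmin : IsMinOn (fun φ => ∑ w, φ w * a w + entropy η φ) W u) {w₀ : ι} (h0 : u w₀ = 0) :
    v w₀ = 0 := by
  classical
  by_contra hne
  have hv0 : 0 < v w₀ := lt_of_le_of_ne (hnn v hv w₀) (Ne.symm hne)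
  -- A bound uniform in `t ≤ 1/2` for the other coordinates: the argument of the logarithm is at
  -- most `v w` where `v` exceeds `u`, and at least `u w / 2` elsewhere. The coordinate `w₀`
  -- contributes a positive multiple of `ln t`, which tends to `-∞`.
  set B : ι → ℝ := fun w => a w * (v w - u w) + 1 / η * (v w - u w)
    + 1 / η * ((v w - u w) * Real.log (if u w ≤ v w then v w else u w / 2)) with hB
  have hterm : ∀ t, 0 < t → t ≤ 1 / 2 → ∀ w,
      (a w + 1 / η * (Real.log (u w + t * (v w - u w)) + 1)) * (v w - u w) ≤ B w := by
    intro t ht ht2 w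
    have hu0 := hnn u hu w
    have key : (v w - u w) * Real.log (u w + t * (v w - u w))
        ≤ (v w - u w) * Real.log (if u w ≤ v w then v w else u w / 2) := by
      split_ifs with h
      · rcases h.eq_or_lt with h' | h'
        · simp [h']
        · refine mul_le_mul_of_nonneg_left (Real.log_le_log ?_ ?_) (sub_nonneg.2 h)
          · have := mul_pos ht (sub_pos.2 h'); linarith
          · nlinarith
      · push Not at h
        have hv0 := hnn v hv w
        refine mul_le_mul_of_nonpos_left (Real.log_le_log (by linarith) ?_) (by linarith)
        nlinarith
    have := mul_le_mul_of_nonneg_left key (by positivity : 0 ≤ 1 / η)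
    simp only [hB]
    nlinarith
  have hlog : Tendsto Real.log (𝓝[>] 0) atBot := Real.tendsto_log_nhdsGT_zero
  have hmul : Tendsto (fun t => 1 / η * v w₀ * Real.log t) (𝓝[>] 0) atBot :=
    hlog.const_mul_atBot (by positivity)
  have hev := hmul.eventually (eventually_lt_atBot
    (-(∑ w ∈ Finset.univ.erase w₀, B w + (a w₀ + 1 / η * (Real.log (v w₀) + 1)) * v w₀)))
  have hev2 : ∀ᶠ t : ℝ in 𝓝[>] 0, t < 1 / 2 :=
    (eventually_lt_nhds (by norm_num)).filter_mono nhdsWithin_le_nhds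
  obtain ⟨t, h1, h2, h3⟩ := (hev.and (hev2.and self_mem_nhdsWithin)).exists
  have ht : 0 < t := h3
  have h4 := entropy_segment_nonneg hη hW hnn hu hv hmin ht (by linarith)
  rw [← Finset.add_sum_erase _ _ (Finset.mem_univ w₀)] at h4
  have h5 := Finset.sum_le_sum fun w (_ : w ∈ Finset.univ.erase w₀) => hterm t ht h2.le w
  rw [h0, sub_zero, zero_add, Real.log_mul ht.ne' hv0.ne'] at h4
  nlinarith

/-- The limit `t → 0` of the segment inequality. Coordinates with `u w = 0` contribute nothing,
since `v w = 0` there as well. -/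
lemma entropy_optimality {η : ℝ} (hη : 0 < η) {W : Set (ι → ℝ)} (hW : Convex ℝ W)
    (hnn : ∀ φ ∈ W, ∀ w, 0 ≤ φ w) {a u v : ι → ℝ} (hu : u ∈ W) (hv : v ∈ W)
    (hmin : IsMinOn (fun φ => ∑ w, φ w * a w + entropy η φ) W u) :
    0 ≤ ∑ w, (a w + 1 / η * (Real.log (u w) + 1)) * (v w - u w) := by
  have hlim : Tendsto (fun t : ℝ => ∑ w, (a w + 1 / η *
      (Real.log (u w + t * (v w - u w)) + 1)) * (v w - u w)) (𝓝[>] 0)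
      (𝓝 (∑ w, (a w + 1 / η * (Real.log (u w) + 1)) * (v w - u w))) := by
    refine tendsto_finsetSum _ fun w _ => ?_
    rcases (hnn u hu w).eq_or_lt with h | h
    · have := eq_zero_of_isMinOn_entropy hη hW hnn hu hv hmin h.symm
      simp [this, ← h]
    · have hc : ContinuousAt (fun t : ℝ => (a w + 1 / η *
          (Real.log (u w + t * (v w - u w)) + 1)) * (v w - u w)) 0 := by
        have : ContinuousAt (fun t : ℝ => Real.log (u w + t * (v w - u w))) 0 :=
          ContinuousAt.log (by fun_prop) (by simpa using h.ne')
        fun_prop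
      have := hc.tendsto
      simp only [zero_mul, add_zero] at this
      exact this.mono_left nhdsWithin_le_nhds
  refine ge_of_tendsto hlim ?_
  have hev2 : ∀ᶠ t : ℝ in 𝓝[>] 0, t < 1 :=
    (eventually_lt_nhds (by norm_num)).filter_mono nhdsWithin_le_nhds
  filter_upwards [hev2, self_mem_nhdsWithin] with t h1 h2
  exact entropy_segment_nonneg hη hW hnn hu hv hmin h2 h1

/-- Invert `1 + a + a² / 2 ≤ exp a` and use `(1 + a + a² / 2) (1 - a + a² / 2) = 1 + a⁴ / 4`. -/
lemma exp_neg_le_quadratic {a : ℝ} (ha : 0 ≤ a) : Real.exp (-a) ≤ 1 - a + a ^ 2 / 2 := by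
  have h := Real.quadratic_le_exp_of_nonneg ha
  rw [Real.exp_neg, inv_le_comm₀ (Real.exp_pos a) (by nlinarith [sq_nonneg (a - 1)])]
  refine le_trans ?_ h
  rw [inv_le_iff_one_le_mul₀ (by nlinarith [sq_nonneg (a - 1)])]
  nlinarith [sq_nonneg (a ^ 2)]

/-- Per-coordinate stability of the entropic mirror step. -/
lemma mirror_step_coord {x y a : ℝ} (hx : 0 < x) (hy : 0 ≤ y) (ha : 0 ≤ a) :
    (x - y) * a - (y * Real.log y - x * Real.log x - (Real.log x + 1) * (y - x))
      ≤ x * a ^ 2 / 2 := by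
  have h1 := exp_neg_le_quadratic ha
  have h2 : x * Real.exp (-a) ≤ x * (1 - a + a ^ 2 / 2) := mul_le_mul_of_nonneg_left h1 hx.le
  -- The maximizer over `y` of the left-hand side is `x * exp (-a)`, the unconstrained mirror step;
  -- the tangent there gives the value `x (exp (-a) - 1 + a)`.
  have hz : 0 < x * Real.exp (-a) := by positivity
  have h3 := mul_log_tangent hy hz
  rw [Real.log_mul hx.ne' (Real.exp_pos _).ne', Real.log_exp] at h3
  nlinarith

lemma mirror_step {η : ℝ} (hη : 0 < η) {u v c : ι → ℝ} (hu : ∀ w, 0 ≤ u w) (hv : ∀ w, 0 ≤ v w)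
    (h0 : ∀ w, v w = 0 → u w = 0) (hc : ∀ w, 0 ≤ c w) :
    ∑ w, (v w - u w) * c w - bregman η u v ≤ η / 2 * ∑ w, v w * c w ^ 2 := by
  have e : bregman η u v = ∑ w, 1 / η * (u w * Real.log (u w) - v w * Real.log (v w)
      - (Real.log (v w) + 1) * (u w - v w)) := by
    unfold bregman entropy
    rw [Finset.mul_sum, Finset.mul_sum, ← Finset.sum_sub_distrib, ← Finset.sum_sub_distrib]
    exact Finset.sum_congr rfl fun w _ => by ring
  rw [e, ← Finset.sum_sub_distrib, Finset.mul_sum]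
  refine Finset.sum_le_sum fun w _ => ?_
  rcases (hv w).eq_or_lt with h | h
  · simp [← h, h0 w h.symm]
  · have := mirror_step_coord h (hu w) (mul_nonneg hη.le (hc w))
    have h2 := mul_le_mul_of_nonneg_left this (by positivity : 0 ≤ 1 / η)
    have e1 : 1 / η * (v w * (η * c w) ^ 2 / 2) = η / 2 * (v w * c w ^ 2) := by
      field_simp
    have e2 : 1 / η * ((v w - u w) * (η * c w)) = (v w - u w) * c w := by
      field_simp
    rw [e1, mul_sub, e2] at h2
    exact h2

/-- Regret of entropic online mirror descent in terms of local norms. -/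
theorem mirror_descent_regret {η : ℝ} (hη : 0 < η) {W : Set (ι → ℝ)} (hW : Convex ℝ W)
    (hnn : ∀ φ ∈ W, ∀ w, 0 ≤ φ w) {φ c : ℕ → ι → ℝ} {K : ℕ} (hK : 0 < K)
    (hφ : ∀ k < K, φ k ∈ W) (hc : ∀ k < K, ∀ w, 0 ≤ c k w)
    (hinit : IsMinOn (entropy η) W (φ 0))
    (hupd : ∀ k, k + 1 < K →
      IsMinOn (fun ψ => ∑ w, ψ w * c k w + bregman η ψ (φ k)) W (φ (k + 1)))
    {u : ι → ℝ} (hu : u ∈ W) :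
    ∑ k ∈ Finset.range K, ∑ w, (φ k w - u w) * c k w
      ≤ entropy η u - entropy η (φ 0)
        + η / 2 * ∑ k ∈ Finset.range K, ∑ w, φ k w * c k w ^ 2 := by
  have hinit' : IsMinOn (fun ψ => ∑ w, ψ w * (fun _ => (0 : ℝ)) w + entropy η ψ) W (φ 0) := by
    simpa using hinit
  -- The update objective equals a linear function plus the entropy up to a constant, so every
  -- iterate falls under the two optimality lemmas.
  have hupd' : ∀ k, k + 1 < K → IsMinOn (fun ψ => ∑ w, ψ w *
      (fun w => c k w - 1 / η * (Real.log (φ k w) + 1)) w + entropy η ψ) W (φ (k + 1)) := by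
    intro k hk ψ hψ
    have h : ∑ w, φ (k + 1) w * c k w + bregman η (φ (k + 1)) (φ k)
      ≤ ∑ w, ψ w * c k w + bregman η ψ (φ k) := hupd k hk hψ
    have e : ∀ ψ : ι → ℝ, ∑ w, ψ w * (c k w - 1 / η * (Real.log (φ k w) + 1)) + entropy η ψ
        = ∑ w, ψ w * c k w + bregman η ψ (φ k) + entropy η (φ k)
          - ∑ w, 1 / η * (Real.log (φ k w) + 1) * φ k w := by
      intro ψ
      unfold bregman
      have e1 : ∑ w, ψ w * (c k w - 1 / η * (Real.log (φ k w) + 1))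
          = ∑ w, ψ w * c k w - ∑ w, 1 / η * (Real.log (φ k w) + 1) * ψ w := by
        rw [← Finset.sum_sub_distrib]
        exact Finset.sum_congr rfl fun w _ => by ring
      have e2 : ∑ w, 1 / η * (Real.log (φ k w) + 1) * (ψ w - φ k w)
          = ∑ w, 1 / η * (Real.log (φ k w) + 1) * ψ w
            - ∑ w, 1 / η * (Real.log (φ k w) + 1) * φ k w := by
        rw [← Finset.sum_sub_distrib]
        exact Finset.sum_congr rfl fun w _ => by ring
      rw [e1, e2]; ring
    simp only [Set.mem_ofPred_eq]
    rw [e, e]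
    linarith
  have hsupp : ∀ k < K, ∀ v ∈ W, ∀ w, φ k w = 0 → v w = 0 := by
    intro k hk v hv w hw
    cases k with
    | zero => exact eq_zero_of_isMinOn_entropy hη hW hnn (hφ 0 hk) hv hinit' hw
    | succ k => exact eq_zero_of_isMinOn_entropy hη hW hnn (hφ _ hk) hv (hupd' k hk) hw
  have hstep : ∀ k, k < K → ∀ v ∈ W, ∑ w, (φ k w - v w) * c k w - bregman η v (φ k)
      ≤ η / 2 * ∑ w, φ k w * c k w ^ 2 := fun k hk v hv =>
    mirror_step hη (hnn v hv) (hnn _ (hφ k hk)) (hsupp k hk v hv) (hc k hk)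
  -- The three-point identity for Bregman divergences, combined with first-order optimality of `φ (k
  -- + 1)`.
  have hthree : ∀ k, k + 1 < K → ∑ w, (φ (k + 1) w - u w) * c k w
      ≤ bregman η u (φ k) - bregman η u (φ (k + 1)) - bregman η (φ (k + 1)) (φ k) := by
    intro k hk
    have h := entropy_optimality hη hW hnn (hφ _ hk) hu (hupd' k hk)
    have e : bregman η u (φ k) - bregman η u (φ (k + 1)) - bregman η (φ (k + 1)) (φ k)
        - ∑ w, (φ (k + 1) w - u w) * c k w
        = ∑ w, (c k w - 1 / η * (Real.log (φ k w) + 1)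
          + 1 / η * (Real.log (φ (k + 1) w) + 1)) * (u w - φ (k + 1) w) := by
      have e3 : bregman η u (φ k) - bregman η u (φ (k + 1)) - bregman η (φ (k + 1)) (φ k)
          = ∑ w, 1 / η * (Real.log (φ (k + 1) w) + 1) * (u w - φ (k + 1) w)
            + ∑ w, 1 / η * (Real.log (φ k w) + 1) * (φ (k + 1) w - φ k w)
            - ∑ w, 1 / η * (Real.log (φ k w) + 1) * (u w - φ k w) := by
        unfold bregman; ring
      rw [e3, ← Finset.sum_add_distrib, ← Finset.sum_sub_distrib, ← Finset.sum_sub_distrib]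
      exact Finset.sum_congr rfl fun w _ => by ring
    linarith
  have hone : ∀ k, k + 1 < K → ∑ w, (φ k w - u w) * c k w
      ≤ bregman η u (φ k) - bregman η u (φ (k + 1)) + η / 2 * ∑ w, φ k w * c k w ^ 2 := by
    intro k hk
    have h1 := hthree k hk
    have h2 := hstep k (by omega) _ (hφ _ hk)
    have e : ∑ w, (φ k w - u w) * c k w
        = ∑ w, (φ k w - φ (k + 1) w) * c k w + ∑ w, (φ (k + 1) w - u w) * c k w := by
      rw [← Finset.sum_add_distrib]
      exact Finset.sum_congr rfl fun w _ => by ring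
    linarith
  have hind : ∀ n, n < K → ∑ k ∈ Finset.range n, ∑ w, (φ k w - u w) * c k w
      ≤ bregman η u (φ 0) - bregman η u (φ n)
        + η / 2 * ∑ k ∈ Finset.range n, ∑ w, φ k w * c k w ^ 2 := by
    intro n
    induction n with
    | zero => simp
    | succ n ih =>
      intro hn
      have h1 := ih (by omega)
      have h2 := hone n hn
      rw [Finset.sum_range_succ, Finset.sum_range_succ, mul_add]
      linarith
  -- No update follows the last round, so it is compared with `u` directly; the divergence it leaves
  -- cancels the end term of the telescoping sum.
  have hlast := hstep (K - 1) (by omega) u hu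
  have hpre := hind (K - 1) (by omega)
  have hbreg : bregman η u (φ 0) ≤ entropy η u - entropy η (φ 0) := by
    have h := entropy_optimality hη hW hnn (hφ 0 hK) hu hinit'
    simp only [zero_add] at h
    unfold bregman
    linarith
  obtain ⟨n, rfl⟩ : ∃ n, K = n + 1 := ⟨K - 1, by omega⟩
  simp only [Nat.add_sub_cancel] at hlast hpre
  rw [Finset.sum_range_succ, Finset.sum_range_succ, mul_add]
  linarith

/-- For `u` the logarithms are at most `ln B`. For `v` the tangent of `x ln x` at `1 / N` bounds
each `-v ln v` by `v ln N + 1 / N`, and there are at most `N` coordinates. -/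
lemma entropy_diff_le {η : ℝ} (hη : 0 < η) {u v : ι → ℝ} (hu : ∀ w, 0 ≤ u w)
    (hv : ∀ w, 0 ≤ v w) {R B N : ℝ} (hN : Fintype.card ι ≤ N) (hN1 : 1 ≤ N) (hB : 1 ≤ B)
    (huB : ∀ w, u w ≤ B) (hu1 : ∑ w, u w ≤ R) (hv1 : ∑ w, v w ≤ R) :
    entropy η u - entropy η v ≤ 1 / η * (R * Real.log B + R * Real.log N + 1) := by
  have h1 : ∑ w, u w * Real.log (u w) ≤ R * Real.log B := by
    calc ∑ w, u w * Real.log (u w) ≤ ∑ w, u w * Real.log B := by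
          refine Finset.sum_le_sum fun w _ => ?_
          rcases (hu w).eq_or_lt with h | h
          · simp [← h]
          · exact mul_le_mul_of_nonneg_left (Real.log_le_log h (huB w)) h.le
      _ = (∑ w, u w) * Real.log B := by rw [Finset.sum_mul]
      _ ≤ _ := mul_le_mul_of_nonneg_right hu1 (Real.log_nonneg hB)
  have hN0 : 0 < N := by linarith
  have h2 : ∀ w, -(v w * Real.log (v w)) ≤ v w * Real.log N + 1 / N := by
    intro w
    have h := mul_log_tangent (hv w) (inv_pos.2 hN0)
    rw [Real.log_inv] at h
    have : 1 / N = N⁻¹ := one_div N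
    nlinarith [hv w]
  have h3 : -∑ w, v w * Real.log (v w) ≤ R * Real.log N + 1 := by
    rw [← Finset.sum_neg_distrib]
    calc ∑ w, -(v w * Real.log (v w)) ≤ ∑ w, (v w * Real.log N + 1 / N) :=
          Finset.sum_le_sum fun w _ => h2 w
      _ = (∑ w, v w) * Real.log N + Fintype.card ι / N := by
          rw [Finset.sum_add_distrib, Finset.sum_mul]
          simp [Finset.card_univ, div_eq_mul_inv]
      _ ≤ _ := by
          have := mul_le_mul_of_nonneg_right hv1 (Real.log_nonneg hN1)
          have : (Fintype.card ι : ℝ) / N ≤ 1 := by rw [div_le_one hN0]; exact hN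
          linarith
  unfold entropy
  rw [← mul_sub]
  exact mul_le_mul_of_nonneg_left (by linarith) (by positivity)

end MirrorDescent

end SSP

namespace SSP

/-! ### Marginal laws of trajectories. -/

section Law

variable {S Γ : Type*} [Fintype S] [DecidableEq S] [Fintype Γ] [DecidableEq Γ] (M : SSP S Γ)

/-- Law of the `i`-th term of the trajectory from `s` under the non-stationary policy `ρ`. -/
def law (ρ : ℕ → Γ → ℝ) (s : S) : ℕ → Option Γ → ℝ
  | 0 => M.startProb (ρ 0) s
  | i + 1 => fun y => ∑ x, law ρ s i x * M.stepProb (ρ (i + 1)) x y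

variable {M}

lemma visitProb_eq_law (r : Γ → ℝ) (s : S) (i : ℕ) :
    M.visitProb r s i = M.law (fun _ => r) s i := by
  induction i with
  | zero => rfl
  | succ i ih => ext y; simp only [visitProb, law, ih]

lemma startProb_nonneg {r : Γ → ℝ} (hr : M.IsRule r) (s : S) (y : Option Γ) :
    0 ≤ M.startProb r s y := by
  cases y with
  | none => simp [startProb]
  | some z => simp only [startProb]; split_ifs <;> [exact hr.1 z; exact le_rfl]

lemma stepProb_nonneg {r : Γ → ℝ} (hr : M.IsRule r) (x y : Option Γ) :
    0 ≤ M.stepProb r x y := by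
  cases x <;> cases y <;> simp only [stepProb]
  · exact zero_le_one
  · exact le_rfl
  · exact M.P_nonneg _ _
  · exact mul_nonneg (M.P_nonneg _ _) (hr.1 _)

lemma sum_startProb {r : Γ → ℝ} (hr : M.IsRule r) (s : S) : ∑ y, M.startProb r s y = 1 := by
  rw [Fintype.sum_option]
  simpa [startProb] using hr.2 s

lemma sum_src_mul {r : Γ → ℝ} (hr : M.IsRule r) (f : S → ℝ) :
    ∑ z, f (M.src z) * r z = ∑ s, f s := by
  have h : ∀ z, f (M.src z) * r z = ∑ s, if M.src z = s then f s * r z else 0 := by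
    intro z; simp
  simp_rw [h]
  rw [Finset.sum_comm]
  refine Finset.sum_congr rfl fun s _ => ?_
  have := hr.2 s
  calc ∑ z, (if M.src z = s then f s * r z else 0)
      = f s * ∑ z, (if M.src z = s then r z else 0) := by
        rw [Finset.mul_sum]; exact Finset.sum_congr rfl fun z _ => by split_ifs <;> simp
    _ = f s := by rw [this, mul_one]

lemma sum_stepProb {r : Γ → ℝ} (hr : M.IsRule r) (x : Option Γ) :
    ∑ y, M.stepProb r x y = 1 := by
  rw [Fintype.sum_option]
  cases x with
  | none => simp [stepProb]
  | some z =>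
    simp only [stepProb]
    rw [sum_src_mul hr fun s => M.P z (some s), ← M.P_sum z, Fintype.sum_option]

lemma law_nonneg {ρ : ℕ → Γ → ℝ} (hρ : ∀ i, M.IsRule (ρ i)) (s : S) (i : ℕ) (y : Option Γ) :
    0 ≤ M.law ρ s i y := by
  induction i generalizing y with
  | zero => exact startProb_nonneg (hρ 0) s y
  | succ i ih => exact Finset.sum_nonneg fun x _ => mul_nonneg (ih x) (stepProb_nonneg (hρ _) x y)

lemma sum_law {ρ : ℕ → Γ → ℝ} (hρ : ∀ i, M.IsRule (ρ i)) (s : S) (i : ℕ) :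
    ∑ y, M.law ρ s i y = 1 := by
  induction i with
  | zero => exact sum_startProb (hρ 0) s
  | succ i ih =>
    simp only [law]
    rw [Finset.sum_comm]
    simp_rw [← Finset.mul_sum, sum_stepProb (hρ (i + 1)), mul_one, ih]

end Law

/-! ### Deterministic policies: values, Bellman inequalities, tails and the weighted cost. -/

section Policy

variable {S Γ : Type*} [Fintype S] [DecidableEq S] [Fintype Γ] [DecidableEq Γ] (M : SSP S Γ)

/-- Transition matrix between non-goal states under a deterministic policy. -/
def trans (π : S → Γ) : Matrix S S ℝ := fun s s' => M.P (π s) (some s')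

/-- Expected value of `g` at the state before step `i + 1`, with value `0` at the goal. -/
def iter (π : S → Γ) (i : ℕ) (g : S → ℝ) : S → ℝ := (M.trans π ^ i).mulVec g

/-- Probability that the goal is not reached within `i` steps. -/
def surv (π : S → Γ) (i : ℕ) : S → ℝ := M.iter π i fun _ => 1

/-- Expected total value of `g` along the visited states. -/
noncomputable def val (π : S → Γ) (g : S → ℝ) (s : S) : ℝ := ∑' i, M.iter π i g s

variable {M} {π : S → Γ}

lemma sum_det (hπ : ∀ s, M.src (π s) = s) (f : Γ → ℝ) :
    ∑ z, (if π (M.src z) = z then f z else 0) = ∑ s, f (π s) := by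
  have h : ∀ z, (if π (M.src z) = z then f z else 0) = ∑ s, if π s = z then f z else 0 := by
    intro z
    rw [Finset.sum_eq_single (M.src z)]
    · intro s _ hs
      rw [if_neg]
      rintro rfl
      exact hs (hπ s).symm
    · simp
  simp_rw [h]
  rw [Finset.sum_comm]
  simp

lemma isRule_det (hπ : ∀ s, M.src (π s) = s) : M.IsRule (M.det π) := by
  refine ⟨fun z => by unfold det; split_ifs <;> norm_num, fun s => ?_⟩
  have h := sum_det hπ fun z => if M.src z = s then (1 : ℝ) else 0
  simp only [hπ] at h
  simp only [Finset.sum_ite_eq', Finset.mem_univ, if_true] at h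
  rw [← h]
  refine Finset.sum_congr rfl fun z _ => ?_
  unfold det
  split_ifs <;> rfl

/-- Under a deterministic policy the walk on pairs is the chain on states, so expectations become
powers of a substochastic matrix. -/
lemma visitProb_det (hπ : ∀ s, M.src (π s) = s) (s : S) (i : ℕ) (z : Γ) :
    M.visitProb (M.det π) s i (some z)
      = if π (M.src z) = z then (M.trans π ^ i) s (M.src z) else 0 := by
  induction i generalizing z with
  | zero =>
    simp only [visitProb, startProb, det, pow_zero, Matrix.one_apply, eq_comm (a := s)]
    split_ifs <;> rfl
  | succ i ih =>
    simp only [visitProb]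
    rw [Fintype.sum_option]
    simp only [stepProb, mul_zero, zero_add, ih]
    have h := sum_det hπ fun z' => (M.trans π ^ i) s (M.src z') *
      (M.P z' (some (M.src z)) * M.det π z)
    simp only [hπ] at h
    simp only [ite_mul, zero_mul, h]
    rw [pow_succ, Matrix.mul_apply]
    unfold det trans
    split_ifs <;> simp

lemma sum_visitProb_mul (hπ : ∀ s, M.src (π s) = s) (s : S) (i : ℕ) (f : Γ → ℝ) :
    ∑ z, M.visitProb (M.det π) s i (some z) * f z = M.iter π i (fun s => f (π s)) s := by
  simp only [visitProb_det hπ, ite_mul, zero_mul]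
  rw [sum_det hπ fun z => (M.trans π ^ i) s (M.src z) * f z]
  simp only [hπ]
  rfl

lemma visitProb_none (hπ : ∀ s, M.src (π s) = s) (s : S) (i : ℕ) :
    M.visitProb (M.det π) s i none = 1 - M.surv π i s := by
  have h := sum_law (M := M) (ρ := fun _ => M.det π) (fun _ => isRule_det hπ) s i
  rw [← visitProb_eq_law, Fintype.sum_option] at h
  have h2 := sum_visitProb_mul hπ s i fun _ => 1
  simp only [mul_one] at h2
  unfold surv
  linarith

lemma visitProb_det_nonneg (hπ : ∀ s, M.src (π s) = s) (s : S) (i : ℕ) (y : Option Γ) :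
    0 ≤ M.visitProb (M.det π) s i y := by
  rw [visitProb_eq_law]
  exact law_nonneg (fun _ => isRule_det hπ) s i y

lemma iter_zero (g : S → ℝ) : M.iter π 0 g = g := by simp [iter]

lemma iter_add (i j : ℕ) (g : S → ℝ) : M.iter π (i + j) g = M.iter π i (M.iter π j g) := by
  simp [iter, pow_add]

lemma iter_one (g : S → ℝ) (s : S) :
    M.iter π 1 g s = ∑ s', M.P (π s) (some s') * g s' := by
  simp [iter, trans, Matrix.mulVec, dotProduct]

lemma trans_pow_nonneg (i : ℕ) (s s' : S) : 0 ≤ (M.trans π ^ i) s s' := by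
  induction i generalizing s' with
  | zero => simp only [pow_zero, Matrix.one_apply]; split_ifs <;> norm_num
  | succ i ih =>
    rw [pow_succ, Matrix.mul_apply]
    exact Finset.sum_nonneg fun x _ => mul_nonneg (ih x) (M.P_nonneg _ _)

lemma iter_mono {f g : S → ℝ} (h : ∀ s, f s ≤ g s) (i : ℕ) (s : S) :
    M.iter π i f s ≤ M.iter π i g s :=
  Finset.sum_le_sum fun s' _ => mul_le_mul_of_nonneg_left (h s') (trans_pow_nonneg i s s')

lemma iter_nonneg {g : S → ℝ} (h : ∀ s, 0 ≤ g s) (i : ℕ) (s : S) : 0 ≤ M.iter π i g s :=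
  Finset.sum_nonneg fun s' _ => mul_nonneg (trans_pow_nonneg i s s') (h s')

lemma iter_fun_add (f g : S → ℝ) (i : ℕ) (s : S) :
    M.iter π i (fun s => f s + g s) s = M.iter π i f s + M.iter π i g s := by
  simp [iter, Matrix.mulVec, dotProduct, mul_add, Finset.sum_add_distrib]

lemma iter_fun_sub (f g : S → ℝ) (i : ℕ) (s : S) :
    M.iter π i (fun s => f s - g s) s = M.iter π i f s - M.iter π i g s := by
  simp [iter, Matrix.mulVec, dotProduct, mul_sub, Finset.sum_sub_distrib]

lemma iter_fun_mul (a : ℝ) (g : S → ℝ) (i : ℕ) (s : S) :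
    M.iter π i (fun s => a * g s) s = a * M.iter π i g s := by
  simp only [iter, Matrix.mulVec, dotProduct, Finset.mul_sum]
  exact Finset.sum_congr rfl fun s' _ => by ring

lemma iter_fun_sum {ι : Type*} (t : Finset ι) (f : ι → S → ℝ) (i : ℕ) (s : S) :
    M.iter π i (fun s => ∑ k ∈ t, f k s) s = ∑ k ∈ t, M.iter π i (f k) s := by
  simp only [iter, Matrix.mulVec, dotProduct, Finset.mul_sum]
  rw [Finset.sum_comm]

lemma iter_const (a : ℝ) (i : ℕ) (s : S) : M.iter π i (fun _ => a) s = a * M.surv π i s := by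
  have := iter_fun_mul (M := M) (π := π) a (fun _ => 1) i s
  simpa [surv] using this

lemma iter_le_mul_surv {g : S → ℝ} {a : ℝ} (h : ∀ s, g s ≤ a) (i : ℕ) (s : S) :
    M.iter π i g s ≤ a * M.surv π i s :=
  (iter_mono h i s).trans_eq (iter_const a i s)

lemma surv_nonneg (i : ℕ) (s : S) : 0 ≤ M.surv π i s := iter_nonneg (fun _ => zero_le_one) i s

lemma surv_zero (s : S) : M.surv π 0 s = 1 := by simp [surv, iter_zero]

lemma surv_one_le (s : S) : M.surv π 1 s ≤ 1 := by
  have h1 := M.P_nonneg (π s) none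
  have h2 := M.P_sum (π s)
  rw [Fintype.sum_option] at h2
  rw [surv, iter_one]
  simp only [mul_one]
  linarith

lemma surv_succ_le (i : ℕ) (s : S) : M.surv π (i + 1) s ≤ M.surv π i s := by
  rw [surv, iter_add]
  exact iter_mono surv_one_le i s

lemma surv_anti (s : S) : Antitone fun i => M.surv π i s :=
  antitone_nat_of_succ_le fun i => surv_succ_le i s

lemma surv_le_one (i : ℕ) (s : S) : M.surv π i s ≤ 1 := by
  have := surv_anti (M := M) (π := π) s (Nat.zero_le i)
  simpa [surv_zero] using this

lemma mem_proper_iff : π ∈ M.proper ↔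
    (∀ s, M.src (π s) = s) ∧ ∀ s, Tendsto (fun i => M.surv π i s) atTop (𝓝 0) := by
  refine and_congr_right fun hπ => forall_congr' fun s => ?_
  simp only [visitProb_none hπ]
  constructor
  · intro h
    have := h.const_sub 1
    simpa using this
  · intro h
    have := h.const_sub 1
    simpa using this

/-- As there are finitely many states, some `n` makes all survival probabilities at most `1/2`. Then
partial sums stay below `2 n` by induction: the first `n` terms give at most `n`, the shifted ones
at most `2 n · 1/2`. -/
lemma summable_surv (hπ : π ∈ M.proper) (s : S) : Summable fun i => M.surv π i s := by
  have h := (mem_proper_iff.1 hπ).2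
  have hev : ∀ᶠ n in atTop, ∀ s, M.surv π n s ≤ 1 / 2 :=
    eventually_all.2 fun s => (h s).eventually_le_const (by norm_num)
  obtain ⟨n, hn, hn1⟩ := (hev.and (eventually_ge_atTop 1)).exists
  have key : ∀ N s, ∑ i ∈ Finset.range N, M.surv π i s ≤ 2 * n := by
    intro N
    induction N with
    | zero => intro s; simp
    | succ N ih =>
      intro s
      have h1 : ∑ i ∈ Finset.range (N + 1), M.surv π i s
          ≤ ∑ i ∈ Finset.range (n + N), M.surv π i s :=
        Finset.sum_le_sum_of_subset_of_nonneg (Finset.range_mono (by omega))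
          fun i _ _ => surv_nonneg i s
      have h2 : ∑ i ∈ Finset.range n, M.surv π i s ≤ n := by
        have := Finset.sum_le_sum fun i (_ : i ∈ Finset.range n) => surv_le_one (M := M) (π := π) i s
        simpa using this
      have h3 : ∑ i ∈ Finset.range N, M.surv π (n + i) s
          = M.iter π n (fun s => ∑ i ∈ Finset.range N, M.surv π i s) s := by
        simp only [surv, iter_add]
        rw [iter_fun_sum]
      have h4 := iter_le_mul_surv (M := M) (π := π) ih n s
      have h5 := hn s
      rw [Finset.sum_range_add _ n N, h3] at h1
      have : 2 * (n : ℝ) * M.surv π n s ≤ n := by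
        have : (0 : ℝ) ≤ n := by positivity
        nlinarith
      linarith
  exact summable_of_sum_range_le (fun i => surv_nonneg i s) fun N => key N s

lemma summable_iter (hπ : π ∈ M.proper) {g : S → ℝ} (hg : ∀ s, 0 ≤ g s) (s : S) :
    Summable fun i => M.iter π i g s := by
  have hb : ∀ s', g s' ≤ ∑ s, g s := fun s' =>
    Finset.single_le_sum (f := g) (fun s _ => hg s) (Finset.mem_univ s')
  exact Summable.of_nonneg_of_le (fun i => iter_nonneg hg i s)
    (fun i => iter_le_mul_surv hb i s) ((summable_surv hπ s).mul_left _)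

lemma val_nonneg {g : S → ℝ} (hg : ∀ s, 0 ≤ g s) (s : S) : 0 ≤ M.val π g s :=
  tsum_nonneg fun i => iter_nonneg hg i s

/-- The Markov property: the expected remaining value after `j` steps is the tail of the series from
`j` on. -/
lemma iter_val (hπ : π ∈ M.proper) {g : S → ℝ} (hg : ∀ s, 0 ≤ g s) (j : ℕ) (s : S) :
    M.iter π j (M.val π g) s = ∑' i, M.iter π (j + i) g s := by
  have h : ∀ i, M.iter π (j + i) g s = ∑ s', (M.trans π ^ j) s s' * M.iter π i g s' := by
    intro i; rw [iter_add]; rfl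
  simp_rw [h]
  rw [Summable.tsum_finsetSum fun s' _ => (summable_iter hπ hg s').mul_left _]
  simp_rw [tsum_mul_left]
  rfl

lemma val_eq (hπ : π ∈ M.proper) {g : S → ℝ} (hg : ∀ s, 0 ≤ g s) (s : S) :
    M.val π g s = g s + M.iter π 1 (M.val π g) s := by
  rw [iter_val hπ hg, val, (summable_iter hπ hg s).tsum_eq_zero_add, iter_zero]
  simp only [add_comm]

lemma val_add (hπ : π ∈ M.proper) {f g : S → ℝ} (hf : ∀ s, 0 ≤ f s) (hg : ∀ s, 0 ≤ g s) (s : S) :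
    M.val π (fun s => f s + g s) s = M.val π f s + M.val π g s := by
  simp only [val, iter_fun_add]
  exact (summable_iter hπ hf s).tsum_add (summable_iter hπ hg s)

lemma val_const (a : ℝ) (s : S) :
    M.val π (fun _ => a) s = a * M.val π (fun _ => 1) s := by
  simp only [val]
  rw [← tsum_mul_left]
  simp only [iter_const, one_mul]

lemma val_mono (hπ : π ∈ M.proper) {f g : S → ℝ} (hf : ∀ s, 0 ≤ f s) (hfg : ∀ s, f s ≤ g s)
    (s : S) : M.val π f s ≤ M.val π g s :=
  (summable_iter hπ hf s).tsum_le_tsum (fun i => iter_mono hfg i s)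
    (summable_iter hπ (fun s => (hf s).trans (hfg s)) s)

lemma val_sum (hπ : π ∈ M.proper) {ι : Type*} (t : Finset ι) {f : ι → S → ℝ}
    (hf : ∀ k ∈ t, ∀ s, 0 ≤ f k s) (s : S) :
    M.val π (fun s => ∑ k ∈ t, f k s) s = ∑ k ∈ t, M.val π (f k) s := by
  simp only [val, iter_fun_sum]
  exact Summable.tsum_finsetSum fun k hk => summable_iter hπ (hf k hk) s

lemma costToGo_det (hπ : π ∈ M.proper) {c : Γ → ℝ} (hc : ∀ z, 0 ≤ c z) (s : S) :
    M.costToGo c (M.det π) s = ENNReal.ofReal (M.val π (fun s => c (π s)) s) := by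
  unfold costToGo val
  rw [ENNReal.ofReal_tsum_of_nonneg (fun i => iter_nonneg (fun s => hc _) i s)
    (summable_iter hπ (fun s => hc _) s)]
  refine tsum_congr fun i => ?_
  rw [← sum_visitProb_mul hπ.1, ENNReal.ofReal_sum_of_nonneg]
  exact fun z _ => mul_nonneg (visitProb_det_nonneg hπ.1 _ _ _) (hc z)

lemma hittingTime_det (hπ : π ∈ M.proper) (s : S) :
    M.hittingTime (M.det π) s = ENNReal.ofReal (M.val π (fun _ => 1) s) :=
  costToGo_det hπ (fun _ => zero_le_one) s

lemma one_le_val_one (hπ : π ∈ M.proper) (s : S) : 1 ≤ M.val π (fun _ => 1) s := by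
  rw [val_eq hπ (fun _ => zero_le_one)]
  have := iter_nonneg (M := M) (π := π) (val_nonneg (M := M) (π := π)
    (g := fun _ => 1) fun _ => zero_le_one) 1 s
  linarith

/-- A function that decreases by at least a positive cost in every step certifies properness and
dominates the cost-to-go. -/
lemma val_le_of_supersolution (hsrc : ∀ s, M.src (π s) = s) {g W : S → ℝ} {ε : ℝ} (hε : 0 < ε)
    (hg : ∀ s, ε ≤ g s) (hW : ∀ s, 0 ≤ W s) (h : ∀ s, g s + M.iter π 1 W s ≤ W s) :
    π ∈ M.proper ∧ ∀ s, M.val π g s ≤ W s := by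
  have hg0 : ∀ s, 0 ≤ g s := fun s => hε.le.trans (hg s)
  have key : ∀ N s, ∑ i ∈ Finset.range N, M.iter π i g s + M.iter π N W s ≤ W s := by
    intro N
    induction N with
    | zero => intro s; simp [iter_zero]
    | succ N ih =>
      intro s
      have h1 := ih s
      have h2 := iter_mono (M := M) (π := π) h N s
      rw [iter_fun_add, ← iter_add] at h2
      rw [Finset.sum_range_succ]
      linarith
  have key2 : ∀ s N, ∑ i ∈ Finset.range N, M.iter π i g s ≤ W s := fun s N => by
    have := key N s
    have := iter_nonneg (M := M) (π := π) hW N s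
    linarith
  have hsum : ∀ s, Summable fun i => M.iter π i g s := fun s =>
    summable_of_sum_range_le (fun i => iter_nonneg hg0 i s) (key2 s)
  -- Each step alive costs at least `ε`, so a finite total cost makes the survival probabilities
  -- summable.
  have hsurv : ∀ s, Tendsto (fun i => M.surv π i s) atTop (𝓝 0) := by
    intro s
    have h1 : Summable fun i => ε * M.surv π i s :=
      Summable.of_nonneg_of_le (fun i => mul_nonneg hε.le (surv_nonneg i s))
        (fun i => by rw [← iter_const]; exact iter_mono hg i s) (hsum s)
    exact ((summable_mul_left_iff hε.ne').1 h1).tendsto_atTop_zero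
  exact ⟨mem_proper_iff.2 ⟨hsrc, hsurv⟩, fun s =>
    Real.tsum_le_of_sum_range_le (fun i => iter_nonneg hg0 i s) (key2 s)⟩

/-- Unroll the inequality `N` times; `V` is bounded above and `π` is proper, so the remainder has
limit at most `0`. -/
lemma le_val_of_subsolution (hπ : π ∈ M.proper) {g V : S → ℝ} (hg : ∀ s, 0 ≤ g s)
    (h : ∀ s, V s ≤ g s + M.iter π 1 V s) (s : S) : V s ≤ M.val π g s := by
  obtain ⟨b, hb⟩ : ∃ b, ∀ s, V s ≤ b := by
    obtain ⟨b, hb⟩ := (Set.finite_range V).bddAbove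
    exact ⟨b, fun s => hb ⟨s, rfl⟩⟩
  have key : ∀ N s, V s ≤ ∑ i ∈ Finset.range N, M.iter π i g s + M.iter π N V s := by
    intro N
    induction N with
    | zero => intro s; simp [iter_zero]
    | succ N ih =>
      intro s
      have h1 := ih s
      have h2 := iter_mono (M := M) (π := π) h N s
      rw [iter_fun_add, ← iter_add] at h2
      rw [Finset.sum_range_succ]
      linarith
  have h1 : ∀ N, V s ≤ ∑ i ∈ Finset.range N, M.iter π i g s + b * M.surv π N s := fun N =>
    (key N s).trans (by have := iter_le_mul_surv (M := M) (π := π) hb N s; linarith)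
  have h2 : Tendsto (fun N => ∑ i ∈ Finset.range N, M.iter π i g s + b * M.surv π N s) atTop
      (𝓝 (M.val π g s + b * 0)) :=
    (summable_iter hπ hg s).hasSum.tendsto_sum_nat.add
      (((mem_proper_iff.1 hπ).2 s).const_mul b)
  rw [mul_zero, add_zero] at h2
  exact ge_of_tendsto' h2 h1

/-- For positive costs some proper policy satisfies the Bellman optimality inequalities. -/
lemma exists_bellman_optimal (hne : M.proper.Nonempty) {b : Γ → ℝ} {ε : ℝ} (hε : 0 < ε)
    (hb : ∀ z, ε ≤ b z) :
    ∃ π ∈ M.proper, ∀ z, M.val π (fun s => b (π s)) (M.src z)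
      ≤ b z + ∑ s', M.P z (some s') * M.val π (fun s => b (π s)) s' := by
  have hb0 : ∀ z, 0 ≤ b z := fun z => hε.le.trans (hb z)
  -- Minimizing the sum of the values over all states, among finitely many policies, lets a strict
  -- improvement at a single state give a contradiction.
  obtain ⟨π, hπ, hmin⟩ := Set.exists_min_image M.proper
    (fun π => ∑ s, M.val π (fun s => b (π s)) s) (Set.toFinite _) hne
  refine ⟨π, hπ, fun z => ?_⟩
  by_contra hcon
  push Not at hcon
  set V := M.val π (fun s => b (π s)) with hV
  set π' : S → Γ := Function.update π (M.src z) z with hπ'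
  have hz : π' (M.src z) = z := by simp [hπ']
  have hsrc : ∀ s, M.src (π' s) = s := by
    intro s
    by_cases hs : s = M.src z
    · rw [hs, hz]
    · simp [hπ', hs, hπ.1 s]
  have hV0 : ∀ s, 0 ≤ V s := val_nonneg fun s => hb0 _
  -- Policy improvement: the old value is a supersolution for the policy switched at one state.
  -- Positivity of `b` then ensures that the new policy is still proper.
  have hsuper : ∀ s, b (π' s) + M.iter π' 1 V s ≤ V s := by
    intro s
    by_cases hs : s = M.src z
    · rw [hs, iter_one, hz]; exact hcon.le
    · have h1 := val_eq hπ (g := fun s => b (π s)) (fun s => hb0 _) s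
      rw [iter_one] at h1 ⊢
      simp only [hπ', Function.update_of_ne hs]
      exact h1.ge
  obtain ⟨hp, hle⟩ := val_le_of_supersolution hsrc hε (g := fun s => b (π' s)) (fun s => hb _)
    hV0 hsuper
  have hlt : M.val π' (fun s => b (π' s)) (M.src z) < V (M.src z) := by
    rw [val_eq hp (fun s => hb0 _), hz]
    refine lt_of_le_of_lt ?_ hcon
    have := iter_mono (M := M) (π := π') hle 1 (M.src z)
    rw [iter_one (g := V), hz] at this
    linarith
  have := hmin π' hp
  have hlt2 := Finset.sum_lt_sum (fun s (_ : s ∈ Finset.univ) => hle s)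
    ⟨M.src z, Finset.mem_univ _, hlt⟩
  linarith

/-- Exponential tail of the hitting time. -/
lemma surv_le_exp (hπ : π ∈ M.proper) {τ : ℝ} (hτ : ∀ s, M.val π (fun _ => 1) s ≤ τ)
    (t : ℕ) (s : S) : M.surv π t s ≤ 2 * Real.exp (-((t + 1) / (4 * τ))) := by
  have hτ1 : 1 ≤ τ := (one_le_val_one hπ s).trans (hτ s)
  -- Survival is decreasing with sum at most `τ`, so `(n + 1) · surv n ≤ τ` with `n + 1 > 2 τ`: each
  -- block of `n ≤ 2 τ` steps halves the survival probability.
  set n := ⌊2 * τ⌋₊ with hn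
  have hn1 : (n : ℝ) ≤ 2 * τ := Nat.floor_le (by linarith)
  have hn2 : 2 * τ < n + 1 := Nat.lt_floor_add_one _
  have hn0 : 0 < n := Nat.floor_pos.2 (by linarith)
  have hhalf : ∀ s, M.surv π n s ≤ 1 / 2 := by
    intro s
    have h1 : ∑ i ∈ Finset.range (n + 1), M.surv π i s ≤ τ :=
      ((summable_surv hπ s).sum_le_tsum _ fun i _ => surv_nonneg i s).trans (hτ s)
    have h2 : ∑ _i ∈ Finset.range (n + 1), M.surv π n s
        ≤ ∑ i ∈ Finset.range (n + 1), M.surv π i s :=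
      Finset.sum_le_sum fun i hi => surv_anti s (by simp at hi; omega)
    simp at h2
    have h3 := surv_nonneg (M := M) (π := π) n s
    by_contra hcon
    push Not at hcon
    nlinarith
  have hpow : ∀ k s, M.surv π (n * k) s ≤ (1 / 2) ^ k := by
    intro k
    induction k with
    | zero => intro s; simp [surv_zero]
    | succ k ih =>
      intro s
      rw [mul_add, mul_one, add_comm, surv, iter_add]
      refine (iter_le_mul_surv ih n s).trans ?_
      rw [pow_succ]
      exact mul_le_mul_of_nonneg_left (hhalf s) (by positivity)
  have h1 : M.surv π t s ≤ (1 / 2) ^ (t / n) :=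
    (surv_anti s (Nat.mul_div_le t n)).trans (hpow _ s)
  have h2 : (t : ℝ) + 1 ≤ n * ((t / n : ℕ) + 1) := by
    have : t + 1 ≤ n * (t / n + 1) := Nat.lt_mul_div_succ t hn0
    exact_mod_cast this
  set k := t / n
  have h3 : ((t : ℝ) + 1) / (4 * τ) ≤ (k + 1) * Real.log 2 := by
    rw [div_le_iff₀ (by linarith)]
    have hl : 1 / 2 ≤ Real.log 2 := by have := Real.log_two_gt_d9; linarith
    have hk : (0 : ℝ) ≤ k + 1 := by positivity
    have e1 : (n : ℝ) * (k + 1) ≤ 2 * τ * (k + 1) := mul_le_mul_of_nonneg_right hn1 hk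
    have e2 : (k + 1) * (1 / 2) * (4 * τ) ≤ (k + 1) * Real.log 2 * (4 * τ) := by gcongr
    linarith
  -- The factor `2` in the conclusion pays for the incomplete last block. Keeping `t + 1` rather
  -- than `t` gives exactly `H₁` in the exponent when `t = H₁ - 1`.
  have h4 : (1 / 2 : ℝ) ^ (k + 1) ≤ Real.exp (-((t + 1) / (4 * τ))) := by
    have : (1 / 2 : ℝ) ^ (k + 1) = Real.exp (-((k + 1) * Real.log 2)) := by
      rw [Real.exp_neg, mul_comm, Real.exp_mul, Real.exp_log two_pos]
      rw [one_div, inv_pow]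
      norm_cast
    rw [this]
    exact Real.exp_le_exp.2 (by linarith)
  rw [pow_succ] at h4
  linarith

/-- The expected layer-weighted cost of the best policy in hindsight. -/
lemma weighted_cost_le {π πf : S → Γ} (hπ : π ∈ M.proper)
    (hπf : πf ∈ M.proper) {c : Γ → ℝ} {κ D ε : ℝ} (hc : ∀ z, 0 ≤ c z) (hcκ : ∀ z, c z ≤ κ)
    (hbest : ∀ π' ∈ M.proper,
      M.val π (fun s => c (π s)) M.s₀ ≤ M.val π' (fun s => c (π' s)) M.s₀)
    (hD : ∀ s, M.val πf (fun _ => 1) s ≤ D) (hε : 0 < ε) (n : ℕ) :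
    ∑ j ∈ Finset.range n, ((j : ℝ) + 1) * M.iter π j (fun s => c (π s)) M.s₀
      ≤ ((κ + ε) * D + n * ε) * M.val π (fun _ => 1) M.s₀ := by
  have hκ : 0 ≤ κ := (hc (π M.s₀)).trans (hcκ _)
  -- Costs may vanish, so the optimal value `V` is taken for the shifted cost `c + ε`. It is a
  -- subsolution for every proper policy; comparison with `πf` bounds it by `(κ + ε) D` everywhere.
  obtain ⟨πε, hπε, hbell⟩ := exists_bellman_optimal ⟨π, hπ⟩ (b := fun z => c z + ε) hε
    fun z => by have := hc z; linarith
  set V := M.val πε (fun s => c (πε s) + ε) with hV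
  have hsub : ∀ π' ∈ M.proper, ∀ s, V s ≤ (c (π' s) + ε) + M.iter π' 1 V s := by
    intro π' hπ' s
    have := hbell (π' s)
    rw [hπ'.1 s] at this
    rw [iter_one]
    exact this
  have hcε : ∀ z, 0 ≤ c z + ε := fun z => add_nonneg (hc z) hε.le
  have hVf : ∀ s, V s ≤ (κ + ε) * D := by
    intro s
    refine (le_val_of_subsolution hπf (fun s => hcε (πf s)) (hsub πf hπf) s).trans ?_
    refine (val_mono hπf (fun s => hcε (πf s)) (g := fun _ => κ + ε)
      (fun s => by have := hcκ (πf s); linarith) s).trans ?_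
    rw [val_const]
    exact mul_le_mul_of_nonneg_left (hD s) (by linarith)
  set J := M.val π (fun s => c (π s) + ε) with hJ
  set Tπ := M.val π (fun _ => 1) M.s₀ with hT
  -- The only use of optimality of `π`, and only at `s₀`: it loses at most the shift against the
  -- optimum.
  have hE0 : J M.s₀ - V M.s₀ ≤ ε * Tπ := by
    have h1 : J M.s₀ = M.val π (fun s => c (π s)) M.s₀ + ε * Tπ := by
      rw [hJ, val_add hπ (fun s => hc _) (fun _ => hε.le), val_const]
    have h2 : M.val πε (fun s => c (πε s)) M.s₀ ≤ V M.s₀ :=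
      val_mono hπε (fun s => hc _) (fun s => by linarith) _
    have h3 := hbest πε hπε
    linarith
  -- `J` solves the Bellman equation of `π` and `V` is a subsolution, so the gap `J - V` is a
  -- supermartingale along `π`. Its smallness at `s₀` therefore persists on average at all later
  -- steps.
  have hE : ∀ j s, M.iter π j (fun s => J s - V s) s ≤ J s - V s := by
    intro j
    induction j with
    | zero => intro s; rw [iter_zero]
    | succ j ih =>
      intro s
      rw [iter_add]
      refine (iter_mono (g := fun s => J s - V s) (fun s => ?_) j s).trans (ih s)
      rw [iter_fun_sub]
      have h1 := val_eq hπ (fun s => hcε (π s)) s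
      have h2 := hsub π hπ s
      linarith
  have hJc : ∀ s, M.val π (fun s => c (π s)) s ≤ J s := fun s =>
    val_mono hπ (fun s => hc _) (fun s => by linarith) s
  have hterm : ∀ j, M.iter π j (M.val π fun s => c (π s)) M.s₀
      ≤ (κ + ε) * D * M.surv π j M.s₀ + ε * Tπ := by
    intro j
    have h1 := iter_mono (M := M) (π := π) hJc j M.s₀
    have h2 := (hE j M.s₀).trans hE0
    rw [iter_fun_sub] at h2
    have h3 := iter_le_mul_surv (M := M) (π := π) hVf j M.s₀
    linarith
  have hsurv : ∑ j ∈ Finset.range n, M.surv π j M.s₀ ≤ Tπ :=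
    (summable_surv hπ _).sum_le_tsum _ fun i _ => surv_nonneg i _
  -- Summation by parts: a cost at index `j` with weight `j + 1` is counted once in each of the
  -- remaining costs from indices `0, …, j`.
  have hswap : ∑ j ∈ Finset.range n, ((j : ℝ) + 1) * M.iter π j (fun s => c (π s)) M.s₀
      ≤ ∑ j ∈ Finset.range n, M.iter π j (M.val π fun s => c (π s)) M.s₀ := by
    set a := fun j => M.iter π j (fun s => c (π s)) M.s₀ with ha
    have ha0 : ∀ j, 0 ≤ a j := fun j => iter_nonneg (fun s => hc _) j _
    have hsa : Summable a := summable_iter hπ (fun s => hc _) _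
    have e1 : ∑ j ∈ Finset.range n, ((j : ℝ) + 1) * a j
        = ∑ j ∈ Finset.range n, ∑ i ∈ Finset.range n, if j ≤ i then a i else 0 := by
      rw [Finset.sum_comm]
      refine Finset.sum_congr rfl fun i hi => ?_
      rw [← Finset.sum_filter, Finset.sum_const]
      have : (Finset.range n).filter (fun j => j ≤ i) = Finset.range (i + 1) := by
        ext j; simp at hi ⊢; omega
      rw [this, Finset.card_range, nsmul_eq_mul]
      push_cast; ring
    rw [e1]
    refine Finset.sum_le_sum fun j _ => ?_
    rw [iter_val hπ (fun s => hc _), ← Finset.sum_filter]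
    have e2 : ∑ i ∈ (Finset.range n).filter (fun i => j ≤ i), a i
        = ∑ i ∈ Finset.range (n - j), a (j + i) := by
      rw [← Finset.sum_Ico_eq_sum_range]
      congr 1
      ext i; simp [and_comm]
    rw [e2]
    exact ((summable_nat_add_iff j).2 hsa |>.congr fun i => by rw [add_comm]).sum_le_tsum _
      fun i _ => ha0 _
  refine hswap.trans ((Finset.sum_le_sum fun j _ => hterm j).trans ?_)
  rw [Finset.sum_add_distrib, ← Finset.mul_sum, Finset.sum_const, Finset.card_range, nsmul_eq_mul]
  have hD0 : 0 ≤ D := (val_nonneg (fun _ => zero_le_one) M.s₀).trans (hD M.s₀)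
  have := mul_le_mul_of_nonneg_left hsurv (by positivity : 0 ≤ (κ + ε) * D)
  linarith

end Policy

end SSP

namespace SSP

/-! ### Occupancy measures of the loop-free instance. -/

section LoopFreeOccupancy

variable {S Γ : Type*} [Fintype S] [DecidableEq S] [Fintype Γ] [DecidableEq Γ] {M : SSP S Γ}

lemma convex_occ (T : ℝ) : Convex ℝ (M.occ T) := by
  intro p hp q hq a b ha hb hab
  refine ⟨fun z => ?_, ?_, fun s => ?_⟩
  · have := hp.1 z
    have := hq.1 z
    simp only [Pi.add_apply, Pi.smul_apply, smul_eq_mul]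
    positivity
  · simp only [Pi.add_apply, Pi.smul_apply, smul_eq_mul, Finset.sum_add_distrib, ← Finset.mul_sum]
    calc a * ∑ z, p z + b * ∑ z, q z ≤ a * T + b * T :=
          add_le_add (mul_le_mul_of_nonneg_left hp.2.1 ha) (mul_le_mul_of_nonneg_left hq.2.1 hb)
      _ = T := by rw [← add_mul, hab, one_mul]
  · have h1 := hp.2.2 s
    have h2 := hq.2.2 s
    have e1 : (∑ z, if M.src z = s then (a • p + b • q) z else 0)
        = a * (∑ z, if M.src z = s then p z else 0) + b * ∑ z, if M.src z = s then q z else 0 := by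
      rw [Finset.mul_sum, Finset.mul_sum, ← Finset.sum_add_distrib]
      refine Finset.sum_congr rfl fun z _ => ?_
      split_ifs <;> simp
    have e2 : ∑ z, M.P z (some s) * (a • p + b • q) z
        = a * ∑ z, M.P z (some s) * p z + b * ∑ z, M.P z (some s) * q z := by
      rw [Finset.mul_sum, Finset.mul_sum, ← Finset.sum_add_distrib]
      refine Finset.sum_congr rfl fun z _ => ?_
      simp; ring
    rw [e1, e2]
    linear_combination a * h1 + b * h2 + (if s = M.s₀ then 1 else 0) * hab

lemma convex_decisionSet (H₁ H : ℕ) [NeZero H] (T lam : ℝ) :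
    Convex ℝ (M.decisionSet H₁ H T lam) := by
  rintro _ ⟨p, hp, rfl⟩ _ ⟨q, hq, rfl⟩ a b ha hb hab
  refine ⟨a • p + b • q, convex_occ T hp hq ha hb hab, ?_⟩
  ext w
  simp [skew]; ring

lemma skew_nonneg {H : ℕ} {lam : ℝ} (hlam : 0 ≤ lam) {q : Option Γ × Fin H → ℝ}
    (hq : ∀ w, 0 ≤ q w) (w : Option Γ × Fin H) : 0 ≤ skew lam q w := by
  have := hq w
  unfold skew
  positivity

lemma skew_le {H : ℕ} {lam : ℝ} (hlam : lam * H ≤ 1) (hlam0 : 0 ≤ lam)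
    {q : Option Γ × Fin H → ℝ} (hq : ∀ w, 0 ≤ q w) (w : Option Γ × Fin H) :
    skew lam q w ≤ 2 * q w := by
  have h1 := hq w
  have h2 : ((w.2 : ℕ) + 1 : ℝ) ≤ H := by exact_mod_cast w.2.isLt
  have h3 : lam * ((w.2 : ℕ) + 1 : ℝ) ≤ 1 := (mul_le_mul_of_nonneg_left h2 hlam0).trans hlam
  have h4 := mul_le_mul_of_nonneg_right h3 h1
  unfold skew
  linarith

lemma loopFree_outflow_some {H₁ H : ℕ} [NeZero H] (q : Option Γ × Fin H → ℝ) (s : S)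
    (j : Fin H) :
    (∑ w, if (M.loopFree H₁ H).src w = (some s, j) then q w else 0)
      = ∑ z, if M.src z = s then q (some z, j) else 0 := by
  rw [Fintype.sum_prod_type, Fintype.sum_option]
  simp only [loopFree, Option.map_none, Option.map_some, Prod.mk.injEq, reduceCtorEq, false_and,
    if_false, Finset.sum_const_zero, zero_add, Option.some.injEq]
  refine Finset.sum_congr rfl fun z _ => ?_
  by_cases h : M.src z = s <;> simp [h]

lemma loopFree_outflow_none {H₁ H : ℕ} [NeZero H] (q : Option Γ × Fin H → ℝ) (j : Fin H) :
    (∑ w, if (M.loopFree H₁ H).src w = (none, j) then q w else 0) = q (none, j) := by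
  rw [Fintype.sum_prod_type, Fintype.sum_option]
  simp [loopFree]

lemma loopFree_inflow_zero {H₁ H : ℕ} [NeZero H] (q : Option Γ × Fin H → ℝ) (y : Option S) :
    ∑ w, (M.loopFree H₁ H).P w (some (y, 0)) * q w = 0 := by
  refine Finset.sum_eq_zero fun w _ => ?_
  have h : M.loopFreeP H₁ H w (some (y, 0)) = 0 := by
    obtain ⟨z, i⟩ := w
    unfold loopFreeP
    have hne : ∀ hj : (i : ℕ) + 1 < H, (0 : Fin H) ≠ ⟨i + 1, hj⟩ := fun hj h => by
      simpa using congrArg Fin.val h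
    by_cases hj : (i : ℕ) + 1 < H
    · rcases z with _ | z <;> rcases y with _ | s <;> simp [hj, hne hj]
    · simp [hj]
  simp [loopFree, h]

lemma loopFreeP_succ {H₁ H : ℕ} (z : Option Γ) (i : Fin H) (y : Option S) (j : ℕ)
    (hj : j + 1 < H) :
    M.loopFreeP H₁ H (z, i) (some (y, ⟨j + 1, hj⟩))
      = if i = ⟨j, by omega⟩ then
          (match z, y with
            | some z, some s => if j + 1 < H₁ then M.P z (some s) else 0
            | some _, none => if H₁ ≤ j + 1 then 1 else 0
            | none, none => 1
            | none, some _ => 0) else 0 := by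
  unfold loopFreeP
  by_cases h : i = ⟨j, by omega⟩
  · subst h
    rcases z with _ | z <;> rcases y with _ | s <;> simp [hj]
  · have h' : j ≠ (i : ℕ) := fun h' => h (Fin.ext h'.symm)
    by_cases hi : (i : ℕ) + 1 < H
    · rcases z with _ | z <;> rcases y with _ | s <;> simp [hi, h, h']
    · simp [hi, h]

lemma loopFree_inflow_some {H₁ H : ℕ} [NeZero H] (q : Option Γ × Fin H → ℝ) (s : S) (j : ℕ)
    (hj : j + 1 < H) :
    ∑ w, (M.loopFree H₁ H).P w (some (some s, ⟨j + 1, hj⟩)) * q w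
      = if j + 1 < H₁ then ∑ z, M.P z (some s) * q (some z, ⟨j, by omega⟩) else 0 := by
  rw [Fintype.sum_prod_type, Fintype.sum_option]
  simp only [loopFree, loopFreeP_succ]
  split_ifs <;> simp

lemma loopFree_inflow_none {H₁ H : ℕ} [NeZero H] (q : Option Γ × Fin H → ℝ) (j : ℕ)
    (hj : j + 1 < H) :
    ∑ w, (M.loopFree H₁ H).P w (some (none, ⟨j + 1, hj⟩)) * q w
      = q (none, ⟨j, by omega⟩) + if H₁ ≤ j + 1 then ∑ z, q (some z, ⟨j, by omega⟩) else 0 := by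
  rw [Fintype.sum_prod_type, Fintype.sum_option]
  simp only [loopFree, loopFreeP_succ]
  split_ifs <;> simp

/-- Flow enters a layer only from the one before it, so the flow equations become a recursion over
layers, separately for ordinary and fast states. -/
lemma mem_occ_loopFree {H₁ H : ℕ} [NeZero H] {T : ℝ} {q : Option Γ × Fin H → ℝ} :
    q ∈ (M.loopFree H₁ H).occ T ↔ (∀ w, 0 ≤ q w) ∧ ∑ w, q w ≤ T ∧
      (∀ s, (∑ z, if M.src z = s then q (some z, 0) else 0) = if s = M.s₀ then 1 else 0) ∧
      q (none, 0) = 0 ∧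
      (∀ s j (hj : j + 1 < H), (∑ z, if M.src z = s then q (some z, ⟨j + 1, hj⟩) else 0)
        = if j + 1 < H₁ then ∑ z, M.P z (some s) * q (some z, ⟨j, by omega⟩) else 0) ∧
      ∀ j (hj : j + 1 < H), q (none, ⟨j + 1, hj⟩)
        = q (none, ⟨j, by omega⟩) + if H₁ ≤ j + 1 then ∑ z, q (some z, ⟨j, by omega⟩) else 0 := by
  have hs₀ : (M.loopFree H₁ H).s₀ = (some M.s₀, 0) := rfl
  constructor
  · rintro ⟨h1, h2, h3⟩
    refine ⟨h1, h2, fun s => ?_, ?_, fun s j hj => ?_, fun j hj => ?_⟩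
    · have h := h3 (some s, 0)
      rw [loopFree_outflow_some, loopFree_inflow_zero, hs₀] at h
      simpa using h
    · have h := h3 (none, 0)
      rw [loopFree_outflow_none, loopFree_inflow_zero, hs₀] at h
      simpa using h
    · have h := h3 (some s, ⟨j + 1, hj⟩)
      have hne : ((some s, ⟨j + 1, hj⟩) : Option S × Fin H) ≠ (some M.s₀, 0) := fun h => by
        simpa using congrArg (fun p => (p.2 : Fin H).val) h
      rw [loopFree_outflow_some, loopFree_inflow_some, hs₀, if_neg hne] at h
      linarith
    · have h := h3 (none, ⟨j + 1, hj⟩)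
      have hne : ((none, ⟨j + 1, hj⟩) : Option S × Fin H) ≠ (some M.s₀, 0) := by simp
      rw [loopFree_outflow_none, loopFree_inflow_none, hs₀, if_neg hne] at h
      linarith
  · rintro ⟨h1, h2, h3, h4, h5, h6⟩
    refine ⟨h1, h2, ?_⟩
    rintro ⟨y, ⟨j, hj⟩⟩
    rw [hs₀]
    cases j with
    | zero =>
      have e0 : (⟨0, hj⟩ : Fin H) = 0 := rfl
      rw [e0]
      cases y with
      | none => rw [loopFree_outflow_none, loopFree_inflow_zero]; simpa using h4
      | some s => rw [loopFree_outflow_some, loopFree_inflow_zero, h3]; simp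
    | succ j =>
      cases y with
      | none => rw [loopFree_outflow_none, loopFree_inflow_none, h6 j hj]; simp
      | some s =>
        rw [loopFree_outflow_some, loopFree_inflow_some, h5 s j hj, sub_self, if_neg]
        intro h
        simpa using congrArg (fun p => (p.2 : Fin H).val) h

/-- The occupancy of the loop-free instance induced by the marginals `p i` of a trajectory: the
first `H₁` terms are kept, and the mass that is left moves along the fast states. -/
def embed (H₁ H : ℕ) (p : ℕ → Option Γ → ℝ) (w : Option Γ × Fin H) : ℝ :=
  match w.1 with
  | some z => if (w.2 : ℕ) < H₁ then p w.2 (some z) else 0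
  | none => if H₁ ≤ (w.2 : ℕ) then ∑ z, p (H₁ - 1) (some z) else 0

/-- Cost of layer `j` of the loop-free instance. -/
def layerCost (H₁ : ℕ) (p : ℕ → Option Γ → ℝ) (c : Γ → ℝ) (j : ℕ) : ℝ :=
  if j < H₁ then ∑ z, p j (some z) * c z else ∑ z, p (H₁ - 1) (some z)

lemma sum_embed_mul {H₁ H : ℕ} (p : ℕ → Option Γ → ℝ) (c : Γ → ℝ) (g : ℕ → ℝ) :
    ∑ w, embed H₁ H p w * (g w.2 * loopFreeCost H c w)
      = ∑ j ∈ Finset.range H, g j * layerCost H₁ p c j := by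
  rw [← Fin.sum_univ_eq_sum_range (fun j => g j * layerCost H₁ p c j), Fintype.sum_prod_type,
    Finset.sum_comm]
  refine Finset.sum_congr rfl fun j _ => ?_
  rw [Fintype.sum_option]
  simp only [embed, loopFreeCost, layerCost]
  by_cases h : (j : ℕ) < H₁
  · simp only [h, if_true, not_le.2 h, if_false, zero_mul, zero_add, Finset.mul_sum]
    exact Finset.sum_congr rfl fun z _ => by ring
  · simp only [h, if_false, not_lt.1 h, if_true, zero_mul, Finset.sum_const_zero]
    ring

lemma sum_embed {H₁ H : ℕ} (p : ℕ → Option Γ → ℝ) :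
    ∑ w, embed H₁ H p w = ∑ j ∈ Finset.range H, layerCost H₁ p (fun _ => 1) j := by
  have h := sum_embed_mul (H₁ := H₁) (H := H) p (fun _ => 1) fun _ => 1
  simp only [one_mul] at h
  rw [← h]
  refine Finset.sum_congr rfl fun w _ => ?_
  obtain ⟨_ | z, j⟩ := w <;> simp [loopFreeCost]

lemma embed_nonneg {H₁ H : ℕ} {p : ℕ → Option Γ → ℝ} (hp : ∀ i y, 0 ≤ p i y)
    (w : Option Γ × Fin H) : 0 ≤ embed H₁ H p w := by
  obtain ⟨_ | z, j⟩ := w <;> simp only [embed] <;> split_ifs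
  · exact Finset.sum_nonneg fun z _ => hp _ _
  · exact le_rfl
  · exact hp _ _
  · exact le_rfl

lemma layerCost_nonneg {H₁ : ℕ} {p : ℕ → Option Γ → ℝ} (hp : ∀ i y, 0 ≤ p i y) {c : Γ → ℝ}
    (hc : ∀ z, 0 ≤ c z) (j : ℕ) : 0 ≤ layerCost H₁ p c j := by
  unfold layerCost
  split_ifs
  · exact Finset.sum_nonneg fun z _ => mul_nonneg (hp _ _) (hc z)
  · exact Finset.sum_nonneg fun z _ => hp _ _

lemma layerCost_le_one {H₁ : ℕ} {p : ℕ → Option Γ → ℝ} (hp : ∀ i y, 0 ≤ p i y)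
    (hp1 : ∀ i, ∑ y, p i y ≤ 1) {c : Γ → ℝ} (hc1 : ∀ z, c z ≤ 1) (j : ℕ) :
    layerCost H₁ p c j ≤ 1 := by
  have h : ∀ i, ∑ z, p i (some z) ≤ 1 := fun i => by
    have h1 := hp1 i
    rw [Fintype.sum_option] at h1
    have := hp i none
    linarith
  unfold layerCost
  split_ifs
  · refine (Finset.sum_le_sum fun z _ => ?_).trans (h j)
    have := mul_le_mul_of_nonneg_left (hc1 z) (hp j (some z))
    linarith
  · exact h _

/-- An occupancy of the loop-free instance is determined by the policies derived from it. -/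
lemma occ_eq_embed_law {H₁ H : ℕ} [NeZero H] (h0 : 0 < H₁) {T : ℝ}
    {q : Option Γ × Fin H → ℝ} (hq : q ∈ (M.loopFree H₁ H).occ T) {ρ : ℕ → Γ → ℝ}
    (hρ : ∀ j : Fin H, (j : ℕ) < H₁ → ∀ z,
      ρ j z * (∑ z', if M.src z' = M.src z then q (some z', j) else 0) = q (some z, j)) :
    q = embed H₁ H (M.law ρ M.s₀) := by
  obtain ⟨h1, -, h3, h4, h5, h6⟩ := mem_occ_loopFree.1 hq
  have hlaw : ∀ j (hj : j < H), j < H₁ → ∀ z, q (some z, ⟨j, hj⟩) = M.law ρ M.s₀ j (some z) := by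
    intro j
    induction j with
    | zero =>
      intro hj hj1 z
      have e0 : (⟨0, hj⟩ : Fin H) = 0 := rfl
      have h := hρ ⟨0, hj⟩ hj1 z
      rw [e0, h3] at h
      rw [e0, ← h]
      simp only [law, startProb]
      split_ifs <;> simp
    | succ j ih =>
      intro hj hj1 z
      have h := hρ ⟨j + 1, hj⟩ hj1 z
      rw [h5 _ j hj, if_pos hj1] at h
      rw [← h]
      simp only [law]
      rw [Fintype.sum_option, Finset.mul_sum]
      simp only [stepProb, mul_zero, zero_add]
      refine Finset.sum_congr rfl fun z' _ => ?_
      rw [ih (by omega) (by omega)]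
      ring
  -- Layers are indexed from `0`, so index `H₁ - 1` is the last with ordinary states. Beyond it the
  -- outflow of each ordinary state is zero, and nonnegativity kills every summand.
  have hsome : ∀ j (hj : j < H), H₁ ≤ j → ∀ z, q (some z, ⟨j, hj⟩) = 0 := by
    intro j hj hj1 z
    obtain ⟨j, rfl⟩ : ∃ i, j = i + 1 := ⟨j - 1, by omega⟩
    have h := h5 (M.src z) j hj
    rw [if_neg (by omega)] at h
    have h' := (Finset.sum_eq_zero_iff_of_nonneg (fun z' _ => by
      split_ifs <;> [exact h1 _; exact le_rfl])).1 h z (Finset.mem_univ z)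
    simpa using h'
  -- All mass alive at index `H₁ - 1` moves to the fast states, including what would reach the goal
  -- in that very step, and it stays constant through all later layers.
  have hnone : ∀ j (hj : j < H), q (none, ⟨j, hj⟩)
      = if H₁ ≤ j then ∑ z, M.law ρ M.s₀ (H₁ - 1) (some z) else 0 := by
    intro j
    induction j with
    | zero => intro hj; rw [if_neg (by omega)]; exact h4
    | succ j ih =>
      intro hj
      rw [h6 j hj, ih (by omega)]
      by_cases hc : H₁ ≤ j
      · rw [if_pos hc, if_pos (by omega), if_pos (by omega)]
        simp [hsome j (by omega) hc]
      · by_cases hc2 : H₁ ≤ j + 1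
        · rw [if_neg hc, if_pos hc2, if_pos hc2, zero_add]
          have : H₁ - 1 = j := by omega
          rw [this]
          exact Finset.sum_congr rfl fun z _ => hlaw j _ (by omega) z
        · rw [if_neg hc, if_neg hc2, if_neg hc2, zero_add]
  ext ⟨y, ⟨j, hj⟩⟩
  cases y with
  | none => simpa [embed] using hnone j hj
  | some z =>
    simp only [embed]
    split_ifs with h
    · exact hlaw j hj h z
    · exact hsome j hj (not_lt.1 h) z

/-- Converse to `occ_eq_embed_law`; it makes the truncated comparator feasible. -/
lemma embed_law_mem_occ {H₁ H : ℕ} [NeZero H] (h0 : 0 < H₁) {T : ℝ} {ρ : ℕ → Γ → ℝ}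
    (hρ : ∀ i, M.IsRule (ρ i)) (hT : ∑ w, embed H₁ H (M.law ρ M.s₀) w ≤ T) :
    embed H₁ H (M.law ρ M.s₀) ∈ (M.loopFree H₁ H).occ T := by
  refine mem_occ_loopFree.2 ⟨embed_nonneg fun i y => law_nonneg hρ _ i y, hT, fun s => ?_, ?_,
    fun s j hj => ?_, fun j hj => ?_⟩
  · simp only [embed, Fin.val_zero, h0, if_true, law, startProb]
    by_cases hs : s = M.s₀
    · rw [if_pos hs, ← (hρ 0).2 s]
      refine Finset.sum_congr rfl fun z _ => ?_
      rw [hs]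
      split_ifs <;> rfl
    · rw [if_neg hs]
      refine Finset.sum_eq_zero fun z _ => ?_
      split_ifs with h1 h2
      · exact absurd (h1.symm.trans h2) hs
      · rfl
      · rfl
  · simp [embed]; omega
  · simp only [embed]
    by_cases h : j + 1 < H₁
    · simp only [h, if_true, show j < H₁ by omega, law]
      simp only [Fintype.sum_option, stepProb, mul_zero, zero_add]
      have e : ∀ z, (if M.src z = s then ∑ z', M.law ρ M.s₀ j (some z') *
          (M.P z' (some (M.src z)) * ρ (j + 1) z) else 0)
          = (∑ z', M.P z' (some s) * M.law ρ M.s₀ j (some z')) *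
            (if M.src z = s then ρ (j + 1) z else 0) := by
        intro z
        split_ifs with hs
        · rw [hs, Finset.sum_mul]
          exact Finset.sum_congr rfl fun z' _ => by ring
        · simp
      simp_rw [e]
      rw [← Finset.mul_sum, (hρ (j + 1)).2 s, mul_one]
    · simp [h]
  · simp only [embed]
    by_cases hc : H₁ ≤ j
    · simp [hc, show H₁ ≤ j + 1 by omega, not_lt.2 hc]
    · by_cases hc2 : H₁ ≤ j + 1
      · have : H₁ - 1 = j := by omega
        simp [hc, hc2, this, not_le.1 hc]
      · simp [hc, hc2]

/-- In the expanded square, `y j` multiplies at most `j` units of earlier terms twice, and itself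
once. This bounds the second moment of an episode's cost by an expression linear in the layer costs,
which the skew term can match. -/
lemma sq_sum_le_weighted {y : ℕ → ℝ} (h0 : ∀ j, 0 ≤ y j) (h1 : ∀ j, y j ≤ 1) (n : ℕ) :
    (∑ j ∈ Finset.range n, y j) ^ 2 ≤ 2 * ∑ j ∈ Finset.range n, ((j : ℝ) + 1) * y j := by
  induction n with
  | zero => simp
  | succ n ih =>
    rw [Finset.sum_range_succ, Finset.sum_range_succ]
    have hs : ∑ j ∈ Finset.range n, y j ≤ n := by
      have := Finset.sum_le_sum fun j (_ : j ∈ Finset.range n) => h1 j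
      simpa using this
    nlinarith [h0 n, h1 n, mul_le_mul_of_nonneg_right hs (h0 n),
      mul_le_mul_of_nonneg_right (h1 n) (h0 n)]

lemma layerCost_visitProb {π : S → Γ} (hπ : ∀ s, M.src (π s) = s) (H₁ : ℕ) (c : Γ → ℝ) (s : S)
    (j : ℕ) : layerCost H₁ (M.visitProb (M.det π) s) c j
      = if j < H₁ then M.iter π j (fun s => c (π s)) s else M.surv π (H₁ - 1) s := by
  unfold layerCost
  rw [sum_visitProb_mul hπ]
  have h := sum_visitProb_mul hπ s (H₁ - 1) fun _ => 1
  simp only [mul_one] at h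
  rw [h]
  rfl

end LoopFreeOccupancy

end SSP

namespace SSP

/-! ### Conditional laws of the realized trajectories. -/

section Trajectories

variable {S Γ : Type*} [Fintype S] [DecidableEq S] [Fintype Γ] [DecidableEq Γ] {M : SSP S Γ}

/-- The sequence that starts with `x` and is constantly `y` from then on. -/
def extendPath {α : Type*} {n : ℕ} (x : Fin n → α) (y : α) (i : ℕ) : α :=
  if h : i < n then x ⟨i, h⟩ else y

lemma extendPath_self {α : Type*} {n : ℕ} (x : Fin n → α) (y : α) : extendPath x y n = y := by
  simp [extendPath]

lemma pathProb_congr {ρ : ℕ → Γ → ℝ} {n : ℕ} {x x' : ℕ → Option Γ} (h : ∀ i ≤ n, x i = x' i) :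
    M.pathProb ρ n x = M.pathProb ρ n x' := by
  unfold pathProb
  rw [h 0 (Nat.zero_le n)]
  congr 1
  refine Finset.prod_congr rfl fun i hi => ?_
  have hi : i < n := Finset.mem_range.1 hi
  rw [h i hi.le, h (i + 1) hi]

lemma sum_pathProb (ρ : ℕ → Γ → ℝ) (n : ℕ) (y : Option Γ) :
    ∑ x : Fin n → Option Γ, M.pathProb ρ n (extendPath x y) = M.law ρ M.s₀ n y := by
  induction n generalizing y with
  | zero => simp [pathProb, law, extendPath]
  | succ n ih =>
    rw [← (Fin.snocEquiv fun _ => Option Γ).sum_comp, Fintype.sum_prod_type]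
    simp only [law]
    refine Finset.sum_congr rfl fun y' _ => ?_
    rw [← ih y', Finset.sum_mul]
    refine Finset.sum_congr rfl fun x _ => ?_
    have hs : ∀ i ≤ n, extendPath ((Fin.snocEquiv fun _ => Option Γ) (y', x)) y i
        = extendPath x y' i := by
      intro i hi
      simp only [extendPath, Fin.snocEquiv, Equiv.coe_fn_mk, Fin.snoc]
      rw [dif_pos (by omega)]
      by_cases h : i < n
      · simp [h]
      · simp [h]
    rw [pathProb, Finset.prod_range_succ, ← mul_assoc, extendPath_self, hs n le_rfl,
      extendPath_self]
    congr 1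
    exact pathProb_congr hs

lemma law_eq_zero {ρ : ℕ → Γ → ℝ} {n : ℕ} {z : Γ} (h : ρ n z = 0) (s : S) :
    M.law ρ s n (some z) = 0 := by
  cases n with
  | zero => simp [law, startProb, h]
  | succ n =>
    simp only [law]
    refine Finset.sum_eq_zero fun x _ => ?_
    cases x <;> simp [stepProb, h]

/-- The Markov property at the time when the learner switches to a fixed deterministic policy. -/
lemma sum_law_add_mul {π : S → Γ} (hπ : ∀ s, M.src (π s) = s) {ρ : ℕ → Γ → ℝ} {n : ℕ}
    (hρ : ∀ i, n ≤ i → ρ i = M.det π) (s : S) (t : ℕ) (g : S → ℝ) :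
    ∑ z, M.law ρ s (n + t) (some z) * g (M.src z)
      = ∑ z, M.law ρ s n (some z) * M.iter π t g (M.src z) := by
  induction t generalizing g with
  | zero => simp [iter_zero]
  | succ t ih =>
    rw [iter_add, ← ih, ← add_assoc]
    simp only [law, Fintype.sum_option, stepProb, mul_zero, zero_add, hρ (n + t + 1) (by omega)]
    simp_rw [Finset.sum_mul]
    rw [Finset.sum_comm]
    refine Finset.sum_congr rfl fun z _ => ?_
    have h1 := sum_src_mul (isRule_det hπ) fun s' => M.P z (some s') * g s'
    have h2 : ∑ z', M.law ρ s (n + t) (some z) *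
        (M.P z (some (M.src z')) * M.det π z') * g (M.src z')
        = M.law ρ s (n + t) (some z) * ∑ s', M.P z (some s') * g s' := by
      rw [← h1, Finset.mul_sum]
      exact Finset.sum_congr rfl fun z' _ => by ring
    rw [h2]
    -- Index `n + t` already uses `π`, so pairs not chosen by `π` have zero mass.
    by_cases hz : π (M.src z) = z
    · rw [iter_one, hz]
    · rw [law_eq_zero, zero_mul, zero_mul]
      rw [hρ (n + t) (by omega), det, if_neg hz]

lemma sum_law_add_le {π : S → Γ} (hπ : ∀ s, M.src (π s) = s) {ρ : ℕ → Γ → ℝ} {n : ℕ}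
    (hrule : ∀ i, M.IsRule (ρ i)) (hρ : ∀ i, n ≤ i → ρ i = M.det π) (s : S) (t : ℕ) {b : ℝ}
    (hb0 : 0 ≤ b) (hb : ∀ s, M.surv π t s ≤ b) : ∑ z, M.law ρ s (n + t) (some z) ≤ b := by
  have h := sum_law_add_mul hπ hρ s t fun _ => 1
  simp only [mul_one] at h
  rw [h]
  have h1 := sum_law hrule s n
  rw [Fintype.sum_option] at h1
  have h2 := law_nonneg hrule s n none
  calc ∑ z, M.law ρ s n (some z) * M.iter π t (fun _ => 1) (M.src z)
      ≤ ∑ z, M.law ρ s n (some z) * b :=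
        Finset.sum_le_sum fun z _ => mul_le_mul_of_nonneg_left (hb _) (law_nonneg hrule _ _ _)
    _ = (∑ z, M.law ρ s n (some z)) * b := by rw [Finset.sum_mul]
    _ ≤ 1 * b := mul_le_mul_of_nonneg_right (by linarith) hb0
    _ = b := one_mul b

variable {Ω : Type*} {m : MeasurableSpace Ω} {μ : Measure Ω} {𝓕 : Filtration ℕ m}
  {K : ℕ} {c : ℕ → Ω → Γ → ℝ} {ρ : ℕ → Ω → ℕ → Γ → ℝ} {X : ℕ → Ω → ℕ → Option Γ}

lemma measurable_stepProb {m' : MeasurableSpace Ω} {r : Ω → Γ → ℝ}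
    (hr : ∀ z, Measurable fun ω => r ω z) (x y : Option Γ) :
    Measurable fun ω => M.stepProb (r ω) x y := by
  cases x <;> cases y <;> simp only [stepProb]
  · exact measurable_const
  · exact measurable_const
  · exact measurable_const
  · exact (hr _).const_mul _

lemma measurable_law {m' : MeasurableSpace Ω} {r : Ω → ℕ → Γ → ℝ}
    (hr : ∀ i z, Measurable fun ω => r ω i z) (s : S) (i : ℕ) (y : Option Γ) :
    Measurable fun ω => M.law (r ω) s i y := by
  induction i generalizing y with
  | zero =>
    cases y with
    | none => exact measurable_const
    | some z =>
      simp only [law, startProb]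
      split_ifs
      · exact hr 0 z
      · exact measurable_const
  | succ i ih =>
    simp only [law]
    exact Finset.measurable_fun_sum _ fun x _ => (ih x).mul (measurable_stepProb (hr (i + 1)) x y)

lemma pathProb_nonneg {r : ℕ → Γ → ℝ} (hr : ∀ i, M.IsRule (r i)) (n : ℕ) (x : ℕ → Option Γ) :
    0 ≤ M.pathProb r n x :=
  mul_nonneg (startProb_nonneg (hr 0) _ _)
    (Finset.prod_nonneg fun _ _ => stepProb_nonneg (hr _) _ _)

lemma IsInteraction.measurableSet_eq (hI : M.IsInteraction μ 𝓕 K c ρ X) {k : ℕ} (hk : k < K)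
    (i : ℕ) (y : Option Γ) : MeasurableSet {ω | X k ω i = y} :=
  𝓕.le (k + 1) _ (hI.traj_meas k hk i y)

lemma IsInteraction.measurableSet_path (hI : M.IsInteraction μ 𝓕 K c ρ X) {k : ℕ} (hk : k < K)
    (n : ℕ) (x : ℕ → Option Γ) : MeasurableSet {ω | ∀ i ≤ n, X k ω i = x i} := by
  have : {ω | ∀ i ≤ n, X k ω i = x i} = ⋂ i ∈ Set.Iic n, {ω | X k ω i = x i} := by
    ext ω; simp
  rw [this]
  exact MeasurableSet.biInter (Set.to_countable _) fun i _ => hI.measurableSet_eq hk i _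

lemma measurable_pathProb {m' : MeasurableSpace Ω} {r : Ω → ℕ → Γ → ℝ}
    (hr : ∀ i z, Measurable fun ω => r ω i z) (n : ℕ) (x : ℕ → Option Γ) :
    Measurable fun ω => M.pathProb (r ω) n x := by
  unfold pathProb
  refine Measurable.mul ?_ (Finset.measurable_fun_prod _ fun i _ => measurable_stepProb (hr _) _ _)
  cases x 0 with
  | none => exact measurable_const
  | some z =>
    simp only [startProb]
    split_ifs
    · exact hr 0 z
    · exact measurable_const

/-- Conditional law of one term of a trajectory. -/
lemma IsInteraction.measure_inter_eq (hI : M.IsInteraction μ 𝓕 K c ρ X) {k : ℕ} (hk : k < K)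
    {B : Set Ω} (hB : MeasurableSet[𝓕 k] B) (n : ℕ) (y : Option Γ) :
    μ (B ∩ {ω | X k ω n = y}) = ∫⁻ ω in B, ENNReal.ofReal (M.law (ρ k ω) M.s₀ n y) ∂μ := by
  have hset : B ∩ {ω | X k ω n = y}
      = ⋃ x : Fin n → Option Γ, B ∩ {ω | ∀ i ≤ n, X k ω i = extendPath x y i} := by
    ext ω
    simp only [Set.mem_inter_iff, Set.mem_iUnion]
    constructor
    · rintro ⟨h1, h2⟩
      refine ⟨fun i => X k ω i, h1, fun i hi => ?_⟩
      unfold extendPath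
      split_ifs with h
      · rfl
      · have : i = n := by omega
        rw [this]; exact h2
    · rintro ⟨x, h1, h2⟩
      exact ⟨h1, (h2 n le_rfl).trans (extendPath_self x y)⟩
  have hdisj : Pairwise (Function.onFun Disjoint fun x : Fin n → Option Γ =>
      B ∩ {ω | ∀ i ≤ n, X k ω i = extendPath x y i}) := by
    intro x x' hne
    refine Set.disjoint_left.2 fun ω h1 h2 => hne ?_
    ext1 i
    have e1 := h1.2 i i.2.le
    have e2 := h2.2 i i.2.le
    rw [e1] at e2
    simpa [extendPath] using e2
  have hmeas := fun i z => (hI.rule_meas k hk i z).mono (𝓕.le k) le_rfl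
  rw [hset, measure_iUnion hdisj fun x => (𝓕.le k _ hB).inter (hI.measurableSet_path hk n _),
    tsum_fintype]
  simp_rw [hI.traj_law k hk B hB]
  rw [← lintegral_finsetSum]
  · refine lintegral_congr fun ω => ?_
    rw [← sum_pathProb, ENNReal.ofReal_sum_of_nonneg]
    exact fun x _ => pathProb_nonneg (hI.rule k hk ω) n _
  · exact fun x _ => (measurable_pathProb hmeas n _).ennreal_ofReal

/-- Conditioning on `𝓕 k` without conditional expectations: restriction to the event and reweighting
by its conditional probability define measures that agree on `𝓕 k`, hence have the same integral of
`f`. -/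
lemma IsInteraction.lintegral_indicator_eq [IsProbabilityMeasure μ]
    (hI : M.IsInteraction μ 𝓕 K c ρ X)
    {k : ℕ} (hk : k < K) {f : Ω → ℝ≥0∞} (hf : Measurable[𝓕 k] f) (n : ℕ) (y : Option Γ) :
    ∫⁻ ω, f ω * ENNReal.ofReal (if X k ω n = y then 1 else 0) ∂μ
      = ∫⁻ ω, f ω * ENNReal.ofReal (M.law (ρ k ω) M.s₀ n y) ∂μ := by
  have hm := 𝓕.le k
  have hA := hI.measurableSet_eq hk n y
  have hlaw : Measurable fun ω => ENNReal.ofReal (M.law (ρ k ω) M.s₀ n y) :=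
    (measurable_law (fun i z => (hI.rule_meas k hk i z).mono hm le_rfl) M.s₀ n y).ennreal_ofReal
  have hf' : Measurable f := hf.mono hm le_rfl
  have htrim : (μ.restrict {ω | X k ω n = y}).trim hm
      = (μ.withDensity fun ω => ENNReal.ofReal (M.law (ρ k ω) M.s₀ n y)).trim hm := by
    refine @Measure.ext _ (𝓕 k) _ _ fun B hB => ?_
    rw [trim_measurableSet_eq hm hB, trim_measurableSet_eq hm hB,
      Measure.restrict_apply (hm _ hB), withDensity_apply _ (hm _ hB), hI.measure_inter_eq hk hB]
  have h1 : ∫⁻ ω, f ω ∂(μ.restrict {ω | X k ω n = y})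
      = ∫⁻ ω, f ω ∂(μ.withDensity fun ω => ENNReal.ofReal (M.law (ρ k ω) M.s₀ n y)) := by
    rw [← lintegral_trim hm hf, ← lintegral_trim hm hf, htrim]
  rw [lintegral_withDensity_eq_lintegral_mul _ hlaw hf', ← lintegral_indicator hA] at h1
  calc ∫⁻ ω, f ω * ENNReal.ofReal (if X k ω n = y then 1 else 0) ∂μ
      = ∫⁻ ω, ({ω | X k ω n = y}.indicator f) ω ∂μ := by
        refine lintegral_congr fun ω => ?_
        by_cases h : X k ω n = y <;> simp [Set.indicator, h]
    _ = _ := h1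
    _ = _ := lintegral_congr fun ω => by simp [mul_comm]

/-- Trajectories stay at the goal. -/
lemma IsInteraction.ae_absorbing (hI : M.IsInteraction μ 𝓕 K c ρ X) {k : ℕ} (hk : k < K) :
    ∀ᵐ ω ∂μ, ∀ i, X k ω i = none → X k ω (i + 1) = none := by
  rw [ae_all_iff]
  intro i
  have hnull : ∀ z, μ {ω | X k ω i = none ∧ X k ω (i + 1) = some z} = 0 := by
    intro z
    -- Cover the event by finitely many cylinders, each containing a step from the goal to a pair,
    -- which has probability `0`.
    refine measure_mono_null (t := ⋃ x : Fin i → Option Γ,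
      {ω | ∀ j ≤ i + 1, X k ω j = extendPath (n := i + 1)
        (Fin.snoc (α := fun _ => Option Γ) x none) (some z) j}) ?_ ?_
    · rintro ω ⟨h1, h2⟩
      refine Set.mem_iUnion.2 ⟨fun j => X k ω j, fun j hj => ?_⟩
      unfold extendPath
      split_ifs with h
      · simp only [Fin.snoc]
        split_ifs with h'
        · rfl
        · have : j = i := by simp at h'; omega
          subst this
          exact h1
      · have : j = i + 1 := by omega
        rw [this]; exact h2
    · refine measure_iUnion_null fun x => ?_
      have h := hI.traj_law k hk Set.univ MeasurableSet.univ (i + 1) (extendPath (n := i + 1)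
        (Fin.snoc (α := fun _ => Option Γ) x none) (some z))
      rw [Set.univ_inter] at h
      rw [h]
      refine (lintegral_congr fun ω => ?_).trans lintegral_zero
      have h0 : M.stepProb (ρ k ω (i + 1)) (extendPath (n := i + 1)
          (Fin.snoc (α := fun _ => Option Γ) x none) (some z) i) (extendPath (n := i + 1)
          (Fin.snoc (α := fun _ => Option Γ) x none) (some z) (i + 1)) = 0 := by
        simp [extendPath, Fin.snoc, stepProb]
      rw [pathProb, Finset.prod_range_succ, h0]
      simp
  rw [ae_iff]
  refine measure_mono_null (t := ⋃ z, {ω | X k ω i = none ∧ X k ω (i + 1) = some z}) ?_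
    (measure_iUnion_null hnull)
  intro ω hω
  simp only [Set.mem_ofPred_eq, Classical.not_imp] at hω
  obtain ⟨z, hz⟩ := Option.ne_none_iff_exists'.1 hω.2
  exact Set.mem_iUnion.2 ⟨z, hω.1, hz⟩

lemma IsInteraction.measure_not_reached_le [IsProbabilityMeasure μ]
    (hI : M.IsInteraction μ 𝓕 K c ρ X) {k : ℕ}
    (hk : k < K) {π : S → Γ} (hπ : ∀ s, M.src (π s) = s) {n : ℕ}
    (hρ : ∀ ω i, n ≤ i → ρ k ω i = M.det π) (t : ℕ) {b : ℝ} (hb0 : 0 ≤ b)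
    (hb : ∀ s, M.surv π t s ≤ b) : μ {ω | X k ω (n + t) ≠ none} ≤ ENNReal.ofReal b := by
  have hset : {ω | X k ω (n + t) ≠ none} = ⋃ z, {ω | X k ω (n + t) = some z} := by
    ext ω
    simp [Option.ne_none_iff_exists']
  have h1 : ∀ z, μ {ω | X k ω (n + t) = some z}
      = ∫⁻ ω, ENNReal.ofReal (M.law (ρ k ω) M.s₀ (n + t) (some z)) ∂μ := by
    intro z
    have := hI.measure_inter_eq hk MeasurableSet.univ (n + t) (some z)
    simpa using this
  have hmeas := fun i z => (hI.rule_meas k hk i z).mono (𝓕.le k) le_rfl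
  rw [hset]
  refine (measure_iUnion_le _).trans ?_
  rw [tsum_fintype]
  simp_rw [h1]
  rw [← lintegral_finsetSum _ fun z _ => (measurable_law hmeas _ _ _).ennreal_ofReal]
  calc ∫⁻ ω, ∑ z, ENNReal.ofReal (M.law (ρ k ω) M.s₀ (n + t) (some z)) ∂μ
      ≤ ∫⁻ _, ENNReal.ofReal b ∂μ := by
        refine lintegral_mono fun ω => ?_
        rw [← ENNReal.ofReal_sum_of_nonneg fun z _ => law_nonneg (hI.rule k hk ω) _ _ _]
        exact ENNReal.ofReal_le_ofReal (sum_law_add_le hπ (hI.rule k hk ω) (hρ ω) _ t hb0 hb)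
    _ = ENNReal.ofReal b := by simp

end Trajectories

/-! ### A Freedman-type inequality with the layer-weighted cost as variance proxy. -/

section Concentration

variable {S Γ : Type*} [Fintype S] [DecidableEq S] [Fintype Γ] [DecidableEq Γ] {M : SSP S Γ}
  {Ω : Type*} {m : MeasurableSpace Ω} {μ : Measure Ω} {𝓕 : Filtration ℕ m}
  {K : ℕ} {c : ℕ → Ω → Γ → ℝ} {ρ : ℕ → Ω → ℕ → Γ → ℝ} {X : ℕ → Ω → ℕ → Option Γ}

/-- Indicators of the values of a trajectory. -/
def pathInd (x : ℕ → Option Γ) (i : ℕ) (y : Option Γ) : ℝ := if x i = y then 1 else 0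

lemma pathInd_nonneg (x : ℕ → Option Γ) (i : ℕ) (y : Option Γ) : 0 ≤ pathInd x i y := by
  unfold pathInd; split_ifs <;> norm_num

lemma sum_pathInd (x : ℕ → Option Γ) (i : ℕ) : ∑ y, pathInd x i y = 1 := by
  simp [pathInd]

lemma measurable_layerCost {m' : MeasurableSpace Ω} {p : Ω → ℕ → Option Γ → ℝ} {d : Ω → Γ → ℝ}
    (hp : ∀ i y, Measurable fun ω => p ω i y) (hd : ∀ z, Measurable fun ω => d ω z) (H₁ j : ℕ) :
    Measurable fun ω => layerCost H₁ (p ω) (d ω) j := by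
  unfold layerCost
  split_ifs
  · exact Finset.measurable_fun_sum _ fun z _ => (hp _ _).mul (hd z)
  · exact Finset.measurable_fun_sum _ fun z _ => hp _ _

lemma IsInteraction.measurable_pathInd (hI : M.IsInteraction μ 𝓕 K c ρ X) {k : ℕ} (hk : k < K)
    (i : ℕ) (y : Option Γ) : Measurable[𝓕 (k + 1)] fun ω => pathInd (X k ω) i y :=
  Measurable.ite (hI.traj_meas k hk i y) measurable_const measurable_const

/-- `layerCost` is linear in the marginals, so conditioning replaces path indicators by their law.
-/
lemma IsInteraction.lintegral_layerCost [IsProbabilityMeasure μ]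
    (hI : M.IsInteraction μ 𝓕 K c ρ X) {k : ℕ} (hk : k < K)
    {f : Ω → ℝ≥0∞} (hf : Measurable[𝓕 k] f) (H₁ j : ℕ) :
    ∫⁻ ω, f ω * ENNReal.ofReal (layerCost H₁ (pathInd (X k ω)) (c k ω) j) ∂μ
      = ∫⁻ ω, f ω * ENNReal.ofReal (layerCost H₁ (M.law (ρ k ω) M.s₀) (c k ω) j) ∂μ := by
  have hm := 𝓕.le k
  have key : ∀ (i : ℕ) (d : Ω → Γ → ℝ), (∀ z, Measurable[𝓕 k] fun ω => d ω z) →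
      (∀ ω z, 0 ≤ d ω z) →
      ∫⁻ ω, f ω * ENNReal.ofReal (∑ z, pathInd (X k ω) i (some z) * d ω z) ∂μ
        = ∫⁻ ω, f ω * ENNReal.ofReal (∑ z, M.law (ρ k ω) M.s₀ i (some z) * d ω z) ∂μ := by
    intro i d hd hd0
    have e : ∀ (p : Ω → Option Γ → ℝ), (∀ ω y, 0 ≤ p ω y) → (∀ y, Measurable fun ω => p ω y) →
        ∫⁻ ω, f ω * ENNReal.ofReal (∑ z, p ω (some z) * d ω z) ∂μ
          = ∑ z, ∫⁻ ω, (f ω * ENNReal.ofReal (d ω z)) * ENNReal.ofReal (p ω (some z)) ∂μ := by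
      intro p hp hpm
      rw [← lintegral_finsetSum]
      · refine lintegral_congr fun ω => ?_
        rw [ENNReal.ofReal_sum_of_nonneg fun z _ => mul_nonneg (hp _ _) (hd0 _ _),
          Finset.mul_sum]
        refine Finset.sum_congr rfl fun z _ => ?_
        rw [ENNReal.ofReal_mul (hp _ _), mul_assoc, mul_comm (ENNReal.ofReal (p ω (some z)))]
      · exact fun z _ => ((hf.mono hm le_rfl).mul
          ((hd z).mono hm le_rfl).ennreal_ofReal).mul (hpm _).ennreal_ofReal
    rw [e (fun ω => pathInd (X k ω) i) (fun ω => pathInd_nonneg _ i)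
        (fun y => (hI.measurable_pathInd hk i y).mono (𝓕.le _) le_rfl),
      e (fun ω => M.law (ρ k ω) M.s₀ i) (fun ω => law_nonneg (hI.rule k hk ω) _ i)
        (fun y => (measurable_law (hI.rule_meas k hk) _ i y).mono hm le_rfl)]
    exact Finset.sum_congr rfl fun z _ =>
      hI.lintegral_indicator_eq hk (hf.mul (hd z).ennreal_ofReal) i (some z)
  unfold layerCost
  split_ifs
  · exact key j (c k) (hI.cost_meas k hk) fun ω z => (hI.cost_mem k hk ω z).1
  · simpa using key (H₁ - 1) (fun _ _ => 1) (fun _ => measurable_const) fun _ _ => zero_le_one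

/-- Exponential moment of the cost of one episode in the loop-free instance. -/
lemma IsInteraction.lintegral_exp_le [IsProbabilityMeasure μ]
    (hI : M.IsInteraction μ 𝓕 K c ρ X) {k : ℕ} (hk : k < K)
    {f : Ω → ℝ≥0∞} (hf : Measurable[𝓕 k] f) (H₁ H : ℕ) {θ : ℝ} (hθ : 0 ≤ θ) (hθH : θ * H ≤ 1) :
    ∫⁻ ω, f ω * ENNReal.ofReal (Real.exp
        (θ * ∑ j ∈ Finset.range H, layerCost H₁ (pathInd (X k ω)) (c k ω) j)) ∂μ
      ≤ ∫⁻ ω, f ω * ENNReal.ofReal (Real.exp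
        (θ * ∑ j ∈ Finset.range H, layerCost H₁ (M.law (ρ k ω) M.s₀) (c k ω) j
          + 2 * θ ^ 2 * ∑ j ∈ Finset.range H,
            ((j : ℝ) + 1) * layerCost H₁ (M.law (ρ k ω) M.s₀) (c k ω) j)) ∂μ := by
  have hm := 𝓕.le k
  have hc0 : ∀ ω z, 0 ≤ c k ω z := fun ω z => (hI.cost_mem k hk ω z).1
  have hc1 : ∀ ω z, c k ω z ≤ 1 := fun ω z => (hI.cost_mem k hk ω z).2
  -- From `exp x ≤ 1 + x + x²` on `[0, 1]` and `sq_sum_le_weighted`, the exponential is at most `1 +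
  -- ∑ a j · y j`, affine in the layer costs `y j`. It can be integrated term by term before
  -- returning to an exponential by `1 + x ≤ exp x`.
  set a : ℕ → ℝ := fun j => θ + 2 * θ ^ 2 * ((j : ℝ) + 1) with ha
  have ha0 : ∀ j, 0 ≤ a j := fun j => by simp only [ha]; positivity
  have hsplit : ∀ y : ℕ → ℝ, ∑ j ∈ Finset.range H, a j * y j
      = θ * ∑ j ∈ Finset.range H, y j
        + 2 * θ ^ 2 * ∑ j ∈ Finset.range H, ((j : ℝ) + 1) * y j := by
    intro y
    rw [Finset.mul_sum, Finset.mul_sum, ← Finset.sum_add_distrib]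
    exact Finset.sum_congr rfl fun j _ => by simp only [ha]; ring
  have hlin : ∀ p : Ω → ℕ → Option Γ → ℝ, (∀ ω i y, 0 ≤ p ω i y) →
      (∀ i y, Measurable fun ω => p ω i y) →
      ∫⁻ ω, f ω * ENNReal.ofReal (1 + ∑ j ∈ Finset.range H, a j * layerCost H₁ (p ω) (c k ω) j) ∂μ
        = ∫⁻ ω, f ω ∂μ + ∑ j ∈ Finset.range H, ENNReal.ofReal (a j) *
          ∫⁻ ω, f ω * ENNReal.ofReal (layerCost H₁ (p ω) (c k ω) j) ∂μ := by
    intro p hp hpm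
    have hf' : Measurable f := hf.mono hm le_rfl
    have hl : ∀ j, Measurable fun ω => layerCost H₁ (p ω) (c k ω) j := fun j =>
      measurable_layerCost hpm (fun z => (hI.cost_meas k hk z).mono hm le_rfl) H₁ j
    have hg : ∀ j, Measurable fun ω => f ω * ENNReal.ofReal (layerCost H₁ (p ω) (c k ω) j) :=
      fun j => hf'.mul (hl j).ennreal_ofReal
    simp_rw [← lintegral_const_mul _ (hg _)]
    rw [← lintegral_finsetSum _ fun j _ => (hg j).const_mul _, ← lintegral_add_left hf']
    refine lintegral_congr fun ω => ?_
    have h0 : ∀ j, 0 ≤ a j * layerCost H₁ (p ω) (c k ω) j := fun j =>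
      mul_nonneg (ha0 j) (layerCost_nonneg (hp ω) (hc0 ω) j)
    rw [ENNReal.ofReal_add zero_le_one (Finset.sum_nonneg fun j _ => h0 j), ENNReal.ofReal_one,
      mul_add, mul_one, ENNReal.ofReal_sum_of_nonneg fun j _ => h0 j, Finset.mul_sum]
    congr 1
    refine Finset.sum_congr rfl fun j _ => ?_
    rw [ENNReal.ofReal_mul (ha0 j)]
    ring
  calc _ ≤ ∫⁻ ω, f ω * ENNReal.ofReal (1 + ∑ j ∈ Finset.range H,
        a j * layerCost H₁ (pathInd (X k ω)) (c k ω) j) ∂μ := by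
        refine lintegral_mono fun ω => ?_
        gcongr
        set y := layerCost H₁ (pathInd (X k ω)) (c k ω) with hy
        have hy0 : ∀ j, 0 ≤ y j := layerCost_nonneg (pathInd_nonneg _) (hc0 ω)
        have hy1 : ∀ j, y j ≤ 1 := layerCost_le_one (pathInd_nonneg _)
          (fun i => (sum_pathInd _ i).le) (hc1 ω)
        set Y := ∑ j ∈ Finset.range H, y j with hY
        have hY0 : 0 ≤ Y := Finset.sum_nonneg fun j _ => hy0 j
        have hYH : Y ≤ H := by
          have := Finset.sum_le_sum fun j (_ : j ∈ Finset.range H) => hy1 j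
          simpa using this
        have hsq := sq_sum_le_weighted hy0 hy1 H
        have hle : θ * Y ≤ 1 := (mul_le_mul_of_nonneg_left hYH hθ).trans hθH
        have hexp := Real.abs_exp_sub_one_sub_id_le (x := θ * Y)
          (by rw [abs_of_nonneg (by positivity)]; exact hle)
        have hexp' := (abs_le.1 hexp).2
        have h2 := mul_le_mul_of_nonneg_left hsq (sq_nonneg θ)
        rw [hsplit]
        nlinarith
    _ = ∫⁻ ω, f ω * ENNReal.ofReal (1 + ∑ j ∈ Finset.range H,
        a j * layerCost H₁ (M.law (ρ k ω) M.s₀) (c k ω) j) ∂μ := by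
        rw [hlin (fun ω => pathInd (X k ω)) (fun ω => pathInd_nonneg _)
            (fun i y => (hI.measurable_pathInd hk i y).mono (𝓕.le _) le_rfl),
          hlin (fun ω => M.law (ρ k ω) M.s₀) (fun ω => law_nonneg (hI.rule k hk ω) _)
            (fun i y => (measurable_law (hI.rule_meas k hk) _ i y).mono hm le_rfl)]
        congr 1
        exact Finset.sum_congr rfl fun j _ => by rw [hI.lintegral_layerCost hk hf]
    _ ≤ _ := by
        refine lintegral_mono fun ω => ?_
        gcongr
        rw [hsplit]
        have := Real.add_one_le_exp
          (θ * ∑ j ∈ Finset.range H, layerCost H₁ (M.law (ρ k ω) M.s₀) (c k ω) j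
          + 2 * θ ^ 2 * ∑ j ∈ Finset.range H,
            ((j : ℝ) + 1) * layerCost H₁ (M.law (ρ k ω) M.s₀) (c k ω) j)
        linarith

/-- Deviation of the realized cost of an episode, compensated by its variance proxy. -/
noncomputable def deviation (M : SSP S Γ) (H₁ H : ℕ) (θ : ℝ) (d : Γ → ℝ) (r : ℕ → Γ → ℝ)
    (x : ℕ → Option Γ) : ℝ :=
  θ * ∑ j ∈ Finset.range H, layerCost H₁ (pathInd x) d j
    - (θ * ∑ j ∈ Finset.range H, layerCost H₁ (M.law r M.s₀) d j
      + 2 * θ ^ 2 * ∑ j ∈ Finset.range H, ((j : ℝ) + 1) * layerCost H₁ (M.law r M.s₀) d j)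

/-- The exponential of the compensated sum is a supermartingale started at `1`. Measurability is
carried in the same induction because the past enters the next step as an `𝓕 n`-measurable weight.
-/
lemma IsInteraction.lintegral_exp_deviation_le [IsProbabilityMeasure μ]
    (hI : M.IsInteraction μ 𝓕 K c ρ X)
    (H₁ H : ℕ) {θ : ℝ} (hθ : 0 ≤ θ) (hθH : θ * H ≤ 1) (n : ℕ) (hn : n ≤ K) :
    Measurable[𝓕 n] (fun ω => ∑ k ∈ Finset.range n,
      M.deviation H₁ H θ (c k ω) (ρ k ω) (X k ω)) ∧
    ∫⁻ ω, ENNReal.ofReal (Real.exp (∑ k ∈ Finset.range n,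
      M.deviation H₁ H θ (c k ω) (ρ k ω) (X k ω))) ∂μ ≤ 1 := by
  induction n with
  | zero => simp
  | succ n ih =>
    have hk : n < K := hn
    obtain ⟨hmeas, hbound⟩ := ih hk.le
    have hm := 𝓕.mono (Nat.le_succ n)
    have hlaw : ∀ j, Measurable[𝓕 n] fun ω =>
        layerCost H₁ (M.law (ρ n ω) M.s₀) (c n ω) j := fun j =>
      measurable_layerCost (fun i y => measurable_law (hI.rule_meas n hk) _ i y)
        (hI.cost_meas n hk) H₁ j
    have hcomp : Measurable[𝓕 n] fun ω =>
        (θ * ∑ j ∈ Finset.range H, layerCost H₁ (M.law (ρ n ω) M.s₀) (c n ω) j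
          + 2 * θ ^ 2 * ∑ j ∈ Finset.range H,
            ((j : ℝ) + 1) * layerCost H₁ (M.law (ρ n ω) M.s₀) (c n ω) j) :=
      ((Finset.measurable_fun_sum _ fun j _ => hlaw j).const_mul _).add
        ((Finset.measurable_fun_sum _ fun j _ => (hlaw j).const_mul _).const_mul _)
    have hreal : Measurable[𝓕 (n + 1)] fun ω =>
        θ * ∑ j ∈ Finset.range H, layerCost H₁ (pathInd (X n ω)) (c n ω) j :=
      (Finset.measurable_fun_sum _ fun j _ =>
        measurable_layerCost (fun i y => hI.measurable_pathInd hk i y)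
          (fun z => (hI.cost_meas n hk z).mono hm le_rfl) H₁ j).const_mul _
    refine ⟨?_, ?_⟩
    · simp_rw [Finset.sum_range_succ]
      exact (hmeas.mono hm le_rfl).add (hreal.sub (hcomp.mono hm le_rfl))
    · set f : Ω → ℝ≥0∞ := fun ω => ENNReal.ofReal (Real.exp (∑ k ∈ Finset.range n,
        M.deviation H₁ H θ (c k ω) (ρ k ω) (X k ω)
        - (θ * ∑ j ∈ Finset.range H, layerCost H₁ (M.law (ρ n ω) M.s₀) (c n ω) j
          + 2 * θ ^ 2 * ∑ j ∈ Finset.range H,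
            ((j : ℝ) + 1) * layerCost H₁ (M.law (ρ n ω) M.s₀) (c n ω) j))) with hf
      have hfm : Measurable[𝓕 n] f := (Real.measurable_exp.comp (hmeas.sub hcomp)).ennreal_ofReal
      calc _ = ∫⁻ ω, f ω * ENNReal.ofReal (Real.exp
            (θ * ∑ j ∈ Finset.range H, layerCost H₁ (pathInd (X n ω)) (c n ω) j)) ∂μ := by
            refine lintegral_congr fun ω => ?_
            rw [hf, ← ENNReal.ofReal_mul (Real.exp_pos _).le, ← Real.exp_add,
              Finset.sum_range_succ, deviation]
            congr 2
            ring
        _ ≤ _ := hI.lintegral_exp_le hk hfm H₁ H hθ hθH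
        _ = ∫⁻ ω, ENNReal.ofReal (Real.exp (∑ k ∈ Finset.range n,
            M.deviation H₁ H θ (c k ω) (ρ k ω) (X k ω))) ∂μ := by
            refine lintegral_congr fun ω => ?_
            rw [hf, ← ENNReal.ofReal_mul (Real.exp_pos _).le, ← Real.exp_add]
            congr 2
            ring
        _ ≤ 1 := hbound

/-- Markov's inequality for the exponential supermartingale. -/
lemma IsInteraction.measure_deviation_ge_le [IsProbabilityMeasure μ]
    (hI : M.IsInteraction μ 𝓕 K c ρ X) (H₁ H : ℕ) {θ : ℝ} (hθ : 0 ≤ θ) (hθH : θ * H ≤ 1)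
    {b : ℝ} (hb : 0 < b) :
    μ {ω | Real.log (1 / b) ≤ ∑ k ∈ Finset.range K,
      M.deviation H₁ H θ (c k ω) (ρ k ω) (X k ω)} ≤ ENNReal.ofReal b := by
  obtain ⟨hmeas, hbound⟩ := hI.lintegral_exp_deviation_le H₁ H hθ hθH K le_rfl
  have hm : Measurable fun ω => ENNReal.ofReal (Real.exp (∑ k ∈ Finset.range K,
      M.deviation H₁ H θ (c k ω) (ρ k ω) (X k ω))) :=
    (Real.measurable_exp.comp (hmeas.mono (𝓕.le K) le_rfl)).ennreal_ofReal
  have h1 := meas_ge_le_lintegral_div (μ := μ) hm.aemeasurable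
    (ε := ENNReal.ofReal (1 / b)) (by simpa using hb) ENNReal.ofReal_ne_top
  refine (measure_mono fun ω hω => ?_).trans (h1.trans ?_)
  · refine Set.mem_ofPred_eq ▸ ENNReal.ofReal_le_ofReal ?_
    rw [← Real.exp_log (by positivity : (0 : ℝ) < 1 / b)]
    exact Real.exp_le_exp.2 hω
  · refine (ENNReal.div_le_div_right hbound _).trans ?_
    rw [one_div b, ENNReal.ofReal_inv_of_pos hb]
    simp

end Concentration

end SSP

namespace SSP

/-! ### Mirror descent in the loop-free instance and translation to the original one. -/

section Regret

variable {S Γ : Type*} [Fintype S] [DecidableEq S] [Fintype Γ] [DecidableEq Γ] {M : SSP S Γ}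

lemma sum_skew_embed_mul {H₁ H : ℕ} (lam : ℝ) (p : ℕ → Option Γ → ℝ) (d : Γ → ℝ) :
    ∑ w, skew lam (embed H₁ H p) w * loopFreeCost H d w
      = ∑ j ∈ Finset.range H, layerCost H₁ p d j
        + lam * ∑ j ∈ Finset.range H, ((j : ℝ) + 1) * layerCost H₁ p d j := by
  have h := sum_embed_mul (H₁ := H₁) (H := H) p d fun j => 1 + lam * ((j : ℝ) + 1)
  rw [Finset.mul_sum, ← Finset.sum_add_distrib]
  calc _ = ∑ w, embed H₁ H p w * ((1 + lam * (((w.2 : ℕ) : ℝ) + 1)) * loopFreeCost H d w) :=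
        Finset.sum_congr rfl fun w _ => by simp only [skew]; ring
    _ = _ := h
    _ = _ := Finset.sum_congr rfl fun j _ => by ring

lemma loopFreeCost_mem {H : ℕ} {d : Γ → ℝ} (hd : ∀ z, d z ∈ Set.Icc (0 : ℝ) 1)
    (w : Option Γ × Fin H) : loopFreeCost H d w ∈ Set.Icc (0 : ℝ) 1 := by
  obtain ⟨_ | z, j⟩ := w
  · simp [loopFreeCost]
  · exact hd z

/-- Regret of the algorithm in the loop-free instance. -/
lemma IsRun.occupancy_regret {πf : S → Γ} {H₁ H : ℕ} [NeZero H] {T η lam : ℝ} {K : ℕ}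
    {c : ℕ → Γ → ℝ} {q : ℕ → Option Γ × Fin H → ℝ} {ρ : ℕ → ℕ → Γ → ℝ}
    (hrun : M.IsRun πf H₁ H T η lam K c q ρ) (h0 : 0 < H₁) (hK : 0 < K) (hη : 0 < η)
    (hη2 : η ≤ 1 / 2) (hlam : 0 ≤ lam) (hlamH : lam * H ≤ 1)
    (hrule : ∀ k < K, ∀ i, M.IsRule (ρ k i)) (hc : ∀ k < K, ∀ z, c k z ∈ Set.Icc (0 : ℝ) 1)
    {p : ℕ → Option Γ → ℝ} (hp0 : ∀ i y, 0 ≤ p i y) (hp : embed H₁ H p ∈ (M.loopFree H₁ H).occ T) {E : ℝ}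
    (hE0 : 0 ≤ E) (hE : entropy η (skew lam (embed H₁ H p)) - entropy η (skew lam (q 0)) ≤ E) :
    ∑ k ∈ Finset.range K, ∑ j ∈ Finset.range H, layerCost H₁ (M.law (ρ k) M.s₀) (c k) j
      + lam * ∑ k ∈ Finset.range K, ∑ j ∈ Finset.range H,
          ((j : ℝ) + 1) * layerCost H₁ (M.law (ρ k) M.s₀) (c k) j
      ≤ (1 + 2 * η) * ∑ k ∈ Finset.range K, ∑ j ∈ Finset.range H, layerCost H₁ p (c k) j
        + 2 * lam * ∑ k ∈ Finset.range K, ∑ j ∈ Finset.range H,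
          ((j : ℝ) + 1) * layerCost H₁ p (c k) j + 2 * E := by
  have hnn : ∀ φ ∈ M.decisionSet H₁ H T lam, ∀ w, 0 ≤ φ w := by
    rintro _ ⟨u, hu, rfl⟩
    exact skew_nonneg hlam hu.1
  have hcw : ∀ k < K, ∀ w : Option Γ × Fin H, loopFreeCost H (c k) w ∈ Set.Icc (0 : ℝ) 1 :=
    fun k hk => loopFreeCost_mem (hc k hk)
  have hq : ∀ k < K, q k = embed H₁ H (M.law (ρ k) M.s₀) := fun k hk =>
    occ_eq_embed_law h0 (hrun.mem k hk) (hrun.follow k hk)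
  have homd := mirror_descent_regret hη (convex_decisionSet H₁ H T lam) hnn
    (φ := fun k => skew lam (q k)) (c := fun k => loopFreeCost H (c k)) hK
    (fun k hk => ⟨q k, hrun.mem k hk, rfl⟩) (fun k hk w => (hcw k hk w).1)
    hrun.init hrun.update ⟨_, hp, rfl⟩
  set A := ∑ k ∈ Finset.range K, ∑ j ∈ Finset.range H,
    layerCost H₁ (M.law (ρ k) M.s₀) (c k) j with hA
  set Ah := ∑ k ∈ Finset.range K, ∑ j ∈ Finset.range H,
    ((j : ℝ) + 1) * layerCost H₁ (M.law (ρ k) M.s₀) (c k) j with hAh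
  set B := ∑ k ∈ Finset.range K, ∑ j ∈ Finset.range H, layerCost H₁ p (c k) j with hB
  set Bh := ∑ k ∈ Finset.range K, ∑ j ∈ Finset.range H,
    ((j : ℝ) + 1) * layerCost H₁ p (c k) j with hBh
  have hlhs : ∑ k ∈ Finset.range K, ∑ w, (skew lam (q k) w - skew lam (embed H₁ H p) w) *
      loopFreeCost H (c k) w = (A + lam * Ah) - (B + lam * Bh) := by
    simp only [hA, hAh, hB, hBh, Finset.mul_sum (s := Finset.range K), ← Finset.sum_add_distrib]
    rw [← Finset.sum_sub_distrib]
    refine Finset.sum_congr rfl fun k hk => ?_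
    simp only [sub_mul, Finset.sum_sub_distrib]
    rw [hq k (Finset.mem_range.1 hk), sum_skew_embed_mul, sum_skew_embed_mul]
  have hlayer0 : ∀ k ∈ Finset.range K, ∀ j, 0 ≤ layerCost H₁ (M.law (ρ k) M.s₀) (c k) j :=
    fun k hk => layerCost_nonneg (law_nonneg (hrule k (Finset.mem_range.1 hk)) _)
      fun z => (hc k (Finset.mem_range.1 hk) z).1
  have hA0 : 0 ≤ A := Finset.sum_nonneg fun k hk => Finset.sum_nonneg fun j _ => hlayer0 k hk j
  have hAh0 : 0 ≤ Ah := Finset.sum_nonneg fun k hk => Finset.sum_nonneg fun j _ =>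
    mul_nonneg (by positivity) (hlayer0 k hk j)
  -- Here `λ H ≤ 1` gives `skew ≤ 2 q`, and `c² ≤ c` turns the stability term into the learner's own
  -- cost.
  have hquad : ∑ k ∈ Finset.range K, ∑ w, skew lam (q k) w * loopFreeCost H (c k) w ^ 2
      ≤ 2 * A := by
    rw [hA, Finset.mul_sum]
    refine Finset.sum_le_sum fun k hk => ?_
    have hk' := Finset.mem_range.1 hk
    have h1 := sum_embed_mul (H₁ := H₁) (H := H) (M.law (ρ k) M.s₀) (c k) fun _ => 1
    simp only [one_mul] at h1
    rw [← h1, Finset.mul_sum, ← hq k hk']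
    refine Finset.sum_le_sum fun w _ => ?_
    have hw := hcw k hk' w
    have h2 := skew_le hlamH hlam (hrun.mem k hk').1 w
    have h3 := (hrun.mem k hk').1 w
    calc skew lam (q k) w * loopFreeCost H (c k) w ^ 2
        ≤ (2 * q k w) * loopFreeCost H (c k) w ^ 2 :=
          mul_le_mul_of_nonneg_right h2 (sq_nonneg _)
      _ ≤ (2 * q k w) * loopFreeCost H (c k) w :=
          mul_le_mul_of_nonneg_left (by nlinarith [hw.1, hw.2]) (by linarith)
      _ = _ := by ring
  rw [hlhs] at homd
  have h1 : (A + lam * Ah) - (B + lam * Bh) ≤ E + η * A := by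
    have := mul_le_mul_of_nonneg_left hquad (by positivity : 0 ≤ η / 2)
    linarith
  have h2 : 0 ≤ lam * Ah := mul_nonneg hlam hAh0
  -- Self-bounding: `η ≤ 1/2` first bounds `A` by twice the comparator terms; inserting this back
  -- into `η A` keeps the factor `1 + 2 η` on `B`.
  have h3 : η * A ≤ 1 / 2 * A := mul_le_mul_of_nonneg_right hη2 hA0
  have h4 : A ≤ 2 * (B + lam * Bh + E) := by linarith
  have h5 : η * A ≤ η * (2 * (B + lam * Bh + E)) := mul_le_mul_of_nonneg_left h4 hη.le
  have hBh0 : 0 ≤ Bh := Finset.sum_nonneg fun k hk => Finset.sum_nonneg fun j _ =>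
    mul_nonneg (by positivity)
      (layerCost_nonneg hp0 (fun z => (hc k (Finset.mem_range.1 hk) z).1) j)
  have h6 : 0 ≤ lam * Bh + E := add_nonneg (mul_nonneg hlam hBh0) hE0
  have h7 := mul_le_mul_of_nonneg_right hη2 h6
  nlinarith

lemma sum_layerCost_le {H₁ : ℕ} {p : ℕ → Option Γ → ℝ} (hp : ∀ i y, 0 ≤ p i y)
    (hp1 : ∀ i, ∑ y, p i y ≤ 1) {d : Γ → ℝ} (hd : ∀ z, d z ≤ 1) (H : ℕ) :
    ∑ j ∈ Finset.range H, layerCost H₁ p d j ≤ H := by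
  have := Finset.sum_le_sum fun j (_ : j ∈ Finset.range H) =>
    layerCost_le_one (H₁ := H₁) hp hp1 hd j
  simpa using this

/-- Skewing at most doubles the mass. The minimum of `T` and `H` is kept because the two parts of `1
/ η` are later paid with different ones of them. -/
lemma entropy_skew_diff_le {H₁ H : ℕ} [NeZero H] {T η lam : ℝ} (hη : 0 < η) (hlam : 0 ≤ lam)
    (hlamH : lam * H ≤ 1) (hT : 2 ≤ T) (hΓ : 0 < Fintype.card Γ) {u v : Option Γ × Fin H → ℝ}
    (hu : u ∈ (M.loopFree H₁ H).occ T) (hv : v ∈ (M.loopFree H₁ H).occ T)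
    (huH : ∑ w, u w ≤ H) (hvH : ∑ w, v w ≤ H) :
    entropy η (skew lam u) - entropy η (skew lam v)
      ≤ 1 / η * (8 * min T H * Real.log (Fintype.card Γ * H * T)) := by
  have hH : (1 : ℝ) ≤ H := by exact_mod_cast NeZero.one_le
  have hG : (1 : ℝ) ≤ Fintype.card Γ := by exact_mod_cast hΓ
  have hmass : ∀ u ∈ (M.loopFree H₁ H).occ T, ∑ w, u w ≤ H →
      ∑ w, skew lam u w ≤ 2 * min T H := by
    intro u hu huH
    calc ∑ w, skew lam u w ≤ ∑ w, 2 * u w :=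
          Finset.sum_le_sum fun w _ => skew_le hlamH hlam hu.1 w
      _ = 2 * ∑ w, u w := by rw [Finset.mul_sum]
      _ ≤ _ := by have := le_min hu.2.1 huH; linarith
  have hcard : ((Fintype.card (Option Γ × Fin H) : ℕ) : ℝ) ≤ 2 * Fintype.card Γ * H := by
    rw [Fintype.card_prod, Fintype.card_option, Fintype.card_fin]
    push_cast
    nlinarith
  have hub : ∀ w, skew lam u w ≤ 2 * T := fun w => by
    have h1 := skew_le hlamH hlam hu.1 w
    have h2 := Finset.single_le_sum (f := u) (fun w _ => hu.1 w) (Finset.mem_univ w)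
    linarith [hu.2.1]
  have hGH : (1 : ℝ) ≤ Fintype.card Γ * H := by nlinarith
  have h := entropy_diff_le hη (skew_nonneg hlam hu.1) (skew_nonneg hlam hv.1) hcard
    (by nlinarith) (by linarith) hub (hmass u hu huH) (hmass v hv hvH)
  refine h.trans (mul_le_mul_of_nonneg_left ?_ (by positivity))
  set L := Real.log (Fintype.card Γ * H * T) with hL
  have e1 : Real.log (2 * T) + Real.log (2 * Fintype.card Γ * H) = 2 * Real.log 2 + L := by
    have hL' : L = Real.log (Fintype.card Γ * H) + Real.log T :=
      Real.log_mul (by linarith) (by linarith)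
    rw [hL', Real.log_mul (by norm_num) (by linarith), mul_assoc,
      Real.log_mul (by norm_num) (by linarith)]
    ring
  have hL2 : Real.log 2 ≤ L := Real.log_le_log (by norm_num) (by nlinarith)
  have hl2 : 1 / 2 ≤ Real.log 2 := by have := Real.log_two_gt_d9; linarith
  have hmin : 1 ≤ min T (H : ℝ) := le_min (by linarith) hH
  have e2 : 2 * min T (H : ℝ) * Real.log (2 * T)
      + 2 * min T (H : ℝ) * Real.log (2 * Fintype.card Γ * H)
      = 2 * min T (H : ℝ) * (2 * Real.log 2 + L) := by rw [← e1]; ring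
  rw [e2]
  nlinarith [mul_le_mul_of_nonneg_left hL2 (by linarith : 0 ≤ min T (H : ℝ)),
    mul_le_mul_of_nonneg_right hmin (by linarith : 0 ≤ L)]

/-- Weighted cost of a deterministic policy in the loop-free instance. -/
lemma sum_layerCost_visitProb {π : S → Γ} (hπ : ∀ s, M.src (π s) = s) (H₁ H₂ : ℕ) (d : Γ → ℝ)
    (g : ℕ → ℝ) : ∑ j ∈ Finset.range (H₁ + H₂),
      g j * layerCost H₁ (M.visitProb (M.det π) M.s₀) d j
      = ∑ j ∈ Finset.range H₁, g j * M.iter π j (fun s => d (π s)) M.s₀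
        + (∑ i ∈ Finset.range H₂, g (H₁ + i)) * M.surv π (H₁ - 1) M.s₀ := by
  rw [Finset.sum_range_add, Finset.sum_mul]
  congr 1
  · exact Finset.sum_congr rfl fun j hj => by
      rw [layerCost_visitProb hπ, if_pos (Finset.mem_range.1 hj)]
  · exact Finset.sum_congr rfl fun j _ => by
      rw [layerCost_visitProb hπ, if_neg (by omega)]

/-- The loop-free cost dominates: a trajectory still running at an index `≥ H₁` was running at `H₁ -
1`, so the fast states charge `1` there. Reaching the goal by index `H` removes the rest of the
series. -/
lemma tsum_stepCost_le {H₁ H : ℕ} {x : ℕ → Option Γ} {d : Γ → ℝ}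
    (hd : ∀ z, d z ∈ Set.Icc (0 : ℝ) 1) (habs : ∀ i, x i = none → x (i + 1) = none)
    (hH : x H = none) :
    ∑' i, ENNReal.ofReal (stepCost d (x i))
      ≤ ENNReal.ofReal (∑ j ∈ Finset.range H, layerCost H₁ (pathInd x) d j) := by
  have hstay : ∀ i j, i ≤ j → x i = none → x j = none := by
    intro i j hij hi
    induction j, hij using Nat.le_induction with
    | base => exact hi
    | succ j _ ih => exact habs j ih
  rw [tsum_eq_sum (s := Finset.range H), ENNReal.ofReal_sum_of_nonneg]
  · refine Finset.sum_le_sum fun j _ => ENNReal.ofReal_le_ofReal ?_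
    unfold layerCost
    split_ifs with h
    · rcases hx : x j with _ | z <;> simp [stepCost, pathInd, hx]
    · rcases hx : x j with _ | z
      · exact Finset.sum_nonneg fun z _ => pathInd_nonneg _ _ _
      · have hne : x (H₁ - 1) ≠ none := fun h0 => by
          have := hstay _ j (by omega) h0
          rw [hx] at this
          exact absurd this (by simp)
        obtain ⟨z', hz'⟩ := Option.ne_none_iff_exists'.1 hne
        simp only [stepCost, pathInd, hz', Option.some.injEq, Finset.sum_ite_eq, Finset.mem_univ,
          if_true]
        exact (hd z).2
  · exact fun j _ => layerCost_nonneg (pathInd_nonneg _) (fun z => (hd z).1) j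
  · intro i hi
    rw [hstay H i (by simpa using hi) hH]
    simp [stepCost]

/-- Finiteness of `S` keeps the supremum below `⊤`, where `toReal` would return `0`. -/
lemma toReal_iSup_ofReal {f : S → ℝ} (hf : ∀ s, 0 ≤ f s) (s : S) :
    f s ≤ (⨆ s, ENNReal.ofReal (f s)).toReal := by
  have hne : ⨆ s, ENNReal.ofReal (f s) ≠ ⊤ := by
    refine ne_top_of_le_ne_top (b := ∑ s, ENNReal.ofReal (f s)) ?_ (iSup_le fun s => ?_)
    · simp
    · exact Finset.single_le_sum (f := fun s => ENNReal.ofReal (f s)) (fun _ _ => zero_le)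
        (Finset.mem_univ s)
  have h := ENNReal.toReal_mono hne (le_iSup (fun s => ENNReal.ofReal (f s)) s)
  rwa [ENNReal.toReal_ofReal (hf s)] at h

lemma val_le_tMax {π : S → Γ} (hπ : π ∈ M.proper) (s : S) :
    M.val π (fun _ => 1) s ≤ M.tMax π := by
  unfold tMax
  simp_rw [hittingTime_det hπ]
  exact toReal_iSup_ofReal (val_nonneg fun _ => zero_le_one) s

/-- The fast policy attains the inner minimum of the diameter at every state. -/
lemma val_le_diameter {π : S → Γ} (hπ : M.IsFast π) (s : S) :
    M.val π (fun _ => 1) s ≤ M.diameter := by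
  have h : ∀ s, ⨅ π' ∈ M.proper, M.hittingTime (M.det π') s
      = ENNReal.ofReal (M.val π (fun _ => 1) s) := fun s => by
    rw [← hittingTime_det hπ.1]
    exact le_antisymm (iInf₂_le π hπ.1) (le_iInf₂ fun π' hπ' => hπ.2 π' hπ' s)
  unfold diameter
  simp_rw [h]
  exact toReal_iSup_ofReal (val_nonneg fun _ => zero_le_one) s

lemma tStar_eq {π : S → Γ} (hπ : π ∈ M.proper) : M.tStar π = M.val π (fun _ => 1) M.s₀ := by
  rw [tStar, hittingTime_det hπ, ENNReal.toReal_ofReal (val_nonneg (fun _ => zero_le_one) _)]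

lemma totalCostToGo_eq {π : S → Γ} (hπ : π ∈ M.proper) {K : ℕ} {c : ℕ → Γ → ℝ}
    (hc : ∀ k < K, ∀ z, 0 ≤ c k z) :
    M.totalCostToGo K c π
      = ENNReal.ofReal (M.val π (fun s => ∑ k ∈ Finset.range K, c k (π s)) M.s₀) := by
  rw [val_sum hπ _ fun k hk s => hc k (Finset.mem_range.1 hk) _, ENNReal.ofReal_sum_of_nonneg]
  · exact Finset.sum_congr rfl fun k hk =>
      costToGo_det hπ (hc k (Finset.mem_range.1 hk)) _
  · exact fun k hk => val_nonneg (fun s => hc k (Finset.mem_range.1 hk) _) _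

end Regret

end SSP

namespace SSP

/-! ### Tuning of the parameters and the bound on the good event. -/

section FinalBound

set_option maxHeartbeats 400000 in
/-- The tuning of the learning rate and the skewness balances all error terms. -/
lemma tuned_bound {D T K H ℓ ℓ₀ L Lam η lam J B Bh E Y : ℝ} (hD : 1 ≤ D) (hT : 2 ≤ T)
    (hK : 1 ≤ K) (hH : 1 ≤ H) (hℓ₀ : 0 < ℓ₀) (hℓ : ℓ₀ ≤ ℓ) (hL : 1 / 2 ≤ L) (hLam : L ≤ Lam)
    (hLam1 : 1 ≤ Lam) (hη : η = min (1 / 2) (Real.sqrt (T * L / (D * K))))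
    (hlam : lam = min (1 / H) (Real.sqrt (ℓ / (D * T * K)))) (hJ : J ≤ D * K)
    (hB : B ≤ J + 2 * H) (hBh : Bh ≤ 3 * (D * T * K) + 2 * H * H)
    (hE : E = 1 / η * (8 * min T H * L))
    (hY : Y ≤ (1 + 2 * η) * B + 2 * lam * Bh + 2 * E + 2 * (ℓ + Real.log 2) / lam) :
    Y - J ≤ 50 * (1 + 1 / ℓ₀) * Lam * (Real.sqrt (D * T * K * ℓ) + H * ℓ) := by
  have hℓpos : 0 < ℓ := hℓ₀.trans_le hℓ
  set W := Real.sqrt (D * T * K) with hW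
  set sL := Real.sqrt L with hsL
  set sl := Real.sqrt ℓ with hsl
  have hDTK : 0 < D * T * K := by positivity
  have hWpos : 0 < W := Real.sqrt_pos.2 hDTK
  have hW2 : W ^ 2 = D * T * K := Real.sq_sqrt hDTK.le
  have hsLpos : 0 < sL := Real.sqrt_pos.2 (by linarith)
  have hsL2 : sL ^ 2 = L := Real.sq_sqrt (by linarith)
  have hslpos : 0 < sl := Real.sqrt_pos.2 hℓpos
  have hsl2 : sl ^ 2 = ℓ := Real.sq_sqrt hℓpos.le
  have hDK : 0 < D * K := by positivity
  have r1 : Real.sqrt (T * L / (D * K)) = W * sL / (D * K) := by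
    have : T * L / (D * K) = (W * sL / (D * K)) ^ 2 := by
      rw [div_pow, mul_pow, hW2, hsL2]
      field_simp
    rw [this, Real.sqrt_sq (by positivity)]
  have r2 : Real.sqrt (ℓ / (D * T * K)) = sl / W := Real.sqrt_div hℓpos.le _
  have r3 : Real.sqrt (D * T * K * ℓ) = W * sl := Real.sqrt_mul hDTK.le _
  rw [r1] at hη
  rw [r2] at hlam
  rw [r3]
  have hηpos : 0 < η := by rw [hη]; exact lt_min (by norm_num) (by positivity)
  have hη1 : η ≤ 1 / 2 := hη ▸ min_le_left _ _
  have hη2 : η ≤ W * sL / (D * K) := hη ▸ min_le_right _ _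
  have hlampos : 0 < lam := by rw [hlam]; exact lt_min (by positivity) (by positivity)
  have hlam1 : lam ≤ 1 / H := hlam ▸ min_le_left _ _
  have hlam2 : lam ≤ sl / W := hlam ▸ min_le_right _ _
  have hηinv : 1 / η ≤ 2 + D * K / (W * sL) := by
    rw [hη]
    rcases min_choice (1 / 2) (W * sL / (D * K)) with h | h <;> rw [h]
    · have : 0 < D * K / (W * sL) := by positivity
      norm_num
      linarith
    · rw [one_div_div]; linarith
  have hlaminv : 1 / lam ≤ H + W / sl := by
    rw [hlam]
    rcases min_choice (1 / H) (sl / W) with h | h <;> rw [h]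
    · have : 0 < W / sl := by positivity
      rw [one_div_one_div]; linarith
    · rw [one_div_div]; linarith
  -- The constant part of `1 / η` is paid with `min T H ≤ H`, the part `D K / (W sL)` with `min T H
  -- ≤ T`.
  have tE : E ≤ 16 * H * L + 8 * (W * sL) := by
    have hm : 0 < min T H := lt_min (by linarith) (by linarith)
    have hL0 : 0 < L := by linarith
    calc E ≤ (2 + D * K / (W * sL)) * (8 * min T H * L) := by
          rw [hE]; exact mul_le_mul_of_nonneg_right hηinv (by positivity)
      _ = 16 * min T H * L + 8 * (D * K / (W * sL) * L) * min T H := by ring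
      _ ≤ 16 * H * L + 8 * (D * K / (W * sL) * L) * T := by
          have h1 : min T H ≤ H := min_le_right _ _
          have h2 : min T H ≤ T := min_le_left _ _
          gcongr
      _ = 16 * H * L + 8 * (W * sL) := by
          have : D * K / (W * sL) * L * T = W * sL := by
            rw [div_mul_eq_mul_div, div_mul_eq_mul_div, div_eq_iff (by positivity)]
            calc D * K * L * T = (D * T * K) * L := by ring
              _ = W * sL * (W * sL) := by rw [← hW2, ← hsL2]; ring
          linear_combination 8 * this
  have tη : η * B ≤ W * sL + H := by
    calc η * B ≤ η * (D * K + 2 * H) := mul_le_mul_of_nonneg_left (by linarith) hηpos.le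
      _ = η * (D * K) + η * (2 * H) := by ring
      _ ≤ W * sL / (D * K) * (D * K) + 1 / 2 * (2 * H) := by gcongr
      _ = W * sL + H := by field_simp
  have tlam : lam * Bh ≤ 3 * (W * sl) + 2 * H := by
    calc lam * Bh ≤ lam * (3 * (D * T * K) + 2 * H * H) :=
          mul_le_mul_of_nonneg_left hBh hlampos.le
      _ = lam * (3 * W ^ 2) + lam * (2 * H * H) := by rw [hW2]; ring
      _ ≤ sl / W * (3 * W ^ 2) + 1 / H * (2 * H * H) := by gcongr
      _ = 3 * (W * sl) + 2 * H := by field_simp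
  have hlog2 : Real.log 2 ≤ 1 := by have := Real.log_two_lt_d9; linarith
  have hlog2' : 0 ≤ Real.log 2 := Real.log_nonneg (by norm_num)
  -- Several error terms carry no factor `ℓ`; since `ℓ ≥ ℓ₀`, multiplication by `u ℓ ≥ 1` supplies
  -- it. This is where the constant depends on `δ₀`.
  set u := 1 / ℓ₀ with hu
  have hupos : 0 < u := by positivity
  have hul : 1 ≤ u * ℓ := by
    rw [hu, div_mul_eq_mul_div, one_mul, le_div_iff₀ hℓ₀]; linarith
  have hHu : H ≤ u * (H * ℓ) :=
    calc H ≤ H * (u * ℓ) := le_mul_of_one_le_right (by linarith) hul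
      _ = u * (H * ℓ) := by ring
  have hslu : 1 ≤ (1 + u) * sl := by
    rcases le_total 1 sl with h | h
    · exact h.trans (le_mul_of_one_le_left hslpos.le (by linarith))
    · have h2 : ℓ ≤ sl := by
        rw [← hsl2, sq]; exact mul_le_of_le_one_left hslpos.le h
      have h3 : u * ℓ ≤ u * sl := mul_le_mul_of_nonneg_left h2 hupos.le
      linarith
  have hWu : W ≤ (1 + u) * (W * sl) :=
    calc W ≤ W * ((1 + u) * sl) := le_mul_of_one_le_right hWpos.le hslu
      _ = (1 + u) * (W * sl) := by ring
  have tdev : 2 * (ℓ + Real.log 2) / lam ≤ 2 * (1 + u) * (H * ℓ + W * sl) := by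
    have h1 : W / sl * ℓ = W * sl := by rw [← hsl2]; field_simp
    have h2 : ℓ + Real.log 2 ≤ (1 + u) * ℓ := by linarith
    calc 2 * (ℓ + Real.log 2) / lam = 2 * (ℓ + Real.log 2) * (1 / lam) := by ring
      _ ≤ 2 * ((1 + u) * ℓ) * (H + W / sl) := by gcongr
      _ = 2 * (1 + u) * (H * ℓ + W / sl * ℓ) := by ring
      _ = _ := by rw [h1]
  have hsLLam : sL ≤ Lam := by
    have : sL ≤ Real.sqrt (Lam ^ 2) := Real.sqrt_le_sqrt (hLam.trans (le_self_pow₀ hLam1 two_ne_zero))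
    rwa [Real.sqrt_sq (by linarith)] at this
  set P := (1 + u) * (W * sl) with hP
  set R := (1 + u) * (H * ℓ) with hR
  have hP0 : 0 ≤ P := by positivity
  have hR0 : 0 ≤ R := by positivity
  have hHR : H ≤ R := by
    have : 0 ≤ H * ℓ := by positivity
    rw [hR]; linarith
  have a1 : W * sL ≤ Lam * P := by
    calc W * sL ≤ P * Lam := by gcongr
      _ = Lam * P := mul_comm _ _
  have a2 : H * L ≤ Lam * R := by
    calc H * L ≤ R * Lam := by gcongr
      _ = Lam * R := mul_comm _ _
  have a3 : P ≤ Lam * P := le_mul_of_one_le_left hP0 hLam1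
  have a4 : R ≤ Lam * R := le_mul_of_one_le_left hR0 hLam1
  have a5 : W * sl ≤ P := le_mul_of_one_le_left (by positivity) (by linarith)
  have a6 : H * ℓ ≤ R := le_mul_of_one_le_left (by positivity) (by linarith)
  have e : 50 * (1 + u) * Lam * (W * sl + H * ℓ) = 50 * (Lam * P) + 50 * (Lam * R) := by
    rw [hP, hR]; ring
  rw [e]
  have e2 : 2 * (1 + u) * (H * ℓ + W * sl) = 2 * R + 2 * P := by rw [hP, hR]; ring
  rw [e2] at tdev
  have e3 : (1 + 2 * η) * B + 2 * lam * Bh = B + 2 * (η * B) + 2 * (lam * Bh) := by ring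
  rw [e3] at hY
  -- The contributions add up to at most `26 Lam P + 42 Lam R`, which leaves room below the factor
  -- `50`.
  linarith

variable {S Γ : Type*} [Fintype S] [DecidableEq S] [Fintype Γ] [DecidableEq Γ] {M : SSP S Γ}

lemma one_le_log_four_mul_div {K : ℕ} (hK : 0 < K) {δ : ℝ} (hδ : 0 < δ) (hδ1 : δ < 1) :
    1 ≤ Real.log (4 * K / δ) := by
  have hK1 : (1 : ℝ) ≤ K := by exact_mod_cast hK
  have h4 : Real.log 4 ≤ Real.log (4 * K / δ) := by
    refine Real.log_le_log (by norm_num) ?_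
    rw [le_div_iff₀ hδ]
    nlinarith
  have : Real.log 4 = 2 * Real.log 2 := by
    rw [show (4 : ℝ) = 2 ^ 2 by norm_num, Real.log_pow]; norm_num
  have := Real.log_two_gt_d9
  linarith

/-- `H₂ ≥ 1` rules out `K = 1`; so `ln K > 0`, which is needed for `H₁ > 0`. -/
lemma two_le_of_fastHorizon_le {K : ℕ} (hK : 0 < K) {δ : ℝ} (hδ : 0 < δ) (hδ1 : δ < 1)
    (hD : 1 ≤ M.diameter) (h : 2 * M.fastHorizon K δ ≤ K ^ 2) : 2 ≤ K := by
  have h1 := one_le_log_four_mul_div hK hδ hδ1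
  have h2 : 4 * M.diameter * Real.log (4 * K / δ) ≤ M.fastHorizon K δ := Nat.le_ceil _
  have h3 : (1 : ℝ) ≤ M.fastHorizon K δ := by nlinarith
  have h4 : 1 ≤ M.fastHorizon K δ := by exact_mod_cast h3
  by_contra hcon
  have : K = 1 := by omega
  subst this
  omega

/-- The reason for the choice of `H₂`: a union bound over `K` episodes then costs `δ / 2`. -/
lemma surv_fastHorizon_le {πf : S → Γ} (hfast : M.IsFast πf) {K : ℕ} (hK : 0 < K) {δ : ℝ}
    (hδ : 0 < δ) (s : S) : M.surv πf (M.fastHorizon K δ) s ≤ δ / (2 * K) := by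
  have hK1 : (1 : ℝ) ≤ K := by exact_mod_cast hK
  have hD : 1 ≤ M.diameter := (one_le_val_one hfast.1 s).trans (val_le_diameter hfast s)
  have h := surv_le_exp hfast.1 (val_le_diameter hfast) (M.fastHorizon K δ) s
  have h2 : 4 * M.diameter * Real.log (4 * K / δ) ≤ M.fastHorizon K δ := Nat.le_ceil _
  have h3 : Real.log (4 * K / δ) ≤ (M.fastHorizon K δ + 1) / (4 * M.diameter) := by
    rw [le_div_iff₀ (by linarith)]; linarith
  have h4 : Real.exp (-((M.fastHorizon K δ + 1) / (4 * M.diameter))) ≤ δ / (4 * K) := by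
    calc _ ≤ Real.exp (-Real.log (4 * K / δ)) := Real.exp_le_exp.2 (by linarith)
      _ = δ / (4 * K) := by
        rw [Real.exp_neg, Real.exp_log (by positivity), inv_div]
  calc _ ≤ 2 * (δ / (4 * K)) := by linarith
    _ = _ := by field_simp; norm_num

lemma surv_tMax_le {π : S → Γ} (hπ : π ∈ M.proper) {K H₁ : ℕ} (hK : 2 ≤ K)
    (hH₁ : 8 * M.tMax π * Real.log K ≤ H₁) (h0 : 0 < H₁) (s : S) :
    M.surv π (H₁ - 1) s ≤ 2 / (K : ℝ) ^ 2 := by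
  have hK1 : (2 : ℝ) ≤ K := by exact_mod_cast hK
  have hT : 1 ≤ M.tMax π := (one_le_val_one hπ s).trans (val_le_tMax hπ s)
  have h := surv_le_exp hπ (val_le_tMax hπ) (H₁ - 1) s
  have e : ((H₁ - 1 : ℕ) : ℝ) + 1 = H₁ := by
    rw [← Nat.cast_add_one]; congr 1; omega
  rw [e] at h
  have h3 : 2 * Real.log K ≤ H₁ / (4 * M.tMax π) := by
    rw [le_div_iff₀ (by linarith)]; linarith
  have h4 : Real.exp (-(H₁ / (4 * M.tMax π))) ≤ 1 / (K : ℝ) ^ 2 := by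
    calc _ ≤ Real.exp (-Real.log ((K : ℝ) ^ 2)) := by
          rw [Real.log_pow]; exact Real.exp_le_exp.2 (by push_cast; linarith)
      _ = _ := by rw [Real.exp_neg, Real.exp_log (by positivity), one_div]
  calc _ ≤ 2 * (1 / (K : ℝ) ^ 2) := by linarith
    _ = _ := by ring

set_option maxHeartbeats 1000000 in
/-- The regret bound outside of the exceptional event. -/
lemma regret_le_of_regular {πf π : S → Γ} (hfast : M.IsFast πf)
    {K H₁ H : ℕ} [NeZero H] {T δ ℓ₀ : ℝ} (hδ : 0 < δ) (hδ1 : δ < 1) (hℓ₀ : 0 < ℓ₀)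
    (hℓ : ℓ₀ ≤ Real.log (1 / δ)) (hH : H = H₁ + M.fastHorizon K δ)
    (hK2 : 2 * M.fastHorizon K δ ≤ K ^ 2) (hK : 0 < K)
    {c : ℕ → Γ → ℝ} {q : ℕ → Option Γ × Fin H → ℝ} {ρ : ℕ → ℕ → Γ → ℝ} {x : ℕ → ℕ → Option Γ}
    (hc : ∀ k < K, ∀ z, c k z ∈ Set.Icc (0 : ℝ) 1) (hrule : ∀ k < K, ∀ i, M.IsRule (ρ k i))
    (hrun : M.IsRun πf H₁ H T (M.learningRate T H K) (M.skewness T H K δ) K c q ρ)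
    (hbest : M.IsBest K c π) (hT : M.tStar π + 1 ≤ T) (hH₁ : 8 * M.tMax π * Real.log K ≤ H₁)
    (hdev : ∑ k ∈ Finset.range K, M.deviation H₁ H (M.skewness T H K δ / 2) (c k) (ρ k) (x k)
      < Real.log (1 / (δ / 2)))
    (habs : ∀ k < K, ∀ i, x k i = none → x k (i + 1) = none) (hreach : ∀ k < K, x k H = none) :
    M.regret K c x π ≤ ((50 * (1 + 1 / ℓ₀) * Real.log (Fintype.card Γ * H * T * K) *
      (Real.sqrt (M.diameter * T * K * Real.log (1 / δ)) + H * Real.log (1 / δ)) : ℝ) :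
        EReal) := by
  have hπ := hbest.1
  set D := M.diameter with hDdef
  set η := M.learningRate T H K with hη
  set lam := M.skewness T H K δ with hlam
  set H₂ := M.fastHorizon K δ with hH₂
  have hD : 1 ≤ D := (one_le_val_one hfast.1 M.s₀).trans (val_le_diameter hfast M.s₀)
  have hK2' : 2 ≤ K := two_le_of_fastHorizon_le hK hδ hδ1 hD hK2
  have hKr : (2 : ℝ) ≤ K := by exact_mod_cast hK2'
  have htS1 : 1 ≤ M.tStar π := by rw [tStar_eq hπ]; exact one_le_val_one hπ _
  have hT2 : 2 ≤ T := by linarith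
  have hlogK : 0 < Real.log K := Real.log_pos (by linarith)
  have htM1 : 1 ≤ M.tMax π := (one_le_val_one hπ M.s₀).trans (val_le_tMax hπ M.s₀)
  have h0 : 0 < H₁ := by
    have : (0 : ℝ) < H₁ := lt_of_lt_of_le (by positivity) hH₁
    exact_mod_cast this
  have hHr : (1 : ℝ) ≤ H := by exact_mod_cast NeZero.one_le
  have hΓ : 0 < Fintype.card Γ := Fintype.card_pos_iff.2 ⟨π M.s₀⟩
  have hΓr : (1 : ℝ) ≤ Fintype.card Γ := by exact_mod_cast hΓ
  have hGH : (1 : ℝ) ≤ Fintype.card Γ * H := by nlinarith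
  have hlog2 := Real.log_two_gt_d9
  have hL : 1 / 2 ≤ Real.log (Fintype.card Γ * H * T) := by
    have : Real.log 2 ≤ Real.log (Fintype.card Γ * H * T) :=
      Real.log_le_log (by norm_num) (by nlinarith)
    linarith
  have hGHT : (2 : ℝ) ≤ Fintype.card Γ * H * T := by nlinarith
  have hLLam : Real.log (Fintype.card Γ * H * T) ≤ Real.log (Fintype.card Γ * H * T * K) :=
    Real.log_le_log (by linarith) (by nlinarith)
  have hLam1 : 1 ≤ Real.log (Fintype.card Γ * H * T * K) := by
    have h4 : Real.log (2 ^ 2) ≤ Real.log (Fintype.card Γ * H * T * K) :=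
      Real.log_le_log (by norm_num) (by nlinarith)
    rw [Real.log_pow] at h4
    push_cast at h4
    linarith
  have hℓpos : 0 < Real.log (1 / δ) := hℓ₀.trans_le hℓ
  have hηpos : 0 < η :=
    lt_min (by norm_num) (Real.sqrt_pos.2 (by positivity))
  have hη2 : η ≤ 1 / 2 := min_le_left _ _
  have hlampos : 0 < lam :=
    lt_min (by positivity) (Real.sqrt_pos.2 (by positivity))
  have hlamH : lam * H ≤ 1 := by
    have : lam ≤ 1 / H := min_le_left _ _
    rwa [le_div_iff₀ (by linarith)] at this
  -- the comparator
  set p := M.visitProb (M.det π) M.s₀ with hp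
  have hprule : ∀ i : ℕ, M.IsRule ((fun _ : ℕ => M.det π) i) := fun _ => isRule_det hπ.1
  have hplaw : p = M.law (fun _ => M.det π) M.s₀ := by
    ext1 i; exact visitProb_eq_law _ _ i
  have hp0 : ∀ i y, 0 ≤ p i y := visitProb_det_nonneg hπ.1 _
  have hp1 : ∀ i, ∑ y, p i y ≤ 1 := fun i => by rw [hplaw]; exact (sum_law hprule _ i).le
  set σ := M.surv π (H₁ - 1) M.s₀ with hσ
  have hσ0 : 0 ≤ σ := surv_nonneg _ _
  have hσle : σ ≤ 2 / (K : ℝ) ^ 2 := surv_tMax_le hπ hK2' hH₁ h0 _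
  have hH₂K : 2 * (H₂ : ℝ) ≤ (K : ℝ) ^ 2 := by exact_mod_cast hK2
  -- The mass of the comparator in the `H₂` fast layers. It is covered by the slack `1` in `T ≥ T⋆ +
  -- 1`, and this is where `2 H₂ ≤ K²` enters.
  have hH₂σ : H₂ * σ ≤ 1 := by
    calc H₂ * σ ≤ H₂ * (2 / (K : ℝ) ^ 2) := by gcongr
      _ = 2 * H₂ / (K : ℝ) ^ 2 := by ring
      _ ≤ 1 := by rw [div_le_one (by positivity)]; exact hH₂K
  have hKσ : K * σ ≤ 1 := by
    calc K * σ ≤ K * (2 / (K : ℝ) ^ 2) := by gcongr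
      _ = 2 / K := by field_simp
      _ ≤ 1 := by rw [div_le_one (by positivity)]; exact hKr
  have hHeq : (H : ℝ) = H₁ + H₂ := by rw [hH]; push_cast; ring
  have hsurvsum : ∑ j ∈ Finset.range H₁, M.surv π j M.s₀ ≤ M.tStar π := by
    rw [tStar_eq hπ]
    exact (summable_surv hπ _).sum_le_tsum _ fun i _ => surv_nonneg i _
  have hmass : ∑ w, embed H₁ H p w ≤ T := by
    have h := sum_layerCost_visitProb hπ.1 H₁ H₂ (fun _ => 1) fun _ => 1
    simp only [one_mul, Finset.sum_const, Finset.card_range, nsmul_eq_mul, mul_one] at h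
    rw [sum_embed, hH, h]
    have hs : ∑ j ∈ Finset.range H₁, M.iter π j (fun _ => 1) M.s₀ ≤ M.tStar π := hsurvsum
    linarith
  have hpocc : embed H₁ H p ∈ (M.loopFree H₁ H).occ T := by
    rw [hplaw] at hmass ⊢
    exact embed_law_mem_occ h0 hprule hmass
  set C : Γ → ℝ := fun z => ∑ k ∈ Finset.range K, c k z with hC
  have hC0 : ∀ z, 0 ≤ C z := fun z =>
    Finset.sum_nonneg fun k hk => (hc k (Finset.mem_range.1 hk) z).1
  have hCK : ∀ z, C z ≤ K := fun z => by
    have := Finset.sum_le_sum fun k (hk : k ∈ Finset.range K) =>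
      (hc k (Finset.mem_range.1 hk) z).2
    simpa [hC] using this
  set J := M.val π (fun s => C (π s)) M.s₀ with hJ
  have htot : ∀ π' ∈ M.proper, M.totalCostToGo K c π'
      = ENNReal.ofReal (M.val π' (fun s => C (π' s)) M.s₀) := fun π' hπ' =>
    totalCostToGo_eq hπ' fun k hk z => (hc k hk z).1
  have hJbest : ∀ π' ∈ M.proper, J ≤ M.val π' (fun s => C (π' s)) M.s₀ := by
    intro π' hπ'
    have h := hbest.2 π' hπ'
    rw [htot π hπ, htot π' hπ'] at h
    exact (ENNReal.ofReal_le_ofReal_iff (val_nonneg (fun s => hC0 _) _)).1 h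
  have hJ0 : 0 ≤ J := val_nonneg (fun s => hC0 _) _
  have hJD : J ≤ D * K := by
    refine (hJbest πf hfast.1).trans ((val_mono hfast.1 (fun s => hC0 _) (g := fun _ => (K : ℝ))
      (fun s => hCK _) _).trans ?_)
    rw [val_const, mul_comm]
    exact mul_le_mul_of_nonneg_right (val_le_diameter hfast _) (by positivity)
  have hswap : ∀ g : ℕ → ℝ, ∑ k ∈ Finset.range K, ∑ j ∈ Finset.range H,
      g j * layerCost H₁ p (c k) j
      = ∑ j ∈ Finset.range H₁, g j * M.iter π j (fun s => C (π s)) M.s₀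
        + K * ((∑ i ∈ Finset.range H₂, g (H₁ + i)) * σ) := by
    intro g
    have h : ∀ k, ∑ j ∈ Finset.range H, g j * layerCost H₁ p (c k) j
        = ∑ j ∈ Finset.range H₁, g j * M.iter π j (fun s => c k (π s)) M.s₀
          + (∑ i ∈ Finset.range H₂, g (H₁ + i)) * σ := fun k => by
      rw [hH]; exact sum_layerCost_visitProb hπ.1 H₁ H₂ (c k) g
    simp_rw [h]
    rw [Finset.sum_add_distrib, Finset.sum_const, Finset.card_range, nsmul_eq_mul,
      Finset.sum_comm]
    congr 1
    refine Finset.sum_congr rfl fun j _ => ?_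
    rw [← Finset.mul_sum, hC, iter_fun_sum]
  set B := ∑ k ∈ Finset.range K, ∑ j ∈ Finset.range H, layerCost H₁ p (c k) j with hB
  set Bh := ∑ k ∈ Finset.range K, ∑ j ∈ Finset.range H,
    ((j : ℝ) + 1) * layerCost H₁ p (c k) j with hBh
  have hBle : B ≤ J + 2 * H := by
    have h := hswap fun _ => 1
    simp only [one_mul, Finset.sum_const, Finset.card_range, nsmul_eq_mul, mul_one] at h
    rw [hB, h]
    have h1 : ∑ j ∈ Finset.range H₁, M.iter π j (fun s => C (π s)) M.s₀ ≤ J :=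
      (summable_iter hπ (fun s => hC0 _) _).sum_le_tsum _ fun i _ =>
        iter_nonneg (fun s => hC0 _) i _
    have h2 : K * (H₂ * σ) ≤ H₂ := by
      calc K * (H₂ * σ) = H₂ * (K * σ) := by ring
        _ ≤ H₂ * 1 := by gcongr
        _ = H₂ := mul_one _
    have : (0 : ℝ) ≤ H₁ := by positivity
    linarith
  have hBhle : Bh ≤ 3 * (D * T * K) + 2 * H * H := by
    rw [hBh, hswap fun j => (j : ℝ) + 1]
    have hH₁r : (1 : ℝ) ≤ H₁ := by exact_mod_cast h0
    -- All episodes are treated at once through the summed cost `C ≤ K`. The shift `ε = 1 / H₁`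
    -- makes the accumulated error `H₁ ε` equal to `1`.
    have h1 := weighted_cost_le hπ hfast.1 hC0 hCK hJbest (val_le_diameter hfast)
      (ε := 1 / H₁) (by positivity) H₁
    rw [← tStar_eq hπ] at h1
    have h2 : ((K + 1 / (H₁ : ℝ)) * D + H₁ * (1 / (H₁ : ℝ))) * M.tStar π
        ≤ 3 * (D * T * K) := by
      have e1 : (H₁ : ℝ) * (1 / (H₁ : ℝ)) = 1 := by field_simp
      have e2 : 1 / (H₁ : ℝ) ≤ 1 := by rw [div_le_one (by positivity)]; exact hH₁r
      rw [e1]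
      have e3 : (K + 1 / (H₁ : ℝ)) * D + 1 ≤ 3 * (D * K) := by
        have : (K + 1 / (H₁ : ℝ)) * D ≤ (K + 1) * D := by gcongr
        have h5 : D * 2 ≤ D * K := mul_le_mul_of_nonneg_left hKr (by linarith)
        linarith
      calc _ ≤ 3 * (D * K) * M.tStar π := by gcongr
        _ ≤ 3 * (D * K) * T := by gcongr; linarith
        _ = _ := by ring
    have h3 : ∑ i ∈ Finset.range H₂, (((H₁ + i : ℕ) : ℝ) + 1) ≤ H₂ * H := by
      have := Finset.sum_le_sum (s := Finset.range H₂) (f := fun i => ((H₁ + i : ℕ) : ℝ) + 1)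
        (g := fun _ => (H : ℝ)) fun i hi => by
          have hi := Finset.mem_range.1 hi
          have : H₁ + i + 1 ≤ H := by omega
          exact_mod_cast this
      simpa using this
    have h4 : K * ((∑ i ∈ Finset.range H₂, (((H₁ + i : ℕ) : ℝ) + 1)) * σ) ≤ 2 * H * H := by
      have hH₂H : (H₂ : ℝ) ≤ H := by rw [hHeq]; linarith
      calc _ ≤ K * ((H₂ * H) * σ) := by gcongr
        _ = (K * σ) * (H₂ * H) := by ring
        _ ≤ 2 * (H * H) := by gcongr; linarith
        _ = _ := by ring
    linarith
  -- the learner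
  set E := 1 / η * (8 * min T H * Real.log (Fintype.card Γ * H * T)) with hE
  have hE0 : 0 ≤ E := by
    have : 0 < min T (H : ℝ) := lt_min (by linarith) (by linarith)
    positivity
  have hq0 : q 0 = embed H₁ H (M.law (ρ 0) M.s₀) :=
    occ_eq_embed_law h0 (hrun.mem 0 hK) (hrun.follow 0 hK)
  have hEnt : entropy η (skew lam (embed H₁ H p)) - entropy η (skew lam (q 0)) ≤ E := by
    refine entropy_skew_diff_le hηpos hlampos.le hlamH hT2 hΓ hpocc (hrun.mem 0 hK) ?_ ?_
    · rw [sum_embed]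
      exact sum_layerCost_le hp0 hp1 (fun _ => le_rfl) H
    · rw [hq0, sum_embed]
      exact sum_layerCost_le (law_nonneg (hrule 0 hK) _) (fun i => (sum_law (hrule 0 hK) _ i).le)
        (fun _ => le_rfl) H
  have hocc := hrun.occupancy_regret h0 hK hηpos hη2 hlampos.le hlamH hrule hc hp0 hpocc hE0 hEnt
  rw [← hB, ← hBh] at hocc
  set Y := ∑ k ∈ Finset.range K, ∑ j ∈ Finset.range H, layerCost H₁ (pathInd (x k)) (c k) j
    with hY
  set A := ∑ k ∈ Finset.range K, ∑ j ∈ Finset.range H,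
    layerCost H₁ (M.law (ρ k) M.s₀) (c k) j with hA
  set Ah := ∑ k ∈ Finset.range K, ∑ j ∈ Finset.range H,
    ((j : ℝ) + 1) * layerCost H₁ (M.law (ρ k) M.s₀) (c k) j with hAh
  -- With `θ = λ / 2`, division by `θ` turns the variance proxy into exactly `λ Ah`, the term that
  -- the skewed mirror descent bound controls together with `A`.
  have hdev' : lam / 2 * Y - (lam / 2 * A + 2 * (lam / 2) ^ 2 * Ah) < Real.log (1 / (δ / 2)) := by
    convert hdev using 1
    simp only [deviation, hY, hA, hAh]
    rw [Finset.mul_sum, Finset.mul_sum, Finset.mul_sum, ← Finset.sum_add_distrib,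
      ← Finset.sum_sub_distrib]
  have hlogδ : Real.log (1 / (δ / 2)) = Real.log (1 / δ) + Real.log 2 := by
    rw [← Real.log_mul (by positivity) (by norm_num)]
    congr 1
    field_simp
  have hYle : Y ≤ A + lam * Ah + 2 * (Real.log (1 / δ) + Real.log 2) / lam := by
    have h1 : lam * (Y - A - lam * Ah) ≤ 2 * (Real.log (1 / δ) + Real.log 2) := by
      rw [← hlogδ]
      have e : lam * (Y - A - lam * Ah)
          = 2 * (lam / 2 * Y - (lam / 2 * A + 2 * (lam / 2) ^ 2 * Ah)) := by ring
      rw [e]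
      linarith
    have h2 : Y - A - lam * Ah ≤ 2 * (Real.log (1 / δ) + Real.log 2) / lam := by
      rw [le_div_iff₀ hlampos]; linarith
    linarith
  have hfinal := tuned_bound (D := D) (T := T) (K := K) (H := H) (η := η) (lam := lam) (B := B)
    (Bh := Bh) (E := E) (Y := Y) hD hT2 (by linarith) hHr hℓ₀ hℓ hL hLLam hLam1 rfl rfl hJD hBle hBhle rfl
    (by linarith)
  -- conversion to extended reals
  have hcost : (∑ k ∈ Finset.range K, ∑' i, ENNReal.ofReal (stepCost (c k) (x k i)))
      ≤ ENNReal.ofReal Y := by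
    rw [hY, ENNReal.ofReal_sum_of_nonneg]
    · exact Finset.sum_le_sum fun k hk => tsum_stepCost_le (hc k (Finset.mem_range.1 hk))
        (habs k (Finset.mem_range.1 hk)) (hreach k (Finset.mem_range.1 hk))
    · exact fun k hk => Finset.sum_nonneg fun j _ => layerCost_nonneg (pathInd_nonneg _)
        (fun z => (hc k (Finset.mem_range.1 hk) z).1) j
  have hY0 : 0 ≤ Y := Finset.sum_nonneg fun k hk => Finset.sum_nonneg fun j _ =>
    layerCost_nonneg (pathInd_nonneg _) (fun z => (hc k (Finset.mem_range.1 hk) z).1) j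
  rw [regret, htot π hπ]
  calc _ ≤ ((ENNReal.ofReal Y : ℝ≥0∞) : EReal) - ((ENNReal.ofReal J : ℝ≥0∞) : EReal) :=
        EReal.sub_le_sub (EReal.coe_ennreal_le_coe_ennreal_iff.2 hcost) le_rfl
    _ = ((Y - J : ℝ) : EReal) := by
        rw [EReal.coe_ennreal_ofReal, EReal.coe_ennreal_ofReal, max_eq_left hY0, max_eq_left hJ0,
          EReal.coe_sub]
    _ ≤ _ := EReal.coe_le_coe_iff.2 hfinal

end FinalBound

end SSP

/-! ### Assembly of the theorem. -/

namespace SSP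

/-- The three forms of the regret bound follow from the first one. -/
lemma regret_bounds_of_le {R : EReal} {C Λ D T Tstar K H ℓ : ℝ} (hC : 0 ≤ C) (hΛ : 0 ≤ Λ)
    (hD : 0 ≤ D) (hTs : 0 ≤ Tstar) (hK : 0 ≤ K) (hH : 0 ≤ H) (hℓ : 0 ≤ ℓ)
    (h : R ≤ ((C * Λ * (Real.sqrt (D * T * K * ℓ) + H * ℓ) : ℝ) : EReal)) :
    R ≤ ((3 * C * Λ ^ 1 * (Real.sqrt (D * T * K * ℓ) + H * ℓ) : ℝ) : EReal) ∧
    (H ^ 2 * ℓ ≤ D * T * K →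
      R ≤ ((3 * C * Λ ^ 1 * Real.sqrt (D * T * K * ℓ) : ℝ) : EReal)) ∧
    (H ^ 2 * ℓ ≤ D * T * K → T ≤ 2 * Tstar →
      R ≤ ((3 * C * Λ ^ 1 * Real.sqrt (D * Tstar * K * ℓ) : ℝ) : EReal)) := by
  have hCΛ : 0 ≤ C * Λ := mul_nonneg hC hΛ
  have hs := Real.sqrt_nonneg (D * T * K * ℓ)
  have hHℓ : H ^ 2 * ℓ ≤ D * T * K → H * ℓ ≤ Real.sqrt (D * T * K * ℓ) := by
    intro hle
    refine Real.le_sqrt_of_sq_le ?_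
    calc (H * ℓ) ^ 2 = H ^ 2 * ℓ * ℓ := by ring
      _ ≤ D * T * K * ℓ := mul_le_mul_of_nonneg_right hle hℓ
  refine ⟨h.trans (EReal.coe_le_coe_iff.2 ?_), fun hle => h.trans (EReal.coe_le_coe_iff.2 ?_),
    fun hle hT2 => h.trans (EReal.coe_le_coe_iff.2 ?_)⟩
  · have : 0 ≤ C * Λ * (Real.sqrt (D * T * K * ℓ) + H * ℓ) := by positivity
    rw [pow_one]
    linarith
  · have h1 := mul_le_mul_of_nonneg_left (hHℓ hle) hCΛ
    have h2 := mul_nonneg hCΛ hs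
    rw [pow_one]
    linarith
  · have h1 := mul_le_mul_of_nonneg_left (hHℓ hle) hCΛ
    -- `√2 ≤ 3/2`; together with the factor `2` from absorbing `H ℓ` this is the `3` in the
    -- statement.
    have h3 : Real.sqrt (D * T * K * ℓ) ≤ 3 / 2 * Real.sqrt (D * Tstar * K * ℓ) := by
      have e : 3 / 2 * Real.sqrt (D * Tstar * K * ℓ)
          = Real.sqrt ((3 / 2) ^ 2 * (D * Tstar * K * ℓ)) := by
        rw [Real.sqrt_mul (by norm_num : (0 : ℝ) ≤ (3 / 2) ^ 2) (D * Tstar * K * ℓ),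
          Real.sqrt_sq (by norm_num)]
      rw [e]
      refine Real.sqrt_le_sqrt ?_
      have h4 : T * (D * K * ℓ) ≤ 2 * Tstar * (D * K * ℓ) :=
        mul_le_mul_of_nonneg_right hT2 (by positivity)
      have h5 : 0 ≤ Tstar * (D * K * ℓ) := by positivity
      linarith
    have h2 := mul_le_mul_of_nonneg_left h3 hCΛ
    rw [pow_one]
    linarith

end SSP

theorem mainTheorem2 (δ₀ : ℝ) (hδ₀ : 0 < δ₀) (hδ₀' : δ₀ < 1) :
    ∃ C : ℝ, 0 < C ∧ ∃ p : ℕ,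
      ∀ (S : Type*) (Γ : Type*) [Fintype S] [DecidableEq S] [Fintype Γ] [DecidableEq Γ]
        (M : SSP S Γ) (_ : M.proper.Nonempty) (πf : S → Γ) (_ : M.IsFast πf)
        (K H₁ H : ℕ) [NeZero H] (T δ : ℝ) (_ : 0 < δ) (_ : δ ≤ δ₀)
        (_ : H = H₁ + M.fastHorizon K δ) (_ : 2 * M.fastHorizon K δ ≤ K ^ 2)
        (Ω : Type*) (m : MeasurableSpace Ω) (μ : Measure Ω) [IsProbabilityMeasure μ]
        (𝓕 : Filtration ℕ m) (c : ℕ → Ω → Γ → ℝ) (q : ℕ → Ω → Option Γ × Fin H → ℝ)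
        (ρ : ℕ → Ω → ℕ → Γ → ℝ) (X : ℕ → Ω → ℕ → Option Γ)
        (_ : M.IsInteraction μ 𝓕 K c ρ X)
        (_ : ∀ k < K, ∀ w, Measurable[𝓕 k] fun ω => q k ω w)
        (_ : ∀ ω, M.IsRun πf H₁ H T (M.learningRate T H K) (M.skewness T H K δ) K
          (fun k => c k ω) (fun k => q k ω) (fun k => ρ k ω)),
        ENNReal.ofReal (1 - δ) ≤ μ {ω | ∀ π : S → Γ, M.IsBest K (fun k => c k ω) π →
          M.tStar π + 1 ≤ T → 8 * M.tMax π * Real.log K ≤ H₁ →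
          -- the bound for every admissible choice of `T`
          M.regret K (fun k => c k ω) (fun k => X k ω) π ≤
            ((C * Real.log (Fintype.card Γ * H * T * K) ^ p *
              (Real.sqrt (M.diameter * T * K * Real.log (1 / δ)) + H * Real.log (1 / δ)) : ℝ) :
                EReal) ∧
          -- for `K` large, the second term is of lower order
          ((H : ℝ) ^ 2 * Real.log (1 / δ) ≤ M.diameter * T * K →
            M.regret K (fun k => c k ω) (fun k => X k ω) π ≤
              ((C * Real.log (Fintype.card Γ * H * T * K) ^ p *
                Real.sqrt (M.diameter * T * K * Real.log (1 / δ)) : ℝ) : EReal)) ∧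
          -- if `T` is tuned up to a constant, in particular if `T = T_⋆ + 1`
          ((H : ℝ) ^ 2 * Real.log (1 / δ) ≤ M.diameter * T * K → T ≤ 2 * M.tStar π →
            M.regret K (fun k => c k ω) (fun k => X k ω) π ≤
              ((C * Real.log (Fintype.card Γ * H * T * K) ^ p *
                Real.sqrt (M.diameter * M.tStar π * K * Real.log (1 / δ)) : ℝ) : EReal))} := by

  classical
  have hℓ₀ : 0 < Real.log (1 / δ₀) := Real.log_pos (by rw [lt_div_iff₀ hδ₀]; linarith)
  -- The factor `50 (1 + 1 / ℓ₀)` comes from `tuned_bound` with `ℓ₀ = ln (1 / δ₀)`, the factor `3`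
  -- from `regret_bounds_of_le`.
  refine ⟨3 * (50 * (1 + 1 / Real.log (1 / δ₀))), by positivity, 1, ?_⟩
  intro S Γ _ _ _ _ M _ πf hfast K H₁ H _ T δ hδ hδ' hH hK2 Ω m μ _ 𝓕 c q ρ X hI _ hrun
  have hδ1 : δ < 1 := hδ'.trans_lt hδ₀'
  have hℓ : Real.log (1 / δ₀) ≤ Real.log (1 / δ) :=
    Real.log_le_log (by positivity) (one_div_le_one_div_of_le hδ hδ')
  -- For `K = 0` the regret is `0`, and so is the bound, because `Real.log 0 = 0`.
  rcases Nat.eq_zero_or_pos K with rfl | hK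
  · refine le_trans ?_ (measure_mono (Set.subset_univ _ |>.trans fun ω _ => ?_) :
      μ Set.univ ≤ _)
    · rw [measure_univ]
      exact ENNReal.ofReal_le_one.2 (by linarith)
    · intro π _ _ _
      simp [SSP.regret, SSP.totalCostToGo]
  have hKr : (1 : ℝ) ≤ K := by exact_mod_cast hK
  have hD : 1 ≤ M.diameter :=
    (SSP.one_le_val_one hfast.1 M.s₀).trans (SSP.val_le_diameter hfast M.s₀)
  set G : Set Ω := {ω | ∀ π : S → Γ, M.IsBest K (fun k => c k ω) π →
      M.tStar π + 1 ≤ T → 8 * M.tMax π * Real.log K ≤ H₁ →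
      M.regret K (fun k => c k ω) (fun k => X k ω) π ≤
        ((50 * (1 + 1 / Real.log (1 / δ₀)) * Real.log (Fintype.card Γ * H * T * K) *
          (Real.sqrt (M.diameter * T * K * Real.log (1 / δ)) + H * Real.log (1 / δ)) : ℝ) :
            EReal)} with hG
  have hGle : ENNReal.ofReal (1 - δ) ≤ μ G := by
    by_cases hex : ∃ π : S → Γ, π ∈ M.proper ∧ M.tStar π + 1 ≤ T
    swap
    · have : G = Set.univ := Set.eq_univ_of_forall fun ω π hb hT _ => absurd ⟨π, hb.1, hT⟩ hex
      rw [this, measure_univ]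
      exact ENNReal.ofReal_le_one.2 (by linarith)
    obtain ⟨π₀, hπ₀, hT₀⟩ := hex
    have hT1 : 1 ≤ T := by
      have := SSP.val_nonneg (M := M) (π := π₀) (fun _ => zero_le_one) M.s₀
      rw [← SSP.tStar_eq hπ₀] at this
      linarith
    have hHr : (1 : ℝ) ≤ H := by exact_mod_cast NeZero.one_le
    set lam := M.skewness T H K δ with hlam
    have hlam0 : 0 ≤ lam := le_min (by positivity) (Real.sqrt_nonneg _)
    have hlamH : lam / 2 * H ≤ 1 := by
      have h1 : lam ≤ 1 / H := min_le_left _ _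
      rw [le_div_iff₀ (by linarith)] at h1
      linarith
    -- The exceptional events: a large deviation, an episode longer than `H`, and a trajectory that
    -- leaves the goal. They have measure at most `δ / 2`, `δ / 2` and `0`.
    set N₁ : Set Ω := {ω | Real.log (1 / (δ / 2)) ≤ ∑ k ∈ Finset.range K,
      M.deviation H₁ H (lam / 2) (c k ω) (ρ k ω) (X k ω)} with hN₁
    set N₂ : Set Ω := ⋃ k ∈ Finset.range K, {ω | X k ω H ≠ none} with hN₂
    set N₃ : Set Ω := ⋃ k ∈ Finset.range K,
      {ω | ¬ ∀ i, X k ω i = none → X k ω (i + 1) = none} with hN₃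
    have h1 : μ N₁ ≤ ENNReal.ofReal (δ / 2) :=
      hI.measure_deviation_ge_le H₁ H (by positivity) hlamH (by positivity)
    have h2 : μ N₂ ≤ ENNReal.ofReal (δ / 2) := by
      refine (measure_biUnion_finset_le _ _).trans ?_
      have hk : ∀ k ∈ Finset.range K, μ {ω | X k ω H ≠ none} ≤ ENNReal.ofReal (δ / (2 * K)) := by
        intro k hk
        rw [hH]
        exact hI.measure_not_reached_le (Finset.mem_range.1 hk) hfast.1.1
          (fun ω => (hrun ω).fast k (Finset.mem_range.1 hk)) _ (by positivity)
          (SSP.surv_fastHorizon_le hfast hK hδ)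
      refine (Finset.sum_le_sum hk).trans_eq ?_
      rw [Finset.sum_const, Finset.card_range, nsmul_eq_mul, ← ENNReal.ofReal_natCast,
        ← ENNReal.ofReal_mul (by positivity)]
      congr 1
      field_simp
    have h3 : μ N₃ = 0 := by
      refine (measure_biUnion_null_iff (Finset.countable_toSet _)).2 fun k hk => ?_
      exact ae_iff.1 (hI.ae_absorbing (Finset.mem_range.1 hk))
    have hcover : Set.univ ⊆ G ∪ (N₁ ∪ N₂ ∪ N₃) := by
      intro ω _
      by_cases hω : ω ∈ N₁ ∪ N₂ ∪ N₃
      · exact Or.inr hω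
      · refine Or.inl fun π hb hT hH₁ => ?_
        simp only [Set.mem_union, not_or] at hω
        obtain ⟨⟨hω1, hω2⟩, hω3⟩ := hω
        have hω2' : ∀ k < K, X k ω H = none := by
          intro k hk
          by_contra hcon
          exact hω2 (Set.mem_biUnion (Finset.mem_coe.2 (Finset.mem_range.2 hk)) hcon)
        have hω3' : ∀ k < K, ∀ i, X k ω i = none → X k ω (i + 1) = none := by
          intro k hk
          by_contra hcon
          exact hω3 (Set.mem_biUnion (Finset.mem_coe.2 (Finset.mem_range.2 hk)) hcon)
        exact SSP.regret_le_of_regular hfast hδ hδ1 hℓ₀ hℓ hH hK2 hK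
          (fun k hk => hI.cost_mem k hk ω) (fun k hk => hI.rule k hk ω) (hrun ω) hb hT hH₁
          (not_le.1 hω1) hω3' hω2'
    -- Subadditivity over a cover is enough, so measurability of `G` plays no role.
    have hone : 1 ≤ μ G + ENNReal.ofReal δ := by
      calc 1 = μ Set.univ := measure_univ.symm
        _ ≤ μ G + (μ N₁ + μ N₂ + μ N₃) := by
          refine (measure_mono hcover).trans ((measure_union_le _ _).trans ?_)
          gcongr
          refine (measure_union_le _ _).trans ?_
          gcongr
          exact measure_union_le _ _
        _ ≤ μ G + ENNReal.ofReal δ := by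
          gcongr
          rw [h3, add_zero]
          refine (add_le_add h1 h2).trans_eq ?_
          rw [← ENNReal.ofReal_add (by positivity) (by positivity), add_halves]
    rw [ENNReal.ofReal_sub _ hδ.le, ENNReal.ofReal_one]
    exact tsub_le_iff_right.2 hone
  refine hGle.trans (measure_mono fun ω hω π hb hT hH₁ => ?_)
  have hts : 1 ≤ M.tStar π := by rw [SSP.tStar_eq hb.1]; exact SSP.one_le_val_one hb.1 _
  have hHr : (1 : ℝ) ≤ H := by exact_mod_cast NeZero.one_le
  have hΓ : (1 : ℝ) ≤ Fintype.card Γ := by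
    exact_mod_cast (Fintype.card_pos_iff.2 ⟨π M.s₀⟩ : 0 < Fintype.card Γ)
  have hlog : 0 ≤ Real.log (Fintype.card Γ * H * T * K) :=
    Real.log_nonneg (one_le_mul_of_one_le_of_one_le (one_le_mul_of_one_le_of_one_le
      (one_le_mul_of_one_le_of_one_le hΓ hHr) (by linarith)) hKr)
  exact SSP.regret_bounds_of_le (by positivity) hlog (by linarith) (by linarith) (by linarith)
    (by linarith) (by linarith) (hω π hb hT hH₁)
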